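/- Let $d\ge 1$ be an integer, $1<p<\infty$, $0\le a<b<\infty$, and let $\Omega\subset\mathbb R^d$ be either $\{|x|<b\}$ or $\{a<|x|<b\}$. Let $\eta\in L^1_{\rm loc}([0,\infty))$ with $\eta\ge 0$ a.e. and $\eta=0$ a.e. outside $(a,b)$, and put $w(x)=\eta(|x|)$. Let $$I_p=\{r\in(a,b):\ \eta^{-1/(p-1)}\in L^1((r-\varepsilon,r+\varepsilon))\text{ for some }\varepsilon>0\},\qquad I_{\Omega,w}=\{x\in\Omega:\ |x|\in I_p\},$$ where $\eta^{-1/(p-1)}=+\infty$ where $\eta=0$. Assume that $\eta$ is finitely degenerate: $I_p=\bigcup_{i=1}^N(a_i,b_i)$ is a disjoint union of finitely many nonempty open intervals, $1\le N<\infty$. For $r<s$ put $J(r,s)=\int_{\{r<|y|<s\}}\big(|y|^{(d-1)p}w(y)\big)^{-1/(p-1)}\,dy$, and let $\hat w_p$ be the radial weight on $\Omega$ with $$\hat w_p(x)=\begin{cases}J\big(|x|,\tfrac{a_i+b_i}2\big)^{-1}& a_i<|x|\le\tfrac{3a_i+b_i}4,\\ J\big(\tfrac{3a_i+b_i}4,\tfrac{a_i+3b_i}4\big)^{-1}&\tfrac{3a_i+b_i}4<|x|\le\tfrac{a_i+3b_i}4,\\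 J\big(\tfrac{a_i+b_i}2,|x|\big)^{-1}&\tfrac{a_i+3b_i}4<|x|<b_i,\end{cases}$$ extended by limits to $|x|=a_i$ and $|x|=b_i$ (a null set), and by $0$ elsewhere. Let $X=L^p(\Omega,(\hat w_p)^{p-1})$ with its norm topology. Let $AC_r^d(\Omega)$ be the set of measurable $u:\Omega\to\mathbb R$ with $u\in W^{1,1}_{\rm loc}(I_{\Omega,w})$ such that $u(x)=v(|x|)$ on $I_{\Omega,w}$ for some absolutely continuous $v$ on $(a,b)$. Define $F:X\to[0,+\infty]$ by $F(u)=\int_\Omega|\nabla u|^p\,w\,dx$ if $u$ is (the class of) an element of $AC_r^d(\Omega)$ and $F(u)=+\infty$ otherwise. Here, since a class in $X$ is determined only on $I_{\Omega,w}$, $\nabla u$ denotes the a.e. gradient of $v(|x|)$ on $\{a<|x|<b\}$ ($w$ vanishes a.e. on the rest of $\Omega$), and if several $v$ are admissible the infimum of the integral over them is taken. Let $\overline F$ be the lower semicontinuous envelope of $F$ on $X$, i.e. the largest lower semicontinuous functional below $F$. Let $\mathrm{Dom}_{r,w}$ be the set of measurable $u:\Omega\to\mathbb R$ such that $u(x)=v(|x|)$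 on $I_{\Omega,w}$ for some $v\in W^{1,1}_{\rm loc}(I_p)$ with $\int_{I_p}r^{d-1}|v'(r)|^p\eta(r)\,dr<\infty$. Then $\mathrm{Dom}_{r,w}\subset X$, and, functions being identified with their classes in $X$, $$\{u\in X:\ \overline F(u)<+\infty\}=\mathrm{Dom}_{r,w}.$$ Moreover every $u\in\mathrm{Dom}_{r,w}$ belongs to $W^{1,1}_{\rm loc}(I_{\Omega,w})$, and $$\overline F(u)=\begin{cases}\displaystyle\int_{I_{\Omega,w}}|\nabla u|^p\,w\,dx&\text{if }u\in\mathrm{Dom}_{r,w},\\[1ex]+\infty&\text{if }u\in X\setminus\mathrm{Dom}_{r,w}.\end{cases}$$ -/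

import Mathlib

open Set MeasureTheory
open scoped ENNReal Topology ContDiff

noncomputable section

namespace RadialRelaxation

/-- The ambient space `ℝ^d` with its Euclidean norm. -/
abbrev Space (d : ℕ) : Type := EuclideanSpace ℝ (Fin d)

/-- `u` belongs to `W^{1,1}_loc(U)` and its weak gradient on the open set `U` is `G`:
both are locally integrable on `U`, and the integration by parts formula holds against every
test function in `C_c^∞(U)`, in every direction `e`. (For `E = ℝ`, `G` is the weak derivative.) -/
def HasWeakGradientOn {E : Type*} [NormedAddCommGroup E] [InnerProductSpace ℝ E]
    [FiniteDimensional ℝ E] [MeasurableSpace E] [BorelSpace E]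
    (u : E → ℝ) (G : E → E) (U : Set E) : Prop :=
  LocallyIntegrableOn u U ∧ LocallyIntegrableOn G U ∧
    ∀ φ : E → ℝ, ContDiff ℝ ∞ φ → HasCompactSupport φ → tsupport φ ⊆ U → ∀ e : E,
      ∫ x in U, u x * fderiv ℝ φ x e = - ∫ x in U, inner ℝ (G x) e * φ x

/-- The set `I_p` of the radii `r ∈ (a, b)` having a neighbourhood on which `η^{-1/(p-1)}` is
integrable. The power is taken in `[0, ∞]`, so that it is `+∞` where `η` vanishes. -/
def goodRadii (p : ℝ) (η : ℝ → ℝ) (a b : ℝ) : Set ℝ :=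
  {r | r ∈ Ioo a b ∧ ∃ ε > 0,
    ∫⁻ s in Ioo (r - ε) (r + ε), (ENNReal.ofReal (η s)) ^ (-(1 / (p - 1))) < ⊤}

/-- The set `S ⊆ ℝ` is the disjoint union of the nonempty open intervals `(α i, β i)`
(which are then the connected components of `S`). -/
structure IsIntervalDecomposition {ι : Type*} (S : Set ℝ) (α β : ι → ℝ) : Prop where
  lt : ∀ i, α i < β i
  disjoint : Pairwise fun i j => Disjoint (Ioo (α i) (β i)) (Ioo (α j) (β j))
  eq_iUnion : S = ⋃ i, Ioo (α i) (β i)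

/-- `I_{Ω,w} = {x ∈ Ω : |x| ∈ I_p}`, for `w = η(|·|)`. -/
def goodSet {d : ℕ} (p : ℝ) (η : ℝ → ℝ) (a b : ℝ) (Ω : Set (Space d)) : Set (Space d) :=
  {x | x ∈ Ω ∧ ‖x‖ ∈ goodRadii p η a b}

/-- The integral of `(|y|^{(d-1)p} w(y))^{-1/(p-1)}` over the shell `{r < |y| < s}`. -/
def shellIntegral (d : ℕ) (p : ℝ) (η : ℝ → ℝ) (r s : ℝ) : ℝ≥0∞ :=
  ∫⁻ y in {y : Space d | r < ‖y‖ ∧ ‖y‖ < s},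
    (ENNReal.ofReal (‖y‖ ^ (((d : ℝ) - 1) * p) * η ‖y‖)) ^ (-(1 / (p - 1)))

open Classical in
/-- The contribution of one component `(α, β)` to the auxiliary weight, as a function of
`r = |x|`. By monotone convergence, the values at the end points `r = α`, `r = β` are the limits
of the values at the points of the component. -/
def auxPiece (d : ℕ) (p : ℝ) (η : ℝ → ℝ) (α β r : ℝ) : ℝ≥0∞ :=
  if α ≤ r ∧ r ≤ (3 * α + β) / 4 then
    (shellIntegral d p η r ((α + β) / 2))⁻¹
  else if (3 * α + β) / 4 ≤ r ∧ r ≤ (α + 3 * β) / 4 then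
    (shellIntegral d p η ((3 * α + β) / 4) ((α + 3 * β) / 4))⁻¹
  else if (α + 3 * β) / 4 ≤ r ∧ r ≤ β then
    (shellIntegral d p η ((α + β) / 2) r)⁻¹
  else 0

/-- The auxiliary weight `ŵ_p`, for the decomposition of `I_p` into the intervals `(α i, β i)`;
it vanishes where `|x|` lies in none of the `[α i, β i]`. (The closed intervals overlap at most at
end points; the supremum only makes a choice on those spheres, which are Lebesgue null.) -/
def auxWeight {d : ℕ} {ι : Type*} (p : ℝ) (η : ℝ → ℝ) (α β : ι → ℝ) (x : Space d) : ℝ≥0∞ :=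
  ⨆ i, auxPiece d p η (α i) (β i) ‖x‖

/-- The measure `(ŵ_p)^{p-1} dx` on `Ω`. -/
def auxMeasure {d : ℕ} {ι : Type*} (p : ℝ) (η : ℝ → ℝ) (α β : ι → ℝ) (Ω : Set (Space d)) :
    Measure (Space d) :=
  (volume.restrict Ω).withDensity fun x => auxWeight p η α β x ^ (p - 1)

/-- `u` belongs to `AC_r^d(Ω)` with profile `v`: `u` is measurable on `Ω`, it belongs to
`W^{1,1}_loc(I_{Ω,w})`, and `u(x) = v(|x|)` on `I_{Ω,w}`, with `v` absolutely continuous on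
`(a, b)`. (A function is absolutely continuous on `(a, b)` exactly if it is on `(a, b)` the
restriction of a function absolutely continuous on `[a, b]`; the values of `v` outside `(a, b)`
play no role.) -/
def IsACrWithProfile {d : ℕ} (p : ℝ) (η : ℝ → ℝ) (a b : ℝ) (Ω : Set (Space d))
    (u : Space d → ℝ) (v : ℝ → ℝ) : Prop :=
  AEStronglyMeasurable u (volume.restrict Ω) ∧
  (∃ G, HasWeakGradientOn u G (goodSet p η a b Ω)) ∧
  AbsolutelyContinuousOnInterval v a b ∧
  ∀ x ∈ goodSet p η a b Ω, u x = v ‖x‖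

/-- The energy `∫_Ω |∇(v(|x|))|^p w dx`. For absolutely continuous `v`, the function `v(|x|)` is
differentiable at almost every `x` with `a < |x| < b`, and `w` vanishes a.e. elsewhere. -/
def profileEnergy {d : ℕ} (p : ℝ) (η : ℝ → ℝ) (Ω : Set (Space d)) (v : ℝ → ℝ) : ℝ≥0∞ :=
  ∫⁻ x in Ω, ‖fderiv ℝ (fun y : Space d => v ‖y‖) x‖ₑ ^ p * ENNReal.ofReal (η ‖x‖)

/-- The space `X = L^p(Ω, (ŵ_p)^{p-1})`. -/
abbrev X {d : ℕ} {ι : Type*} (p : ℝ) (η : ℝ → ℝ) (α β : ι → ℝ) (Ω : Set (Space d)) :=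
  Lp ℝ (ENNReal.ofReal p) (auxMeasure p η α β Ω)

/-- The functional `F` on `X`: the energy `∫_Ω |∇u|^p w dx` if `f ∈ X` is the class of some
`u ∈ AC_r^d(Ω)`, and `+∞` (the infimum of the empty set) otherwise. A class `f` determines its
representatives and their profiles only on `I_{Ω,w}`; on the rest of `Ω`, the gradient is that of
the absolutely continuous profile, and the least value over the admissible representatives
and profiles is taken. -/
def F {d : ℕ} {ι : Type*} (p : ℝ) (η : ℝ → ℝ) (a b : ℝ) (α β : ι → ℝ) (Ω : Set (Space d))
    (f : X p η α β Ω) : ℝ≥0∞ :=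
  ⨅ (u : Space d → ℝ) (v : ℝ → ℝ) (_ : IsACrWithProfile p η a b Ω u v)
    (_ : f =ᵐ[auxMeasure p η α β Ω] u), profileEnergy p η Ω v

/-- The lower semicontinuous envelope: the largest lower semicontinuous function below `Φ`. -/
def lscEnvelope {Y : Type*} [TopologicalSpace Y] (Φ : Y → ℝ≥0∞) (y : Y) : ℝ≥0∞ :=
  ⨆ (Ψ : Y → ℝ≥0∞) (_ : LowerSemicontinuous Ψ) (_ : ∀ z, Ψ z ≤ Φ z), Ψ y

/-- The relaxed functional: the lower semicontinuous envelope of `F` for the norm topology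
of `X`. -/
def relaxedF {d : ℕ} {ι : Type*} (p : ℝ) [Fact (1 ≤ ENNReal.ofReal p)] (η : ℝ → ℝ) (a b : ℝ)
    (α β : ι → ℝ) (Ω : Set (Space d)) : X p η α β Ω → ℝ≥0∞ :=
  lscEnvelope (F p η a b α β Ω)

/-- The one dimensional class `Dom_η`: `v ∈ W^{1,1}_loc(I_p)` with
`∫_{I_p} r^{d-1} |v'(r)|^p η(r) dr < ∞`. -/
def DomEta (d : ℕ) (p : ℝ) (η : ℝ → ℝ) (a b : ℝ) (v : ℝ → ℝ) : Prop :=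
  ∃ g : ℝ → ℝ, HasWeakGradientOn v g (goodRadii p η a b) ∧
    ∫⁻ r in goodRadii p η a b, ENNReal.ofReal (r ^ (d - 1)) * ‖g r‖ₑ ^ p * ENNReal.ofReal (η r) < ⊤

/-- The class `Dom_{r,w}`: measurable functions on `Ω` with `u(x) = v(|x|)` on `I_{Ω,w}` for some
`v ∈ Dom_η`. -/
def Dom {d : ℕ} (p : ℝ) (η : ℝ → ℝ) (a b : ℝ) (Ω : Set (Space d)) : Set (Space d → ℝ) :=
  {u | AEStronglyMeasurable u (volume.restrict Ω) ∧
    ∃ v, DomEta d p η a b v ∧ ∀ x ∈ goodSet p η a b Ω, u x = v ‖x‖}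

/-- The elements of `X` that are classes of functions in `Dom_{r,w}`. -/
def DomX {d : ℕ} {ι : Type*} (p : ℝ) (η : ℝ → ℝ) (a b : ℝ) (α β : ι → ℝ) (Ω : Set (Space d)) :
    Set (X p η α β Ω) :=
  {f | ∃ u ∈ Dom p η a b Ω, f =ᵐ[auxMeasure p η α β Ω] u}

end RadialRelaxation

end

/-! In polar coordinates the energy of a radial function with profile `v` is `c ∫ |v'|^p m dr`,
where `m(r) = r^{d-1} η(r)` and `c` is the surface measure of the unit sphere. The decisive quantity
is the conjugate weight `k = m^{-1/(p-1)}`, through Hölder's inequality `|v(y) - v(x)|^p ≤ (∫_x^y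
|v'|^p m) (∫_x^y k)^{p-1}`. On `I_p` the weight `k` is locally integrable, so bounded energy
controls increments of `v`. Near a radius of `(a, b)` outside `I_p` the integral of `k` is infinite,
and a transition of height one can be made with arbitrarily small energy. Hence the relaxed
functional sees only the energy on `I_p`, and the profiles on different components decouple. The
candidate limit is `weakEnergy`, the least energy on `I_p` among the locally absolutely continuous
profiles of a class.

Lower bound: `weakEnergy` lies below `F`, so it suffices that it is lower semicontinuous.
Convergence in `X` gives, for a subsequence, convergence almost everywhere on `I_p`, because the
auxiliary weight is positive there. Closedness of the energy sublevels is
`exists_isPrimitiveOn_of_ae_tendsto`. Hölder's inequality makes the derivatives equi-integrable on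
compact intervals, so the limit is locally absolutely continuous. Its energy is recovered without
weak compactness: the integral over `r` of `|v(r+h) - v(r)|^p (∫_r^{r+h} k)^{1-p}` is at most `h`
times the energy, this bound passes to the limit by Fatou's lemma, and the integrand divided by `h`
tends to `|v'|^p m` as `h → 0`.

Upper bound: a profile is first frozen near the end points of each component. This does not raise
the energy, and convergence in `X` follows by domination from the Hardy inequality `hardy`, for
which the auxiliary weight is designed. The frozen pieces, now bounded, are then joined across the
bad radii by cut-offs of vanishing energy (`exists_transition`, `exists_gluing`).

The resulting identity `relaxedF_eq_weakEnergy` is translated back to `Dom` by the du Bois-Reymond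
lemma, the weak gradient of a radial function, and the uniqueness of weak gradients. -/

namespace RadialRelaxation
open Filter

/-! ### Primitives and absolute continuity on open subsets of the line -/

/-- On every compact interval contained in `S`, `v` is a primitive of the integrable
function `g`. -/
def IsPrimitiveOn (v g : ℝ → ℝ) (S : Set ℝ) : Prop :=
  ∀ ⦃x y⦄, x ≤ y → Icc x y ⊆ S →
    IntervalIntegrable g volume x y ∧ v y - v x = ∫ t in x..y, g t

theorem absolutelyContinuousOnInterval_congr {v w : ℝ → ℝ} {x y : ℝ}
    (hv : AbsolutelyContinuousOnInterval v x y) (h : EqOn v w (uIcc x y)) :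
    AbsolutelyContinuousOnInterval w x y := by
  rw [absolutelyContinuousOnInterval_iff] at hv ⊢
  intro ε hε
  obtain ⟨δ, hδ, H⟩ := hv ε hε
  refine ⟨δ, hδ, fun E hE hlt => ?_⟩
  have := H E hE hlt
  rwa [Finset.sum_congr rfl fun i hi => by
    rw [h ((hE.1 i hi).1), h ((hE.1 i hi).2)]] at this

theorem exists_Icc_nhds_subset {S : Set ℝ} (hS : IsOpen S) {r : ℝ} (hr : r ∈ S) :
    ∃ δ > 0, Icc (r - δ) (r + δ) ⊆ S := by
  obtain ⟨δ, hδ, h⟩ := Metric.isOpen_iff.1 hS r hr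
  refine ⟨δ / 2, by positivity, fun t ht => h ?_⟩
  rw [Metric.mem_ball, Real.dist_eq, abs_lt]
  constructor <;> linarith [ht.1, ht.2]

namespace IsPrimitiveOn

variable {v g : ℝ → ℝ} {S S' : Set ℝ}

theorem mono (h : IsPrimitiveOn v g S) (hS : S' ⊆ S) : IsPrimitiveOn v g S' :=
  fun _ _ hxy hs => h hxy (hs.trans hS)

theorem intervalIntegrable (h : IsPrimitiveOn v g S) {x y : ℝ} (hs : uIcc x y ⊆ S) :
    IntervalIntegrable g volume x y := by
  rcases le_total x y with hxy | hxy
  · exact (h hxy (by rwa [uIcc_of_le hxy] at hs)).1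
  · exact (h hxy (by rwa [uIcc_of_ge hxy] at hs)).1.symm

theorem sub_eq (h : IsPrimitiveOn v g S) {x y : ℝ} (hs : uIcc x y ⊆ S) :
    v y - v x = ∫ t in x..y, g t := by
  rcases le_total x y with hxy | hxy
  · exact (h hxy (by rwa [uIcc_of_le hxy] at hs)).2
  · rw [intervalIntegral.integral_symm, ← (h hxy (by rwa [uIcc_of_ge hxy] at hs)).2]; ring

theorem absolutelyContinuousOnInterval (h : IsPrimitiveOn v g S) {x y : ℝ}
    (hs : uIcc x y ⊆ S) : AbsolutelyContinuousOnInterval v x y := by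
  have h1 := (h.intervalIntegrable hs).absolutelyContinuousOnInterval_intervalIntegral
    (left_mem_uIcc)
  have h2 : AbsolutelyContinuousOnInterval (fun _ : ℝ => v x) x y :=
    (LipschitzWith.const (v x)).lipschitzOnWith.absolutelyContinuousOnInterval
  refine absolutelyContinuousOnInterval_congr (h2.add h1) fun t ht => ?_
  have : uIcc x t ⊆ S := (uIcc_subset_uIcc_left ht).trans hs
  simp only [Pi.add_apply]
  rw [← h.sub_eq this]; ring

theorem continuousOn (h : IsPrimitiveOn v g S) (hS : IsOpen S) : ContinuousOn v S := by
  intro r hr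
  obtain ⟨δ, hδ, hs⟩ := exists_Icc_nhds_subset hS hr
  have hle : r - δ ≤ r + δ := by linarith
  have h1 := (h.absolutelyContinuousOnInterval (by rwa [uIcc_of_le hle])).continuousOn
  rw [uIcc_of_le hle] at h1
  exact (h1.continuousAt (Icc_mem_nhds (by linarith) (by linarith))).continuousWithinAt

end IsPrimitiveOn

theorem _root_.AbsolutelyContinuousOnInterval.isPrimitiveOn {v : ℝ → ℝ} {a b : ℝ} (hab : a ≤ b)
    (h : AbsolutelyContinuousOnInterval v a b) : IsPrimitiveOn v (deriv v) (Icc a b) := by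
  intro x y hxy hs
  have : AbsolutelyContinuousOnInterval v x y :=
    h.mono (by rwa [uIcc_of_le hxy, uIcc_of_le hab])
  exact ⟨this.intervalIntegrable_deriv, this.integral_deriv_eq_sub.symm⟩

/-- Lebesgue differentiation for a function integrable on the compact intervals in an open set. -/
theorem ae_hasDerivAt_integral_of_isOpen {f : ℝ → ℝ} {S : Set ℝ} (hS : IsOpen S)
    (hf : ∀ x y, x ≤ y → Icc x y ⊆ S → IntervalIntegrable f volume x y) :
    ∀ᵐ r, r ∈ S → HasDerivAt (fun t => ∫ s in r..t, f s) (f r) r := by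
  -- Rational end points leave only countably many intervals, so the exceptional null sets can be
  -- united.
  have key : ∀ q : ℚ × ℚ, ∀ᵐ r, Icc (q.1 : ℝ) q.2 ⊆ S → r ∈ Ioo (q.1 : ℝ) q.2 →
      HasDerivAt (fun t => ∫ s in r..t, f s) (f r) r := by
    intro q
    by_cases hq : Icc (q.1 : ℝ) q.2 ⊆ S
    · by_cases hle : (q.1 : ℝ) ≤ q.2
      · filter_upwards [(hf _ _ hle hq).ae_hasDerivAt_integral] with r hr _ hr'
        rw [uIcc_of_le hle] at hr
        exact hr (Ioo_subset_Icc_self hr') r (Ioo_subset_Icc_self hr')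
      · exact Eventually.of_forall fun r _ hr => absurd (hr.1.trans hr.2).le hle
    · exact Eventually.of_forall fun r h => absurd h hq
  rw [← ae_all_iff] at key
  filter_upwards [key] with r hr hrS
  obtain ⟨δ, hδ, hs⟩ := exists_Icc_nhds_subset hS hrS
  obtain ⟨q1, h1, h1'⟩ := exists_rat_btwn (show r - δ < r by linarith)
  obtain ⟨q2, h2, h2'⟩ := exists_rat_btwn (show r < r + δ by linarith)
  exact hr (q1, q2) ((Icc_subset_Icc h1.le h2'.le).trans hs) ⟨h1', h2⟩

theorem IsPrimitiveOn.ae_hasDerivAt {v g : ℝ → ℝ} {S : Set ℝ} (hS : IsOpen S)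
    (h : IsPrimitiveOn v g S) : ∀ᵐ r, r ∈ S → HasDerivAt v (g r) r := by
  filter_upwards [ae_hasDerivAt_integral_of_isOpen hS fun x y hxy hs => (h hxy hs).1] with r hr hrS
  have h1 := (hr hrS).const_add (v r)
  refine h1.congr_of_eventuallyEq ?_
  obtain ⟨δ, hδ, hs⟩ := exists_Icc_nhds_subset hS hrS
  filter_upwards [Icc_mem_nhds (show r - δ < r by linarith) (show r < r + δ by linarith)] with t ht
  have : uIcc r t ⊆ Icc (r - δ) (r + δ) := by
    rw [← uIcc_of_le (show r - δ ≤ r + δ by linarith)]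
    apply uIcc_subset_uIcc <;> rw [uIcc_of_le (show r - δ ≤ r + δ by linarith)]
    · constructor <;> linarith
    · exact ht
  rw [← h.sub_eq (this.trans hs)]; ring

theorem IsPrimitiveOn.ae_eq_deriv {v g : ℝ → ℝ} {S : Set ℝ} (hS : IsOpen S)
    (h : IsPrimitiveOn v g S) : g =ᵐ[volume.restrict S] deriv v := by
  rw [EventuallyEq, ae_restrict_iff' hS.measurableSet]
  filter_upwards [h.ae_hasDerivAt hS] with r hr hrS using (hr hrS).deriv.symm

theorem IsPrimitiveOn.aestronglyMeasurable {v g : ℝ → ℝ} {S : Set ℝ} (hS : IsOpen S)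
    (h : IsPrimitiveOn v g S) : AEStronglyMeasurable g (volume.restrict S) :=
  (measurable_deriv v).aestronglyMeasurable.congr (h.ae_eq_deriv hS).symm

/-! ### The conjugate weight and Hölder's inequality -/

/-- The conjugate weight `m^{-1/(p-1)}`. -/
noncomputable def conjWeight (p : ℝ) (m : ℝ → ℝ≥0∞) (r : ℝ) : ℝ≥0∞ := m r ^ (-(1 / (p - 1)))

theorem measurable_conjWeight {p : ℝ} {m : ℝ → ℝ≥0∞} (hm : Measurable m) :
    Measurable (conjWeight p m) := hm.pow_const _

theorem conjWeight_ne_top_iff {p : ℝ} (hp : 1 < p) {m : ℝ → ℝ≥0∞} {r : ℝ} :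
    conjWeight p m r ≠ ⊤ ↔ m r ≠ 0 := by
  have : 0 < (p - 1)⁻¹ := inv_pos.2 (by linarith)
  simp [conjWeight, ENNReal.rpow_eq_top_iff, this, hp.le]

theorem conjWeight_ne_zero {p : ℝ} (hp : 1 < p) {m : ℝ → ℝ≥0∞} {r : ℝ} (h : m r ≠ ⊤) :
    conjWeight p m r ≠ 0 := by
  have : 0 < (p - 1)⁻¹ := inv_pos.2 (by linarith)
  simp [conjWeight, ENNReal.rpow_eq_zero_iff, this, hp.le, h]

theorem conjWeight_rpow_one_sub {p : ℝ} (hp : 1 < p) {m : ℝ → ℝ≥0∞} {r : ℝ} :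
    conjWeight p m r ^ (1 - p) = m r := by
  have : (p - 1) ≠ 0 := by linarith
  rw [conjWeight, ← ENNReal.rpow_mul, show -(1 / (p - 1)) * (1 - p) = 1 by field_simp; ring,
    ENNReal.rpow_one]

/-- The weighted Hölder inequality `(∫_A |g|)^p ≤ (∫_A |g|^p m) (∫_A m^{-1/(p-1)})^{p-1}`. -/
theorem lintegral_enorm_rpow_le {p : ℝ} (hp : 1 < p) {m : ℝ → ℝ≥0∞} (hm : Measurable m)
    (hm' : ∀ r, m r ≠ ⊤) {g : ℝ → ℝ} {A : Set ℝ} (hg : AEStronglyMeasurable g (volume.restrict A))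
    (hA : ∫⁻ r in A, conjWeight p m r ≠ ⊤) :
    (∫⁻ r in A, ‖g r‖ₑ) ^ p ≤
      (∫⁻ r in A, ‖g r‖ₑ ^ p * m r) * (∫⁻ r in A, conjWeight p m r) ^ (p - 1) := by
  have hp0 : 0 < p := by linarith
  have hp1 : p - 1 ≠ 0 := by linarith
  have hpq : p.HolderConjugate (p / (p - 1)) := by
    have := Real.HolderConjugate.conjExponent hp
    rwa [Real.conjExponent] at this
  have hk := measurable_conjWeight (p := p) hm
  -- The factors `m^{1/p}` and `k^{(p-1)/p}` cancel except where `m = 0`, that is `k = ∞`;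
  -- integrability of `k` makes this set null.
  have h1 : ∫⁻ r in A, ‖g r‖ₑ =
      ∫⁻ r in A, ((fun r => ‖g r‖ₑ * m r ^ (1 / p)) *
        fun r => conjWeight p m r ^ ((p - 1) / p)) r := by
    refine lintegral_congr_ae ?_
    filter_upwards [ae_lt_top hk hA] with r hr
    have h0 : m r ≠ 0 := (conjWeight_ne_top_iff hp).1 hr.ne
    simp only [Pi.mul_apply, conjWeight]
    rw [← ENNReal.rpow_mul, mul_assoc, ← ENNReal.rpow_add _ _ h0 (hm' r)]
    rw [show 1 / p + -(1 / (p - 1)) * ((p - 1) / p) = 0 by field_simp; ring]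
    simp
  rw [h1]
  have h2 := ENNReal.lintegral_mul_le_Lp_mul_Lq (volume.restrict A) hpq
    (f := fun r => ‖g r‖ₑ * m r ^ (1 / p)) (g := fun r => conjWeight p m r ^ ((p - 1) / p))
    (hg.enorm.mul (hm.pow_const _).aemeasurable) (hk.pow_const _).aemeasurable
  refine (ENNReal.rpow_le_rpow h2 hp0.le).trans (le_of_eq ?_)
  rw [ENNReal.mul_rpow_of_nonneg _ _ hp0.le, ← ENNReal.rpow_mul, ← ENNReal.rpow_mul]
  congr 1
  · rw [one_div_mul_cancel hp0.ne', ENNReal.rpow_one]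
    refine lintegral_congr fun r => ?_
    rw [ENNReal.mul_rpow_of_nonneg _ _ hp0.le, ← ENNReal.rpow_mul, one_div_mul_cancel hp0.ne',
      ENNReal.rpow_one]
  · rw [show 1 / (p / (p - 1)) * p = p - 1 by field_simp]
    congr 1
    refine lintegral_congr fun r => ?_
    rw [← ENNReal.rpow_mul, show (p - 1) / p * (p / (p - 1)) = 1 by field_simp, ENNReal.rpow_one]

/-- Increments of a primitive are controlled by the energy and the conjugate weight. -/
theorem IsPrimitiveOn.enorm_sub_rpow_le {p : ℝ} (hp : 1 < p) {m : ℝ → ℝ≥0∞} (hm : Measurable m)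
    (hm' : ∀ r, m r ≠ ⊤) {v g : ℝ → ℝ} {S : Set ℝ} (h : IsPrimitiveOn v g S) {x y : ℝ}
    (hxy : x ≤ y) (hs : Icc x y ⊆ S) (hA : ∫⁻ r in Ioc x y, conjWeight p m r ≠ ⊤) :
    ‖v y - v x‖ₑ ^ p ≤
      (∫⁻ r in Ioc x y, ‖g r‖ₑ ^ p * m r) * (∫⁻ r in Ioc x y, conjWeight p m r) ^ (p - 1) := by
  obtain ⟨h1, h2⟩ := h hxy hs
  rw [intervalIntegrable_iff_integrableOn_Ioc_of_le hxy] at h1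
  refine le_trans ?_ (lintegral_enorm_rpow_le hp hm hm' h1.aestronglyMeasurable hA)
  refine ENNReal.rpow_le_rpow ?_ (by linarith)
  rw [h2, intervalIntegral.integral_of_le hxy]
  exact enorm_integral_le_lintegral_enorm _

/-! ### Weighted difference quotients -/

theorem lintegral_Ioc_add (e : ℝ → ℝ≥0∞) (r h : ℝ) :
    ∫⁻ s in Ioc r (r + h), e s = ∫⁻ t in Ioc 0 h, e (r + t) := by
  rw [← lintegral_indicator measurableSet_Ioc, ← lintegral_indicator measurableSet_Ioc,
    ← lintegral_add_left_eq_self _ r]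
  refine lintegral_congr fun t => ?_
  have : r + t ∈ Ioc r (r + h) ↔ t ∈ Ioc 0 h := by simp [mem_Ioc]
  by_cases ht : t ∈ Ioc 0 h
  · rw [indicator_of_mem (this.2 ht), indicator_of_mem ht]
  · rw [indicator_of_notMem (mt this.1 ht), indicator_of_notMem ht]

theorem measurable_lintegral_Ioc_add {e : ℝ → ℝ≥0∞} (he : Measurable e) (h : ℝ) :
    Measurable fun r => ∫⁻ s in Ioc r (r + h), e s := by
  simp_rw [lintegral_Ioc_add]
  exact Measurable.lintegral_prod_right' (f := fun z : ℝ × ℝ => e (z.1 + z.2))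
    (he.comp (measurable_fst.add measurable_snd))

/-- Tonelli's theorem: each `s` lies in `(r, r + h]` for a set of `r` of length `h`. -/
theorem lintegral_lintegral_Ioc_add {e : ℝ → ℝ≥0∞} (he : Measurable e) (h : ℝ) :
    ∫⁻ r, ∫⁻ s in Ioc r (r + h), e s = ENNReal.ofReal h * ∫⁻ s, e s := by
  simp_rw [lintegral_Ioc_add]
  rw [lintegral_lintegral_swap]
  · simp_rw [lintegral_add_right_eq_self e]
    simp [mul_comm]
  · exact (he.comp (measurable_fst.add measurable_snd)).aemeasurable

open scoped Pointwise in
-- The complement is the Minkowski sum of the closed set `Sᶜ` and the compact interval `[-h, 0]`,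
-- hence closed.
theorem isOpen_setOf_Icc_add_subset {S : Set ℝ} (hS : IsOpen S) (h : ℝ) :
    IsOpen {r : ℝ | Icc r (r + h) ⊆ S} := by
  have h1 : IsClosed (Sᶜ + -Icc (0 : ℝ) h) :=
    hS.isClosed_compl.add_right_of_isCompact isCompact_Icc.neg
  convert h1.isOpen_compl using 1
  ext r
  simp only [mem_ofPred_eq, mem_compl_iff, Set.mem_add, not_exists, not_and]
  constructor
  · intro H s hs t ht hr
    refine hs (H ?_)
    simp only [Set.mem_neg, mem_Icc] at ht
    constructor <;> linarith [ht.1, ht.2]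
  · intro H s hs
    by_contra hsS
    refine H s hsS (r - s) ?_ (by ring)
    simp only [Set.mem_neg, mem_Icc]
    constructor <;> linarith [hs.1, hs.2]

theorem eventually_Icc_add_subset {S : Set ℝ} (hS : IsOpen S) {r : ℝ} (hr : r ∈ S) :
    ∀ᶠ h in 𝓝[>] (0 : ℝ), Icc r (r + h) ⊆ S := by
  obtain ⟨δ, hδ, hs⟩ := exists_Icc_nhds_subset hS hr
  filter_upwards [Ioo_mem_nhdsGT hδ] with h hh
  exact (Icc_subset_Icc (by linarith) (by linarith [hh.2])).trans hs

/-- Integrated form of the Hölder bound on the difference quotients of a primitive. -/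
theorem IsPrimitiveOn.lintegral_diff_le {p : ℝ} (hp : 1 < p) {m : ℝ → ℝ≥0∞} (hm : Measurable m)
    (hm' : ∀ r, m r ≠ ⊤) {v g : ℝ → ℝ} {S : Set ℝ} (hS : IsOpen S)
    (hk : ∀ x y, Icc x y ⊆ S → ∫⁻ r in Icc x y, conjWeight p m r ≠ ⊤)
    (hv : IsPrimitiveOn v g S) {h : ℝ} (hh : 0 < h) :
    ∫⁻ r in {r | Icc r (r + h) ⊆ S},
      ‖v (r + h) - v r‖ₑ ^ p * (∫⁻ s in Ioc r (r + h), conjWeight p m s) ^ (1 - p) ≤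
    ENNReal.ofReal h * ∫⁻ r in S, ‖g r‖ₑ ^ p * m r := by
  set e : ℝ → ℝ≥0∞ := S.indicator fun r => ‖deriv v r‖ₑ ^ p * m r with he
  have hem : Measurable e :=
    (((measurable_deriv v).enorm.pow_const _).mul hm).indicator hS.measurableSet
  have heS : ∫⁻ r, e r = ∫⁻ r in S, ‖g r‖ₑ ^ p * m r := by
    rw [he, lintegral_indicator hS.measurableSet]
    refine lintegral_congr_ae ?_
    filter_upwards [hv.ae_eq_deriv hS] with r hr
    rw [hr]
  have hD := (isOpen_setOf_Icc_add_subset hS h).measurableSet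
  rw [← heS, ← lintegral_lintegral_Ioc_add hem]
  refine (setLIntegral_mono' (g := fun r => ∫⁻ s in Ioc r (r + h), e s) hD ?_).trans
    (setLIntegral_le_lintegral _ _)
  intro r hr
  have hIoc : Ioc r (r + h) ⊆ S := Ioc_subset_Icc_self.trans hr
  have hfin : ∫⁻ s in Ioc r (r + h), conjWeight p m s ≠ ⊤ :=
    ne_top_of_le_ne_top (hk _ _ hr) (lintegral_mono_set Ioc_subset_Icc_self)
  have h1 := hv.enorm_sub_rpow_le hp hm hm' (by linarith) hr hfin
  have h2 : ∫⁻ s in Ioc r (r + h), ‖g s‖ₑ ^ p * m s = ∫⁻ s in Ioc r (r + h), e s := by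
    refine lintegral_congr_ae ?_
    filter_upwards [ae_restrict_of_ae_restrict_of_subset hIoc (hv.ae_eq_deriv hS),
      ae_restrict_mem measurableSet_Ioc] with s hs hs'
    rw [he, indicator_of_mem (hIoc hs'), hs]
  rw [h2] at h1
  -- Multiplication of Hölder's bound by `(∫ k)^{1-p}` cancels its second factor up to the
  -- inequality `x⁻¹ * x ≤ 1`, which also covers the values `0` and `∞`.
  refine (mul_le_mul_left h1 _).trans ?_
  rw [mul_assoc]
  refine mul_le_of_le_one_right' ?_
  rw [show (1 - p) = -(p - 1) by ring, ENNReal.rpow_neg]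
  exact ENNReal.mul_inv_le_one _

/-- The Hölder difference quotients converge to the energy density. -/
theorem IsPrimitiveOn.ae_tendsto_diff {p : ℝ} (hp : 1 < p) {m : ℝ → ℝ≥0∞} (hm : Measurable m)
    (hm' : ∀ r, m r ≠ ⊤) {v g : ℝ → ℝ} {S : Set ℝ} (hS : IsOpen S)
    (hk : ∀ x y, Icc x y ⊆ S → ∫⁻ r in Icc x y, conjWeight p m r ≠ ⊤)
    (hv : IsPrimitiveOn v g S) :
    ∀ᵐ r, r ∈ S → Tendsto (fun h => (ENNReal.ofReal h)⁻¹ * (‖v (r + h) - v r‖ₑ ^ p *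
      (∫⁻ s in Ioc r (r + h), conjWeight p m s) ^ (1 - p))) (𝓝[>] 0) (𝓝 (‖g r‖ₑ ^ p * m r)) := by
  have hkm := measurable_conjWeight (p := p) hm
  have hkfin : ∀ᵐ r, r ∈ S → conjWeight p m r ≠ ⊤ := by
    have key : ∀ q : ℚ × ℚ, ∀ᵐ r, Icc (q.1 : ℝ) q.2 ⊆ S → r ∈ Icc (q.1 : ℝ) q.2 →
        conjWeight p m r ≠ ⊤ := by
      intro q
      by_cases hq : Icc (q.1 : ℝ) q.2 ⊆ S
      · filter_upwards [(ae_restrict_iff' measurableSet_Icc).1 (ae_lt_top hkm (hk _ _ hq))]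
          with r hr _ hr' using (hr hr').ne
      · exact Eventually.of_forall fun r h => absurd h hq
    rw [← ae_all_iff] at key
    filter_upwards [key] with r hr hrS
    obtain ⟨δ, hδ, hs⟩ := exists_Icc_nhds_subset hS hrS
    obtain ⟨q1, h1, h1'⟩ := exists_rat_btwn (show r - δ < r by linarith)
    obtain ⟨q2, h2, h2'⟩ := exists_rat_btwn (show r < r + δ by linarith)
    exact hr (q1, q2) ((Icc_subset_Icc h1.le h2'.le).trans hs) ⟨h1'.le, h2.le⟩
  have hint : ∀ x y, x ≤ y → Icc x y ⊆ S →
      IntervalIntegrable (fun r => (conjWeight p m r).toReal) volume x y := by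
    intro x y hxy hs
    rw [intervalIntegrable_iff_integrableOn_Icc_of_le hxy]
    exact integrable_toReal_of_lintegral_ne_top hkm.aemeasurable (hk _ _ hs)
  filter_upwards [hv.ae_hasDerivAt hS, hkfin, ae_hasDerivAt_integral_of_isOpen hS hint]
    with r h1 h2 h3 hrS
  have hk0 : conjWeight p m r ≠ 0 := conjWeight_ne_zero hp (hm' r)
  have t0 : Tendsto (fun h : ℝ => r + h) (𝓝[>] 0) (𝓝[≠] r) := by
    refine tendsto_nhdsWithin_iff.2 ⟨?_, ?_⟩
    · have : Tendsto (fun h : ℝ => r + h) (𝓝 0) (𝓝 (r + 0)) :=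
        (continuous_const.add continuous_id).tendsto 0
      rw [add_zero] at this
      exact this.mono_left nhdsWithin_le_nhds
    · filter_upwards [self_mem_nhdsWithin] with h hh
      simpa using (ne_of_gt hh)
  have t1 : Tendsto (fun h => ENNReal.ofReal h⁻¹ * ‖v (r + h) - v r‖ₑ) (𝓝[>] 0) (𝓝 ‖g r‖ₑ) := by
    have := ((hasDerivAt_iff_tendsto_slope.1 (h1 hrS)).comp t0).enorm
    refine this.congr' ?_
    filter_upwards [self_mem_nhdsWithin] with h (hh : 0 < h)
    simp only [Function.comp, slope, add_sub_cancel_left, vsub_eq_sub, smul_eq_mul, enorm_mul]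
    rw [Real.enorm_eq_ofReal (inv_pos.2 hh).le]
  have t2 : Tendsto (fun h => ENNReal.ofReal h⁻¹ * ∫⁻ s in Ioc r (r + h), conjWeight p m s)
      (𝓝[>] 0) (𝓝 (conjWeight p m r)) := by
    have := (hasDerivAt_iff_tendsto_slope.1 (h3 hrS)).comp t0
    have := (ENNReal.continuous_ofReal.tendsto _).comp this
    rw [ENNReal.ofReal_toReal (h2 hrS)] at this
    refine this.congr' ?_
    filter_upwards [self_mem_nhdsWithin, eventually_Icc_add_subset hS hrS] with h (hh : 0 < h) hs
    simp only [Function.comp, slope, add_sub_cancel_left, vsub_eq_sub, smul_eq_mul,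
      intervalIntegral.integral_same, sub_zero]
    rw [ENNReal.ofReal_mul (inv_pos.2 hh).le]
    congr 1
    rw [intervalIntegral.integral_of_le (by linarith), integral_toReal hkm.aemeasurable,
      ENNReal.ofReal_toReal]
    · exact ne_top_of_le_ne_top (hk _ _ hs) (lintegral_mono_set Ioc_subset_Icc_self)
    · refine ae_lt_top hkm ?_
      exact ne_top_of_le_ne_top (hk _ _ hs) (lintegral_mono_set Ioc_subset_Icc_self)
  -- Since `h^{-1} = (h^{-1})^p (h^{-1})^{1-p}`, the quotient is the `p`-th power of the slope of
  -- `v` times the power `1 - p` of the mean of `k`. Both converge by Lebesgue differentiation, and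
  -- `k^{1-p} = m`.
  have t3 := ENNReal.Tendsto.mul ((ENNReal.continuous_rpow_const (y := p)).tendsto _ |>.comp t1)
    (Or.inr ?_) ((ENNReal.continuous_rpow_const (y := 1 - p)).tendsto _ |>.comp t2)
    (Or.inr ?_)
  · rw [conjWeight_rpow_one_sub hp] at t3
    refine t3.congr' ?_
    filter_upwards [self_mem_nhdsWithin, eventually_Icc_add_subset hS hrS] with h (hh : 0 < h) hs
    simp only [Function.comp]
    have e0 : ENNReal.ofReal h⁻¹ ≠ 0 := by simpa using hh
    have e1 : ENNReal.ofReal h⁻¹ ≠ ⊤ := ENNReal.ofReal_ne_top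
    rw [ENNReal.mul_rpow_of_nonneg _ _ (by linarith), ENNReal.mul_rpow_of_ne_top e1 ?_]
    · rw [mul_mul_mul_comm, ← ENNReal.rpow_add _ _ e0 e1]
      simp [ENNReal.ofReal_inv_of_pos hh]
    · exact ne_top_of_le_ne_top (hk _ _ hs) (lintegral_mono_set Ioc_subset_Icc_self)
  · rw [conjWeight_rpow_one_sub hp]; exact hm' r
  · exact ENNReal.rpow_ne_top_of_nonneg (by linarith) enorm_ne_top

/-! ### Closedness of the energy sublevels -/

/-- Bounded sequences have limits along ultrafilters. -/
theorem exists_tendsto_ultrafilter_of_bounded {f : ℕ → ℝ} {C : ℝ} (hf : ∀ n, |f n| ≤ C)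
    (U : Ultrafilter ℕ) : ∃ L, Tendsto f U (𝓝 L) := by
  obtain ⟨L, -, hL⟩ := (isCompact_Icc (a := -C) (b := C)).ultrafilter_le_nhds' (U.map f)
    (by
      rw [Ultrafilter.mem_map]
      exact Filter.univ_mem' fun n => abs_le.1 (hf n))
  exact ⟨L, hL⟩

/-- The bound is a single integral over the union of the intervals, whatever their number, so
equi-integrability of the derivatives yields absolute continuity uniformly along a sequence. -/
theorem IsPrimitiveOn.sum_dist_le {v g : ℝ → ℝ} {S : Set ℝ} (hv : IsPrimitiveOn v g S)
    {x y : ℝ} (hs : uIcc x y ⊆ S) {n : ℕ} {I : ℕ → ℝ × ℝ}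
    (hI : (n, I) ∈ AbsolutelyContinuousOnInterval.disjWithin x y) :
    ∑ i ∈ Finset.range n, dist (v (I i).1) (v (I i).2) ≤
      (∫⁻ r in ⋃ i ∈ Finset.range n, uIoc (I i).1 (I i).2, ‖g r‖ₑ).toReal := by
  obtain ⟨hI1, hI2⟩ := hI
  have hg := (hv.intervalIntegrable hs).def'
  have hsub : ∀ i ∈ Finset.range n, uIoc (I i).1 (I i).2 ⊆ uIoc x y := fun i hi =>
    AbsolutelyContinuousOnInterval.uIoc_subset_of_mem_disjWithin ⟨hI1, hI2⟩ (Finset.mem_range.1 hi)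
  have hgU : IntegrableOn g (⋃ i ∈ Finset.range n, uIoc (I i).1 (I i).2) :=
    hg.mono_set (iUnion₂_subset hsub)
  rw [← integral_norm_eq_lintegral_enorm hgU.aestronglyMeasurable,
    integral_biUnion_finset _ (by simp +contextual [uIoc]) hI2]
  · refine Finset.sum_le_sum fun i hi => ?_
    have h1 : uIcc (I i).1 (I i).2 ⊆ S :=
      (uIcc_subset_uIcc (hI1 i hi).1 (hI1 i hi).2).trans hs
    rw [dist_comm, Real.dist_eq, hv.sub_eq h1, intervalIntegral.abs_intervalIntegral_eq]
    exact abs_integral_le_integral_abs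
  · exact fun i hi => (hg.mono_set (hsub i hi)).norm

/-- Weak closedness of the energy sublevels: an almost everywhere limit of primitives of uniformly
bounded energy is almost everywhere a primitive, with the same energy bound. -/
theorem exists_isPrimitiveOn_of_ae_tendsto {p : ℝ} (hp : 1 < p) {m : ℝ → ℝ≥0∞} (hm : Measurable m)
    (hm' : ∀ r, m r ≠ ⊤) {S : Set ℝ} (hS : IsOpen S)
    (hk : ∀ x y, Icc x y ⊆ S → ∫⁻ r in Icc x y, conjWeight p m r ≠ ⊤)
    {v g : ℕ → ℝ → ℝ} (hv : ∀ n, IsPrimitiveOn (v n) (g n) S) {T : ℝ≥0∞} (hT : T ≠ ⊤)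
    (hE : ∀ n, ∫⁻ r in S, ‖g n r‖ₑ ^ p * m r ≤ T) {w : ℝ → ℝ}
    (hw : ∀ᵐ r, r ∈ S → Tendsto (fun n => v n r) atTop (𝓝 (w r))) :
    ∃ w' g', w' =ᵐ[volume.restrict S] w ∧ IsPrimitiveOn w' g' S ∧
      ∫⁻ r in S, ‖g' r‖ₑ ^ p * m r ≤ T := by
  have hp0 : 0 < p := by linarith
  have hkm := measurable_conjWeight (p := p) hm
  -- uniform integrability of the derivatives
  have hUI : ∀ n, ∀ x y, Icc x y ⊆ S → ∀ A ⊆ Icc x y,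
      ∫⁻ r in A, ‖g n r‖ₑ ≤ (T * (∫⁻ r in A, conjWeight p m r) ^ (p - 1)) ^ (1 / p) := by
    intro n x y hs A hA
    rw [one_div, ENNReal.le_rpow_inv_iff hp0]
    refine (lintegral_enorm_rpow_le hp hm hm'
      (((hv n).aestronglyMeasurable hS).mono_set (hA.trans hs))
      (ne_top_of_le_ne_top (hk _ _ hs) (lintegral_mono_set hA))).trans ?_
    gcongr
    exact (lintegral_mono_set (hA.trans hs)).trans (hE n)
  have hfin : ∀ x y, Icc x y ⊆ S → ∀ A ⊆ Icc x y,
      (T * (∫⁻ r in A, conjWeight p m r) ^ (p - 1)) ^ (1 / p) ≠ ⊤ := by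
    intro x y hs A hA
    refine ENNReal.rpow_ne_top_of_nonneg (by positivity) (ENNReal.mul_ne_top hT ?_)
    refine ENNReal.rpow_ne_top_of_nonneg (by linarith) ?_
    exact ne_top_of_le_ne_top (hk _ _ hs) (lintegral_mono_set hA)
  -- pointwise boundedness
  have hbd : ∀ r ∈ S, ∃ C, ∀ n, |v n r| ≤ C := by
    intro r hr
    obtain ⟨δ, hδ, hs⟩ := exists_Icc_nhds_subset hS hr
    -- An interval of positive length contains a point of convergence. The values there are bounded
    -- in `n`, and the increments from it to `r` are bounded by Hölder's inequality.
    obtain ⟨r', hr', ht⟩ : ∃ r' ∈ Icc r (r + δ), Tendsto (fun n => v n r') atTop (𝓝 (w r')) := by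
      by_contra! H
      have h0 : volume (Icc r (r + δ)) = 0 := by
        refine measure_mono_null (fun t ht => ?_) hw
        have : t ∈ S := hs ⟨by linarith [ht.1], ht.2⟩
        simpa [this] using H t ht
      simp [hδ.not_ge] at h0
    obtain ⟨C, hC⟩ := (Metric.isBounded_range_of_tendsto _ ht).exists_norm_le
    have hs' : Icc r r' ⊆ S := (Icc_subset_Icc (by linarith) hr'.2).trans hs
    refine ⟨C + ((T * (∫⁻ r in Ioc r r', conjWeight p m r) ^ (p - 1)) ^ (1 / p)).toReal,
      fun n => ?_⟩
    have h1 : |v n r' - v n r| ≤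
        ((T * (∫⁻ r in Ioc r r', conjWeight p m r) ^ (p - 1)) ^ (1 / p)).toReal := by
      rw [((hv n) hr'.1 hs').2, intervalIntegral.integral_of_le hr'.1]
      have h2 := enorm_integral_le_lintegral_enorm (μ := volume.restrict (Ioc r r')) (g n)
      have h3 := ENNReal.toReal_mono (hfin _ _ hs' _ Ioc_subset_Icc_self)
        (h2.trans (hUI n _ _ hs' _ Ioc_subset_Icc_self))
      rwa [toReal_enorm, Real.norm_eq_abs] at h3
    have h4 : |v n r'| ≤ C := hC _ (mem_range_self n)
    rw [abs_le] at h1 h4 ⊢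
    constructor <;> linarith [h1.1, h1.2, h4.1, h4.2]
  -- A limit along one ultrafilter exists at every point of `S` simultaneously, with no extraction
  -- of subsequences. Almost everywhere it is the given limit `w`.
  set U : Ultrafilter ℕ := hyperfilter ℕ
  have hU : (U : Filter ℕ) ≤ atTop := Nat.hyperfilter_le_atTop
  have hlim : ∀ r, ∃ L, r ∈ S → Tendsto (fun n => v n r) U (𝓝 L) := by
    intro r
    by_cases hr : r ∈ S
    · obtain ⟨C, hC⟩ := hbd r hr
      obtain ⟨L, hL⟩ := exists_tendsto_ultrafilter_of_bounded hC U
      exact ⟨L, fun _ => hL⟩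
    · exact ⟨0, fun h => absurd h hr⟩
  choose w' hw' using hlim
  have hww : ∀ᵐ r, r ∈ S → w' r = w r := by
    filter_upwards [hw] with r hr hrS
    exact tendsto_nhds_unique (hw' r hrS) ((hr hrS).mono_left hU)
  -- Sums of increments over disjoint intervals are bounded, independently of `n`, by a quantity
  -- involving only `T` and the integral of `k` over their union. The bound survives pointwise
  -- limits and tends to zero with the total length.
  have hAC : ∀ x y, x ≤ y → Icc x y ⊆ S → AbsolutelyContinuousOnInterval w' x y := by
    intro x y hxy hs
    let s := fun E : ℕ × (ℕ → ℝ × ℝ) ↦ ⋃ i ∈ Finset.range E.1, uIoc (E.2 i).1 (E.2 i).2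
    have hk' : ∫⁻ r in uIoc x y, conjWeight p m r ≠ ⊤ := by
      rw [uIoc_of_le hxy]
      exact ne_top_of_le_ne_top (hk _ _ hs) (lintegral_mono_set Ioc_subset_Icc_self)
    have h1 : Tendsto (fun i ↦ ∫⁻ r in s i, conjWeight p m r ∂volume.restrict (uIoc x y))
        (AbsolutelyContinuousOnInterval.totalLengthFilter ⊓
          𝓟 (AbsolutelyContinuousOnInterval.disjWithin x y)) (𝓝 0) :=
      tendsto_setLIntegral_zero hk'
        (AbsolutelyContinuousOnInterval.tendsto_volume_restrict_totalLengthFilter_disjWithin_nhds_zero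
          _ _)
    have h2 := (ENNReal.continuous_rpow_const (y := 1 / p)).tendsto _ |>.comp
      (ENNReal.Tendsto.const_mul (a := T)
        ((ENNReal.continuous_rpow_const (y := p - 1)).tendsto _ |>.comp h1) (Or.inr hT))
    rw [ENNReal.zero_rpow_of_pos (by linarith), mul_zero,
      ENNReal.zero_rpow_of_pos (by positivity)] at h2
    have h3 := ENNReal.toReal_zero ▸ (ENNReal.continuousAt_toReal (by simp)).tendsto.comp h2
    refine squeeze_zero' (Eventually.of_forall fun E =>
      Finset.sum_nonneg (fun _ _ ↦ dist_nonneg)) ?_ h3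
    have h4 : ∀ᶠ E in AbsolutelyContinuousOnInterval.totalLengthFilter ⊓
        𝓟 (AbsolutelyContinuousOnInterval.disjWithin x y),
        E ∈ AbsolutelyContinuousOnInterval.disjWithin x y :=
      eventually_inf_principal.mpr (by simp)
    filter_upwards [h4] with E hE
    have hsub : s E ⊆ uIoc x y :=
      AbsolutelyContinuousOnInterval.biUnion_uIoc_subset_of_mem_disjWithin hE
    have hsub' : s E ⊆ Icc x y := by
      rw [uIoc_of_le hxy] at hsub; exact hsub.trans Ioc_subset_Icc_self
    simp only [Function.comp]
    rw [Measure.restrict_restrict_of_subset hsub]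
    have hlim : Tendsto (fun n => ∑ i ∈ Finset.range E.1, dist (v n (E.2 i).1) (v n (E.2 i).2)) U
        (𝓝 (∑ i ∈ Finset.range E.1, dist (w' (E.2 i).1) (w' (E.2 i).2))) := by
      refine tendsto_finsetSum _ fun i hi => ?_
      have := hE.1 i hi
      rw [uIcc_of_le hxy] at this
      exact (hw' _ (hs this.1)).dist (hw' _ (hs this.2))
    refine le_of_tendsto hlim (Eventually.of_forall fun n => ?_)
    refine ((hv n).sum_dist_le (by rwa [uIcc_of_le hxy]) hE).trans ?_
    exact ENNReal.toReal_mono (hfin _ _ hs _ hsub') (hUI n _ _ hs _ hsub')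
  have hprim : IsPrimitiveOn w' (deriv w') S := fun x y hxy hs =>
    (hAC x y hxy hs).isPrimitiveOn hxy hxy Subset.rfl
  refine ⟨w', deriv w', (ae_restrict_iff' hS.measurableSet).2 hww, hprim, ?_⟩
  -- the difference quotients of the limit
  have hdiff : ∀ h > 0, ∫⁻ r in {r | Icc r (r + h) ⊆ S},
      ‖w' (r + h) - w' r‖ₑ ^ p * (∫⁻ s in Ioc r (r + h), conjWeight p m s) ^ (1 - p) ≤
      ENNReal.ofReal h * T := by
    intro h hh
    have hD := isOpen_setOf_Icc_add_subset hS h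
    have hmeas : ∀ n, AEMeasurable (fun r => ‖v n (r + h) - v n r‖ₑ ^ p *
        (∫⁻ s in Ioc r (r + h), conjWeight p m s) ^ (1 - p))
        (volume.restrict {r | Icc r (r + h) ⊆ S}) := by
      intro n
      have c1 : ContinuousOn (fun r => v n (r + h) - v n r) {r | Icc r (r + h) ⊆ S} := by
        refine ContinuousOn.sub ?_ ?_
        · exact ((hv n).continuousOn hS).comp (by fun_prop)
            fun r hr => hr ⟨by linarith, le_rfl⟩
        · exact ((hv n).continuousOn hS).mono fun r hr => hr ⟨le_rfl, by linarith⟩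
      exact ((c1.aemeasurable hD.measurableSet).enorm.pow_const _).mul
        ((measurable_lintegral_Ioc_add hkm h).pow_const _).aemeasurable
    have hshift : ∀ᵐ r, r + h ∈ S → Tendsto (fun n => v n (r + h)) atTop (𝓝 (w (r + h))) :=
      (measurePreserving_add_right volume h).quasiMeasurePreserving.ae hw
    have hshift' : ∀ᵐ r, r + h ∈ S → w' (r + h) = w (r + h) :=
      (measurePreserving_add_right volume h).quasiMeasurePreserving.ae hww
    -- Fatou's lemma as `n → ∞`, for fixed `h`.
    calc ∫⁻ r in {r | Icc r (r + h) ⊆ S},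
          ‖w' (r + h) - w' r‖ₑ ^ p * (∫⁻ s in Ioc r (r + h), conjWeight p m s) ^ (1 - p)
        = ∫⁻ r in {r | Icc r (r + h) ⊆ S}, liminf (fun n => ‖v n (r + h) - v n r‖ₑ ^ p *
          (∫⁻ s in Ioc r (r + h), conjWeight p m s) ^ (1 - p)) atTop := by
          refine lintegral_congr_ae ((ae_restrict_iff' hD.measurableSet).2 ?_)
          filter_upwards [hw, hww, hshift, hshift'] with r a1 a2 a3 a4 hr
          have m1 : r ∈ S := hr ⟨le_rfl, by linarith⟩
          have m2 : r + h ∈ S := hr ⟨by linarith, le_rfl⟩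
          -- Positivity of `k` makes the power `1 - p` of its integral finite, so multiplication by
          -- it preserves limits in `[0, ∞]`.
          have hne : ∫⁻ s in Ioc r (r + h), conjWeight p m s ≠ 0 := by
            rw [← pos_iff_ne_zero, setLIntegral_pos_iff hkm]
            have : (Function.support (conjWeight p m)) = univ := by
              ext s; simpa using conjWeight_ne_zero hp (hm' s)
            simp [this, hh]
          rw [a2 m1, a4 m2]
          refine (Tendsto.liminf_eq ?_).symm
          refine ENNReal.Tendsto.mul_const ?_ (Or.inr ?_)
          · exact (ENNReal.continuous_rpow_const.tendsto _).comp ((a3 m2).sub (a1 m1)).enorm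
          · rw [show (1 - p) = -(p - 1) by ring, ENNReal.rpow_neg]
            refine ENNReal.inv_ne_top.2 ?_
            simp [ENNReal.rpow_eq_zero_iff, hne]
            intro; linarith
      _ ≤ liminf (fun n => ∫⁻ r in {r | Icc r (r + h) ⊆ S}, ‖v n (r + h) - v n r‖ₑ ^ p *
          (∫⁻ s in Ioc r (r + h), conjWeight p m s) ^ (1 - p)) atTop :=
          lintegral_liminf_le' hmeas
      _ ≤ ENNReal.ofReal h * T := by
          refine (liminf_le_liminf (v := fun _ => ENNReal.ofReal h * T)
            (Eventually.of_forall fun n => ?_)).trans (by simp)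
          refine ((hv n).lintegral_diff_le hp hm hm' hS hk hh).trans ?_
          gcongr
          exact hE n
  set h : ℕ → ℝ := fun j => 1 / ((j : ℝ) + 1)
  have hh : ∀ j, 0 < h j := fun j => by positivity
  have hh0 : Tendsto h atTop (𝓝[>] 0) :=
    tendsto_nhdsWithin_iff.2 ⟨tendsto_one_div_add_atTop_nhds_zero_nat, Eventually.of_forall hh⟩
  have hD : ∀ j, MeasurableSet {r | Icc r (r + h j) ⊆ S} := fun j =>
    (isOpen_setOf_Icc_add_subset hS _).measurableSet
  set f : ℕ → ℝ → ℝ≥0∞ := fun j => {r | Icc r (r + h j) ⊆ S}.indicator fun r =>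
    (ENNReal.ofReal (h j))⁻¹ * (‖w' (r + h j) - w' r‖ₑ ^ p *
        (∫⁻ s in Ioc r (r + h j), conjWeight p m s) ^ (1 - p)) with hf
  have hfm : ∀ j, AEMeasurable (f j) (volume.restrict S) := by
    intro j
    refine AEMeasurable.mono_measure ?_ Measure.restrict_le_self
    rw [hf, aemeasurable_indicator_iff (hD j)]
    have c1 : ContinuousOn (fun r => w' (r + h j) - w' r) {r | Icc r (r + h j) ⊆ S} := by
      refine ContinuousOn.sub ?_ ?_
      · exact (hprim.continuousOn hS).comp (by fun_prop)
          fun r hr => hr ⟨by linarith [hh j], le_rfl⟩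
      · exact (hprim.continuousOn hS).mono fun r hr => hr ⟨le_rfl, by linarith [hh j]⟩
    exact (((c1.aemeasurable (hD j)).enorm.pow_const _).mul
      ((measurable_lintegral_Ioc_add hkm _).pow_const _).aemeasurable).const_mul _
  -- Fatou's lemma a second time, now along `h = 1 / (j + 1) → 0`.
  calc ∫⁻ r in S, ‖deriv w' r‖ₑ ^ p * m r
      = ∫⁻ r in S, liminf (fun j => f j r) atTop := by
        refine lintegral_congr_ae ((ae_restrict_iff' hS.measurableSet).2 ?_)
        filter_upwards [hprim.ae_tendsto_diff hp hm hm' hS hk] with r hr hrS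
        refine (Tendsto.liminf_eq (((hr hrS).comp hh0).congr' ?_)).symm
        filter_upwards [hh0.eventually (eventually_Icc_add_subset hS hrS)] with j hj
        simp only [hf, Function.comp]
        rw [indicator_of_mem (show r ∈ {r | Icc r (r + h j) ⊆ S} from hj)]
    _ ≤ liminf (fun j => ∫⁻ r in S, f j r) atTop := lintegral_liminf_le' hfm
    _ ≤ T := by
        refine (liminf_le_liminf (v := fun _ => T)
            (Eventually.of_forall fun j => ?_)).trans (by simp)
        refine (setLIntegral_le_lintegral _ _).trans ?_
        rw [hf, lintegral_indicator (hD j), lintegral_const_mul' _ _ (by simpa using hh j)]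
        refine (mul_le_mul_right (hdiff _ (hh j)) _).trans ?_
        rw [← mul_assoc, ENNReal.inv_mul_cancel (by simpa using hh j) ENNReal.ofReal_ne_top,
          one_mul]

/-! ### Transitions of small energy -/

/-- A bounded density on `U` of total mass one and small weighted energy, which exists as soon as
the conjugate weight is not integrable on `U`. -/
theorem exists_density_small_energy {p : ℝ} (hp : 1 < p) {m : ℝ → ℝ≥0∞} (hm : Measurable m)
    {U : Set ℝ} (hU : MeasurableSet U) (hUfin : volume U ≠ ⊤)
    (hk : ∫⁻ r in U, conjWeight p m r = ⊤) {ε : ℝ≥0∞} (hε : ε ≠ 0) :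
    ∃ h : ℝ → ℝ, (∀ r, 0 ≤ h r) ∧ (∀ r ∉ U, h r = 0) ∧ Integrable h ∧ ∫ r, h r = 1 ∧
      ∫⁻ r, ‖h r‖ₑ ^ p * m r ≤ ε := by
  have hp0 : 0 < p := by linarith
  have hkm := measurable_conjWeight (p := p) hm
  -- The density is the truncation `k_n = min(k, n)` on `U`, divided by its integral `I_n`. Its
  -- energy is at most `I_n^{-p} I_n = I_n^{1-p}`, which tends to zero because `I_n → ∞`.
  set k : ℕ → ℝ → ℝ≥0∞ := fun n => U.indicator fun r => min (conjWeight p m r) n with hkdef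
  have hkn : ∀ n, Measurable (k n) := fun n => (hkm.min measurable_const).indicator hU
  have hsup : Tendsto (fun n => ∫⁻ r, k n r) atTop (𝓝 ⊤) := by
    rw [← hk, ← lintegral_indicator hU]
    refine lintegral_tendsto_of_tendsto_of_monotone (fun n => (hkn n).aemeasurable) ?_ ?_
    · refine Eventually.of_forall fun r i j hij => ?_
      refine indicator_le_indicator ?_
      exact min_le_min_left _ (by exact_mod_cast hij)
    · refine Eventually.of_forall fun r => ?_
      by_cases hr : r ∈ U
      · simp only [hkdef, indicator_of_mem hr]
        have := (tendsto_const_nhds (x := conjWeight p m r)).min ENNReal.tendsto_nat_nhds_top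
        simpa using this
      · simp [hkdef, indicator_of_notMem hr]
  have hpow : Tendsto (fun n => (∫⁻ r, k n r) ^ (1 - p)) atTop (𝓝 0) := by
    have h1 := ((ENNReal.continuous_rpow_const (y := 1 - p)).tendsto ⊤).comp hsup
    rwa [ENNReal.top_rpow_of_neg (by linarith)] at h1
  -- The requirement that the integral exceed one serves only to make it nonzero.
  obtain ⟨n, h1, h2⟩ := ((hsup.eventually_const_lt (u := 1) (by simp)).and
    (hpow.eventually_le_const (pos_iff_ne_zero.2 hε))).exists
  set I := ∫⁻ r, k n r with hI
  have hI0 : I ≠ 0 := (zero_lt_one.trans h1).ne'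
  have hIfin : I ≠ ⊤ := by
    refine ne_top_of_le_ne_top (ENNReal.mul_ne_top (ENNReal.natCast_ne_top n) hUfin) ?_
    rw [hI, lintegral_indicator hU, ← setLIntegral_const]
    exact lintegral_mono fun r => min_le_right _ _
  have hkfin : ∀ r, k n r ≠ ⊤ := by
    intro r
    by_cases hr : r ∈ U
    · simp only [hkdef, indicator_of_mem hr]
      exact ne_top_of_le_ne_top (ENNReal.natCast_ne_top n) (min_le_right _ _)
    · simp [hkdef, indicator_of_notMem hr]
  have hen : ∀ r, ‖(k n r / I).toReal‖ₑ = k n r / I := fun r => by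
    rw [Real.enorm_eq_ofReal ENNReal.toReal_nonneg,
      ENNReal.ofReal_toReal (ENNReal.div_ne_top (hkfin r) hI0)]
  refine ⟨fun r => (k n r / I).toReal, fun r => ENNReal.toReal_nonneg, fun r hr => ?_, ?_, ?_, ?_⟩
  · simp [hkdef, indicator_of_notMem hr]
  · refine integrable_toReal_of_lintegral_ne_top ((hkn n).div_const _).aemeasurable ?_
    simp_rw [div_eq_mul_inv]
    rw [lintegral_mul_const _ (hkn n), ← hI, ENNReal.mul_inv_cancel hI0 hIfin]
    simp
  · rw [integral_toReal ((hkn n).div_const _).aemeasurable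
      (Eventually.of_forall fun r => (ENNReal.div_ne_top (hkfin r) hI0).lt_top)]
    simp_rw [div_eq_mul_inv]
    rw [lintegral_mul_const _ (hkn n), ← hI, ENNReal.mul_inv_cancel hI0 hIfin]
    simp
  · refine le_trans ?_ h2
    -- On `U`, `k_n^p m = k_n (k_n^{p-1} m) ≤ k_n`, because `k_n^{p-1} ≤ k^{p-1} = 1/m`.
    have h3 : ∀ r, ‖(k n r / I).toReal‖ₑ ^ p * m r ≤ I⁻¹ ^ p * k n r := by
      intro r
      rw [hen, div_eq_mul_inv, ENNReal.mul_rpow_of_nonneg _ _ hp0.le, mul_comm (k n r ^ p),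
        mul_assoc]
      gcongr
      have h4 : k n r ^ p = k n r * k n r ^ (p - 1) := by
        nth_rewrite 2 [← ENNReal.rpow_one (k n r)]
        rw [← ENNReal.rpow_add_of_nonneg _ _ zero_le_one (by linarith)]
        congr 1; ring
      rw [h4, mul_assoc]
      refine mul_le_of_le_one_right' ?_
      by_cases hr : r ∈ U
      · have h5 : k n r ≤ conjWeight p m r := by
          simp only [hkdef, indicator_of_mem hr]; exact min_le_left _ _
        have h6 : conjWeight p m r ^ (p - 1) = (m r)⁻¹ := by
          rw [show p - 1 = -(1 - p) by ring, ENNReal.rpow_neg, conjWeight_rpow_one_sub hp]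
        calc k n r ^ (p - 1) * m r ≤ conjWeight p m r ^ (p - 1) * m r := by
              gcongr
          _ ≤ 1 := by rw [h6]; exact ENNReal.inv_mul_le_one _
      · have : k n r = 0 := by simp [hkdef, indicator_of_notMem hr]
        rw [this, ENNReal.zero_rpow_of_pos (by linarith)]; simp
    refine (lintegral_mono h3).trans (le_of_eq ?_)
    rw [lintegral_const_mul _ (hkn n), ← hI, ENNReal.inv_rpow, ← ENNReal.rpow_neg]
    nth_rewrite 2 [← ENNReal.rpow_one I]
    rw [← ENNReal.rpow_add _ _ hI0 hIfin]
    congr 1; ring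

/-- An absolutely continuous transition from `0` to `1` near `c` with small energy. -/
theorem exists_transition {p : ℝ} (hp : 1 < p) {m : ℝ → ℝ≥0∞} (hm : Measurable m) {c δ : ℝ}
    (hk : ∫⁻ r in Ioo (c - δ) (c + δ), conjWeight p m r = ⊤) {ε : ℝ≥0∞} (hε : ε ≠ 0) :
    ∃ t h : ℝ → ℝ, IsPrimitiveOn t h univ ∧ (∀ r, t r ∈ Icc (0 : ℝ) 1) ∧
      (∀ r ≤ c - δ, t r = 0) ∧ (∀ r, c + δ ≤ r → t r = 1) ∧ (∀ r ∉ Ioo (c - δ) (c + δ), h r = 0) ∧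
      ∫⁻ r, ‖h r‖ₑ ^ p * m r ≤ ε := by
  obtain ⟨h, h0, hU, hint, h1, hE⟩ := exists_density_small_energy hp hm measurableSet_Ioo
    (by simp) hk hε
  refine ⟨fun r => ∫ s in Iic r, h s, h, ?_, fun r => ⟨?_, ?_⟩, ?_, ?_, hU, hE⟩
  · intro x y hxy _
    exact ⟨hint.intervalIntegrable, intervalIntegral.integral_Iic_sub_Iic hint.integrableOn
      hint.integrableOn⟩
  · exact integral_nonneg h0
  · rw [← h1]; exact setIntegral_le_integral hint (Eventually.of_forall h0)
  · intro r hr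
    refine (setIntegral_congr_fun measurableSet_Iic (g := fun _ => (0:ℝ)) fun s hs => ?_).trans
      (by simp)
    exact hU s fun hs' => by have := hs'.1; have : s ≤ r := hs; linarith
  · intro r hr
    rw [← h1]
    refine setIntegral_eq_integral_of_forall_compl_eq_zero fun s hs => ?_
    refine hU s fun hs' => hs ?_
    exact (hs'.2.trans_le hr).le

/-! ### Derivatives of radial functions and polar coordinates -/

theorem enorm_fderiv_comp_norm {E : Type*} [NormedAddCommGroup E]
    [InnerProductSpace ℝ E] (v : ℝ → ℝ) {x : E} (hx : x ≠ 0) :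
    ‖fderiv ℝ (fun y : E => v ‖y‖) x‖ₑ = ‖deriv v ‖x‖‖ₑ := by
  have : Nontrivial E := ⟨x, 0, hx⟩
  have hx' : ‖x‖ ≠ 0 := norm_ne_zero_iff.2 hx
  have hd : DifferentiableAt ℝ (fun y : E => ‖y‖) x := differentiableAt_id.norm ℝ hx
  by_cases hv : DifferentiableAt ℝ v ‖x‖
  · have := (hv.hasDerivAt.comp_hasFDerivAt x hd.hasFDerivAt).fderiv
    rw [show (fun y : E => v ‖y‖) = v ∘ fun y => ‖y‖ from rfl, this, enorm_smul]
    have h1 : ‖fderiv ℝ (fun y : E => ‖y‖) x‖ₑ = 1 := by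
      rw [← ofReal_norm, norm_fderiv_norm hd]; simp
    rw [h1, mul_one]
  -- The default value zero is taken on both sides: restriction to the ray through `x` recovers `v`,
  -- so differentiability of `v(|y|)` at `x` would force that of `v` at `|x|`.
  · rw [deriv_zero_of_not_differentiableAt hv, fderiv_zero_of_not_differentiableAt]
    · rw [← ofReal_norm, ← ofReal_norm, norm_zero, norm_zero]
    · intro h
      apply hv
      have hl : DifferentiableAt ℝ (fun r : ℝ => r • (‖x‖⁻¹ • x)) ‖x‖ := by fun_prop
      have hxx : ‖x‖ • (‖x‖⁻¹ • x) = x := by rw [smul_smul, mul_inv_cancel₀ hx', one_smul]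
      have h2 : DifferentiableAt ℝ ((fun y : E => v ‖y‖) ∘ fun r : ℝ => r • (‖x‖⁻¹ • x)) ‖x‖ := by
        refine DifferentiableAt.comp _ ?_ hl
        rwa [hxx]
      refine h2.congr_of_eventuallyEq ?_
      filter_upwards [lt_mem_nhds (norm_pos_iff.2 hx)] with r hr
      have h1 : ‖‖x‖⁻¹ • x‖ = 1 := by rw [norm_smul, norm_inv, norm_norm, inv_mul_cancel₀ hx']
      rw [Function.comp, norm_smul, h1, mul_one, Real.norm_eq_abs, abs_of_pos hr]

section Polar

variable {E : Type*} [NormedAddCommGroup E] [InnerProductSpace ℝ E]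
    [FiniteDimensional ℝ E] [MeasurableSpace E] [BorelSpace E]

/-- The surface measure of the unit sphere. -/
noncomputable def sphereMass (E : Type*) [NormedAddCommGroup E] [InnerProductSpace ℝ E]
    [FiniteDimensional ℝ E] [MeasurableSpace E] [BorelSpace E] : ℝ≥0∞ :=
  (volume : Measure E).toSphere univ

theorem sphereMass_ne_top : sphereMass E ≠ ⊤ := measure_ne_top _ _

variable [Nontrivial E]

theorem sphereMass_ne_zero : sphereMass E ≠ 0 := by
  rw [sphereMass, ne_eq, Measure.measure_univ_eq_zero]
  exact Measure.toSphere_ne_zero _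

/-- Integration of radial functions in polar coordinates. -/
theorem lintegral_comp_norm {f : ℝ → ℝ≥0∞} (hf : Measurable f) :
    ∫⁻ x : E, f ‖x‖ = sphereMass E *
      ∫⁻ r in Ioi 0, ENNReal.ofReal (r ^ (Module.finrank ℝ E - 1)) * f r := by
  have hmp := (volume : Measure E).measurePreserving_homeomorphUnitSphereProd
  have h1 : ∫⁻ x : E, f ‖x‖ = ∫⁻ x : ({0}ᶜ : Set E), f ‖x.1‖ ∂((volume : Measure E).comap (↑)) := by
    rw [lintegral_subtype_comap (measurableSet_singleton _).compl (fun x : E => f ‖x‖),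
      restrict_compl_singleton]
  have h2 := hmp.lintegral_comp (f := fun z => f z.2.1)
    (hf.comp (measurable_subtype_coe.comp measurable_snd))
  rw [h1]
  simp only [homeomorphUnitSphereProd_apply_snd_coe] at h2
  refine h2.trans ?_
  have hm2 : Measurable fun b : Metric.sphere (0 : E) 1 × Ioi (0 : ℝ) => f b.2 :=
    hf.comp (measurable_subtype_coe.comp measurable_snd)
  rw [lintegral_prod _ hm2.aemeasurable]
  simp only [lintegral_const]
  rw [mul_comm, sphereMass, Measure.volumeIoiPow, lintegral_withDensity_eq_lintegral_mul]
  · congr 1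
    rw [← lintegral_subtype_comap measurableSet_Ioi]
    rfl
  · fun_prop
  · exact hf.comp measurable_subtype_coe

theorem ae_comp_norm_of_ae {P : ℝ → Prop} (h : ∀ᵐ r ∂(volume.restrict (Ioi 0)), P r) :
    ∀ᵐ x : E, P ‖x‖ := by
  set N := toMeasurable (volume.restrict (Ioi 0)) {r | ¬ P r} with hN
  have hNm : MeasurableSet N := measurableSet_toMeasurable _ _
  have hN0 : volume.restrict (Ioi 0) N = 0 := by rw [hN, measure_toMeasurable]; exact h
  have h1 := lintegral_comp_norm (E := E) (f := N.indicator 1) (measurable_one.indicator hNm)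
  have h2 : ∫⁻ r in Ioi (0 : ℝ), ENNReal.ofReal (r ^ (Module.finrank ℝ E - 1)) *
      N.indicator 1 r = 0 := by
    rw [← setLIntegral_measure_zero N (fun r : ℝ =>
      ENNReal.ofReal (r ^ (Module.finrank ℝ E - 1))) hN0, ← lintegral_indicator hNm]
    refine lintegral_congr fun r => ?_
    by_cases hr : r ∈ N <;> simp [hr]
  have hmN : Measurable fun x : E => N.indicator (1 : ℝ → ℝ≥0∞) ‖x‖ :=
    (measurable_one.indicator hNm).comp measurable_norm
  rw [h2, mul_zero, lintegral_eq_zero_iff hmN] at h1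
  filter_upwards [h1] with x hx
  by_contra hP
  have : ‖x‖ ∈ N := subset_toMeasurable _ _ hP
  simp [this] at hx

/-- The polar formula is applied to the indicator of the exceptional radii, which is why the
property is required to be measurable. In the converse direction a null set of radii may simply be
enlarged to a measurable one. -/
theorem ae_of_ae_comp_norm {P : ℝ → Prop} (hP : MeasurableSet {r | P r})
    (h : ∀ᵐ x : E, P ‖x‖) : ∀ᵐ r ∂(volume.restrict (Ioi 0)), P r := by
  have hm : Measurable ({r | P r}ᶜ.indicator (1 : ℝ → ℝ≥0∞)) := measurable_one.indicator hP.compl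
  have h1 := lintegral_comp_norm (E := E) hm
  have h2 : ∫⁻ x : E, {r | P r}ᶜ.indicator (1 : ℝ → ℝ≥0∞) ‖x‖ = 0 := by
    have hm2 : Measurable fun x : E => {r | P r}ᶜ.indicator (1 : ℝ → ℝ≥0∞) ‖x‖ :=
      hm.comp measurable_norm
    rw [lintegral_eq_zero_iff hm2]
    filter_upwards [h] with x hx
    simp [hx]
  rw [h2, eq_comm, mul_eq_zero, or_iff_right sphereMass_ne_zero, lintegral_eq_zero_iff] at h1
  · filter_upwards [h1, ae_restrict_mem measurableSet_Ioi] with r hr (hr0 : 0 < r)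
    by_contra hPr
    simp [hPr] at hr
    have := pow_pos hr0 (Module.finrank ℝ E - 1)
    linarith
  · exact Measurable.mul (by fun_prop) hm

theorem quasiMeasurePreserving_norm (A : Set ℝ) :
    Measure.QuasiMeasurePreserving (fun x : E => ‖x‖)
      (volume.restrict {x : E | ‖x‖ ∈ A}) (volume.restrict A) := by
  refine ⟨measurable_norm, Measure.AbsolutelyContinuous.mk fun s hs h0 => ?_⟩
  rw [Measure.map_apply measurable_norm hs, Measure.restrict_apply (measurable_norm hs)]
  have h1 : ∀ᵐ r ∂(volume.restrict (Ioi 0)), r ∉ s ∩ A := by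
    rw [Measure.restrict_apply hs] at h0
    exact ae_restrict_of_ae (measure_eq_zero_iff_ae_notMem.1 h0)
  exact measure_eq_zero_iff_ae_notMem.2 (ae_comp_norm_of_ae (E := E) h1)

theorem setLIntegral_comp_norm {A : Set ℝ} (hA : MeasurableSet A) (hA0 : A ⊆ Ioi 0)
    {f : ℝ → ℝ≥0∞} (hf : AEMeasurable f (volume.restrict A)) :
    ∫⁻ x in {x : E | ‖x‖ ∈ A}, f ‖x‖ = sphereMass E *
      ∫⁻ r in A, ENNReal.ofReal (r ^ (Module.finrank ℝ E - 1)) * f r := by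
  have hA' : MeasurableSet {x : E | ‖x‖ ∈ A} := measurable_norm hA
  have e1 : ∫⁻ x in {x : E | ‖x‖ ∈ A}, f ‖x‖ = ∫⁻ x in {x : E | ‖x‖ ∈ A}, hf.mk f ‖x‖ :=
    lintegral_congr_ae ((quasiMeasurePreserving_norm A).ae hf.ae_eq_mk)
  have e2 := lintegral_comp_norm (E := E) (hf.measurable_mk.indicator hA)
  rw [e1, ← lintegral_indicator hA']
  refine Eq.trans (lintegral_congr fun x => ?_) (e2.trans ?_)
  · by_cases hx : ‖x‖ ∈ A <;> simp [indicator, hx]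
  · congr 1
    rw [← lintegral_indicator measurableSet_Ioi, ← lintegral_indicator hA]
    refine lintegral_congr_ae ?_
    filter_upwards [(ae_restrict_iff' hA).1 hf.ae_eq_mk] with r hr
    by_cases hrA : r ∈ A
    · rw [indicator_of_mem hrA, indicator_of_mem (hA0 hrA), indicator_of_mem hrA, hr hrA]
    · rw [indicator_of_notMem hrA]
      by_cases h0 : r ∈ Ioi (0 : ℝ)
      · rw [indicator_of_mem h0, indicator_of_notMem hrA, mul_zero]
      · rw [indicator_of_notMem h0]

end Polar

/-! ### Test functions and weak gradients -/

/-- Test functions on an open set. -/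
structure IsTestFunction {E : Type*} [NormedAddCommGroup E] [NormedSpace ℝ E] (φ : E → ℝ)
    (U : Set E) : Prop where
  contDiff : ContDiff ℝ ∞ φ
  compact : HasCompactSupport φ
  subset : tsupport φ ⊆ U

namespace IsTestFunction

variable {E : Type*} [NormedAddCommGroup E] [NormedSpace ℝ E] {φ : E → ℝ} {U : Set E}

theorem continuous (h : IsTestFunction φ U) : Continuous φ := h.contDiff.continuous

theorem continuous_fderiv (h : IsTestFunction φ U) (e : E) :
    Continuous fun x => fderiv ℝ φ x e :=
  (h.contDiff.continuous_fderiv (by simp)).clm_apply continuous_const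

theorem fderiv_eq_zero {x : E} (hx : x ∉ tsupport φ) (e : E) : fderiv ℝ φ x e = 0 := by
  rw [fderiv_of_notMem_tsupport ℝ hx]; rfl

end IsTestFunction

section WeakGradient

variable {E : Type*} [NormedAddCommGroup E] [InnerProductSpace ℝ E]
    [FiniteDimensional ℝ E] [MeasurableSpace E] [BorelSpace E]

theorem integrable_smul_of_locallyIntegrableOn {F : Type*} [NormedAddCommGroup F] [NormedSpace ℝ F]
    {f : E → F} {U K : Set E} (hf : LocallyIntegrableOn f U) (hK : IsCompact K) (hKU : K ⊆ U)
    {ψ : E → ℝ} (hψ : Continuous ψ) (hψK : ∀ x ∉ K, ψ x = 0) :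
    Integrable fun x => ψ x • f x := by
  have h1 : IntegrableOn f K := hf.integrableOn_compact_subset hKU hK
  obtain ⟨C, hC⟩ := hK.exists_bound_of_continuousOn hψ.continuousOn
  have h2 : IntegrableOn (fun x => ψ x • f x) K :=
    h1.bdd_smul C hψ.aestronglyMeasurable
      ((ae_restrict_iff' hK.measurableSet).2 (Eventually.of_forall hC))
  rwa [integrableOn_iff_integrable_of_support_subset] at h2
  intro x hx
  by_contra hxK
  exact hx (by simp [hψK x hxK])

namespace IsTestFunction

variable {φ : E → ℝ} {U : Set E}

theorem integrable_mul_fderiv (h : IsTestFunction φ U) {u : E → ℝ}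
    (hu : LocallyIntegrableOn u U) (e : E) :
    Integrable fun x => u x * fderiv ℝ φ x e := by
  have := integrable_smul_of_locallyIntegrableOn hu h.compact h.subset (h.continuous_fderiv e)
    fun x hx => IsTestFunction.fderiv_eq_zero hx e
  simpa only [smul_eq_mul, mul_comm] using this

theorem integrable_inner_mul (h : IsTestFunction φ U) {G : E → E}
    (hG : LocallyIntegrableOn G U) (e : E) :
    Integrable fun x => inner ℝ (G x) e * φ x := by
  have := (integrable_smul_of_locallyIntegrableOn hG h.compact h.subset h.continuous
    fun x hx => image_eq_zero_of_notMem_tsupport hx).inner_const e (𝕜 := ℝ)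
  refine this.congr (Eventually.of_forall fun x => ?_)
  simp only [inner_smul_left]
  rw [mul_comm]; simp

theorem setIntegral_mul_fderiv (u : E → ℝ) (e : E) {φ : E → ℝ} {V : Set E}
    (hV : tsupport φ ⊆ V) :
    ∫ x in V, u x * fderiv ℝ φ x e = ∫ x, u x * fderiv ℝ φ x e :=
  setIntegral_eq_integral_of_forall_compl_eq_zero fun x hx => by
    rw [IsTestFunction.fderiv_eq_zero (fun hx' => hx (hV hx')), mul_zero]

theorem setIntegral_inner_mul (G : E → E) (e : E) {φ : E → ℝ} {V : Set E}
    (hV : tsupport φ ⊆ V) :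
    ∫ x in V, inner ℝ (G x) e * φ x = ∫ x, inner ℝ (G x) e * φ x :=
  setIntegral_eq_integral_of_forall_compl_eq_zero fun x hx => by
    rw [image_eq_zero_of_notMem_tsupport (fun hx' => hx (hV hx')), mul_zero]

end IsTestFunction

/-- Test functions and their derivatives vanish off `U`, so the integrals may be taken over the
whole space. -/
theorem hasWeakGradientOn_iff {u : E → ℝ} {G : E → E} {U : Set E} :
    HasWeakGradientOn u G U ↔ LocallyIntegrableOn u U ∧ LocallyIntegrableOn G U ∧
      ∀ φ, IsTestFunction φ U → ∀ e : E,
        ∫ x, u x * fderiv ℝ φ x e = - ∫ x, inner ℝ (G x) e * φ x := by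
  refine and_congr_right fun _ => and_congr_right fun _ =>
    ⟨fun H φ h e => ?_, fun H φ a b c e => ?_⟩
  · rw [← IsTestFunction.setIntegral_mul_fderiv u e h.subset,
      ← IsTestFunction.setIntegral_inner_mul G e h.subset]
    exact H φ h.contDiff h.compact h.subset e
  · have h : IsTestFunction φ U := ⟨a, b, c⟩
    rw [IsTestFunction.setIntegral_mul_fderiv u e h.subset,
      IsTestFunction.setIntegral_inner_mul G e h.subset]
    exact H φ h e

theorem locallyIntegrableOn_iUnion {F : Type*} [NormedAddCommGroup F] {f : E → F} {ι : Type*}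
    {W : ι → Set E} (hW : ∀ i, IsOpen (W i)) (hf : ∀ i, LocallyIntegrableOn f (W i)) :
    LocallyIntegrableOn f (⋃ i, W i) := by
  intro x hx
  obtain ⟨i, hi⟩ := mem_iUnion.1 hx
  have := hf i x hi
  rw [(hW i).nhdsWithin_eq hi] at this
  exact this.filter_mono nhdsWithin_le_nhds

namespace HasWeakGradientOn

variable {u u' : E → ℝ} {G G' : E → E} {U V : Set E}

theorem mono (h : HasWeakGradientOn u G U) (hV : V ⊆ U) : HasWeakGradientOn u G V := by
  rw [hasWeakGradientOn_iff] at h ⊢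
  exact ⟨h.1.mono_set hV, h.2.1.mono_set hV,
    fun φ hφ e => h.2.2 φ ⟨hφ.1, hφ.2, hφ.3.trans hV⟩ e⟩

theorem congr (h : HasWeakGradientOn u G U) (hu : u =ᵐ[volume.restrict U] u')
    (hG : G =ᵐ[volume.restrict U] G') : HasWeakGradientOn u' G' U := by
  refine ⟨h.1.congr hu, h.2.1.congr hG, fun φ a b c e => ?_⟩
  have h1 := h.2.2 φ a b c e
  rw [integral_congr_ae (g := fun x => u' x * fderiv ℝ φ x e)
      (hu.mono fun x hx => by simp only [hx]),
    integral_congr_ae (f := fun x => inner ℝ (G x) e * φ x)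
      (g := fun x => inner ℝ (G' x) e * φ x) (hG.mono fun x hx => by simp only [hx])] at h1
  exact h1

/-- The weak gradient is unique up to null sets. -/
theorem ae_unique (hU : IsOpen U) (h : HasWeakGradientOn u G U) (h' : HasWeakGradientOn u G' U) :
    G =ᵐ[volume.restrict U] G' := by
  rw [hasWeakGradientOn_iff] at h h'
  have key : ∀ e : E, ∀ᵐ x, x ∈ U → inner ℝ (G x - G' x) e = 0 := by
    intro e
    refine hU.ae_eq_zero_of_integral_contDiff_smul_eq_zero ?_ fun φ a b c => ?_
    · intro x hx
      obtain ⟨s, hs, hint⟩ := (h.2.1.sub h'.2.1) x hx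
      exact ⟨s, hs, Integrable.inner_const hint e⟩
    · have hφ : IsTestFunction φ U := ⟨a, b, c⟩
      have e1 : ∀ x, φ x • inner ℝ (G x - G' x) e =
          inner ℝ (G x) e * φ x - inner ℝ (G' x) e * φ x := fun x => by
        rw [inner_sub_left, smul_eq_mul]; ring
      simp_rw [e1]
      rw [integral_sub (hφ.integrable_inner_mul h.2.1 e) (hφ.integrable_inner_mul h'.2.1 e)]
      have h1 := h.2.2 φ hφ e
      have h2 := h'.2.2 φ hφ e
      linarith
  have key2 : ∀ᵐ x, ∀ i, x ∈ U → inner ℝ (G x - G' x) (stdOrthonormalBasis ℝ E i) = 0 :=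
    ae_all_iff.2 fun i => key _
  rw [EventuallyEq, ae_restrict_iff' hU.measurableSet]
  filter_upwards [key2] with x hx hxU
  rw [← sub_eq_zero]
  rw [← (stdOrthonormalBasis ℝ E).sum_repr' (G x - G' x)]
  refine Finset.sum_eq_zero fun i _ => ?_
  rw [real_inner_comm, hx i hxU, zero_smul]

/-- Weak gradients on finitely many disjoint open sets. -/
theorem iUnion {ι : Type*} [Finite ι] {W : ι → Set E} (hW : ∀ i, IsOpen (W i))
    (hd : Pairwise fun i j => Disjoint (W i) (W j)) (h : ∀ i, HasWeakGradientOn u G (W i)) :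
    HasWeakGradientOn u G (⋃ i, W i) := by
  classical
  have := Fintype.ofFinite ι
  have hu := locallyIntegrableOn_iUnion hW fun i => (h i).1
  have hG := locallyIntegrableOn_iUnion hW fun i => (h i).2.1
  rw [hasWeakGradientOn_iff]
  refine ⟨hu, hG, fun φ hφ e => ?_⟩
  -- Removing the other open pieces from the support of `φ` leaves a closed set contained in `W i`.
  -- Hence `φ` cut off to `W i` vanishes near the boundary of `W i` and remains smooth.
  have htest : ∀ i, IsTestFunction ((W i).indicator φ) (W i) := by
    intro i
    have hclosed : IsClosed (tsupport φ \ ⋃ (j) (_ : j ≠ i), W j) :=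
      (isClosed_tsupport φ).sdiff (isOpen_iUnion fun j => isOpen_iUnion fun _ => hW j)
    have hsub : tsupport φ \ (⋃ (j) (_ : j ≠ i), W j) ⊆ W i := by
      rintro x ⟨hx, hx'⟩
      obtain ⟨j, hj⟩ := mem_iUnion.1 (hφ.subset hx)
      by_cases hji : j = i
      · exact hji ▸ hj
      · exact absurd (mem_iUnion₂.2 ⟨j, hji, hj⟩) hx'
    have hts : tsupport ((W i).indicator φ) ⊆ tsupport φ \ ⋃ (j) (_ : j ≠ i), W j := by
      refine closure_minimal (fun x hx => ?_) hclosed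
      have hxW : x ∈ W i := by
        by_contra hh; exact hx (indicator_of_notMem hh _)
      refine ⟨subset_tsupport _ ?_, ?_⟩
      · intro h0; exact hx (by rw [indicator_of_mem hxW, h0])
      · intro hx'
        obtain ⟨j, hji, hj⟩ := mem_iUnion₂.1 hx'
        exact (hd hji).le_bot ⟨hj, hxW⟩
    refine ⟨?_, ?_, hts.trans hsub⟩
    · rw [contDiff_iff_contDiffAt]
      intro x
      by_cases hx : x ∈ W i
      · refine hφ.contDiff.contDiffAt.congr_of_eventuallyEq ?_
        filter_upwards [(hW i).mem_nhds hx] with y hy using indicator_of_mem hy _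
      · refine (contDiffAt_const (c := (0 : ℝ))).congr_of_eventuallyEq ?_
        filter_upwards [(isClosed_tsupport ((W i).indicator φ)).isOpen_compl.mem_nhds
          (fun hx' => hx (hsub (hts hx')))] with y hy using image_eq_zero_of_notMem_tsupport hy
    · exact hφ.compact.of_isClosed_subset (isClosed_tsupport _) (hts.trans sdiff_subset)
  have hfd : ∀ i, ∀ x ∈ W i, fderiv ℝ φ x e = fderiv ℝ ((W i).indicator φ) x e := by
    intro i x hx
    congr 1
    refine Filter.EventuallyEq.fderiv_eq ?_
    filter_upwards [(hW i).mem_nhds hx] with y hy using (indicator_of_mem hy _).symm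
  rw [← IsTestFunction.setIntegral_mul_fderiv u e hφ.subset,
    ← IsTestFunction.setIntegral_inner_mul G e hφ.subset,
    integral_iUnion_fintype (fun i => (hW i).measurableSet) hd
      fun i => (hφ.integrable_mul_fderiv hu e).integrableOn,
    integral_iUnion_fintype (fun i => (hW i).measurableSet) hd
      fun i => (hφ.integrable_inner_mul hG e).integrableOn, ← Finset.sum_neg_distrib]
  refine Finset.sum_congr rfl fun i _ => ?_
  have h1 := (h i).2.2 _ (htest i).contDiff (htest i).compact (htest i).subset e
  rw [setIntegral_congr_fun (hW i).measurableSet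
    (g := fun x => u x * fderiv ℝ ((W i).indicator φ) x e)
    fun x hx => by simp only [hfd i x hx], h1]
  congr 1
  refine setIntegral_congr_fun (hW i).measurableSet fun x hx => ?_
  simp only [indicator_of_mem hx]

end HasWeakGradientOn

end WeakGradient

/-! ### Weak gradients of radial functions -/

theorem isOpen_norm_preimage {E : Type*} [NormedAddCommGroup E] {S : Set ℝ} (hS : IsOpen S) :
    IsOpen {x : E | ‖x‖ ∈ S} :=
  hS.preimage continuous_norm

theorem exists_Icc_of_isCompact_shell {E : Type*} [NormedAddCommGroup E] {K : Set E}
    (hK : IsCompact K)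
    {α β : ℝ} (hKS : K ⊆ {x : E | ‖x‖ ∈ Ioo α β}) (hne : K.Nonempty) :
    ∃ s t, s ≤ t ∧ Icc s t ⊆ Ioo α β ∧ K ⊆ {x : E | ‖x‖ ∈ Icc s t} := by
  obtain ⟨x, hx, hmin⟩ := hK.exists_isMinOn hne continuous_norm.continuousOn
  obtain ⟨y, hy, hmax⟩ := hK.exists_isMaxOn hne continuous_norm.continuousOn
  exact ⟨‖x‖, ‖y‖, hmin hy, fun r hr => ⟨(hKS hx).1.trans_le hr.1, hr.2.trans_lt (hKS hy).2⟩,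
    fun z hz => ⟨hmin hz, hmax hz⟩⟩

section Radial

variable {E : Type*} [NormedAddCommGroup E] [InnerProductSpace ℝ E]

/-- The radial vector field `g(|x|) x / |x|`. -/
noncomputable def radialField (g : ℝ → ℝ) (x : E) : E := g ‖x‖ • (‖x‖⁻¹ • x)

theorem enorm_radialField (g : ℝ → ℝ) {x : E} (hx : x ≠ 0) : ‖radialField g x‖ₑ = ‖g ‖x‖‖ₑ := by
  have h1 : ‖‖x‖⁻¹ • x‖ₑ = 1 := by
    rw [← ofReal_norm, norm_smul, norm_inv, norm_norm, inv_mul_cancel₀ (norm_ne_zero_iff.2 hx)]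
    simp
  rw [radialField, enorm_smul, h1, mul_one]

theorem radialField_sub (g h : ℝ → ℝ) (x : E) :
    radialField g x - radialField h x = radialField (fun r => g r - h r) x := by
  simp only [radialField, sub_smul]

theorem fderiv_comp_norm_apply {v : ℝ → ℝ} {x : E} (hx : x ≠ 0)
    (hv : DifferentiableAt ℝ v ‖x‖) (e : E) :
    DifferentiableAt ℝ (fun y : E => v ‖y‖) x ∧
    fderiv ℝ (fun y : E => v ‖y‖) x e = inner ℝ (radialField (deriv v) x) e := by
  have hx' : ‖x‖ ≠ 0 := norm_ne_zero_iff.2 hx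
  have hd : HasFDerivAt (fun y : E => ‖y‖) ((1 / (2 * ‖x‖)) • (2 • innerSL ℝ x)) x := by
    have h1 := (hasStrictFDerivAt_norm_sq x).hasFDerivAt.sqrt (by positivity)
    simpa [Real.sqrt_sq] using h1
  have h2 := hv.hasDerivAt.comp_hasFDerivAt x hd
  refine ⟨h2.differentiableAt, ?_⟩
  rw [show (fun y : E => v ‖y‖) = v ∘ fun y => ‖y‖ from rfl, h2.fderiv]
  simp only [radialField, inner_smul_left, smul_apply, innerSL_apply_apply,
    smul_eq_mul, nsmul_eq_mul]
  simp
  field_simp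
  simp

variable [FiniteDimensional ℝ E] [MeasurableSpace E] [BorelSpace E] [Nontrivial E]

theorem aestronglyMeasurable_radialField {g : ℝ → ℝ} {A : Set ℝ}
    (hg : AEStronglyMeasurable g (volume.restrict A)) :
    AEStronglyMeasurable (radialField g : E → E) (volume.restrict {x : E | ‖x‖ ∈ A}) :=
  (hg.comp_quasiMeasurePreserving (quasiMeasurePreserving_norm A)).smul
    (measurable_norm.inv.smul measurable_id).aestronglyMeasurable

theorem lintegral_enorm_comp_norm_le {g : ℝ → ℝ} {s t : ℝ} (hs : 0 < s)
    (hg : AEStronglyMeasurable g (volume.restrict (Icc s t))) :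
    ∫⁻ x in {x : E | ‖x‖ ∈ Icc s t}, ‖g ‖x‖‖ₑ ≤
      sphereMass E * ENNReal.ofReal (t ^ (Module.finrank ℝ E - 1)) * ∫⁻ r in Icc s t, ‖g r‖ₑ := by
  rw [setLIntegral_comp_norm measurableSet_Icc (fun r hr => hs.trans_le hr.1) hg.enorm, mul_assoc]
  gcongr
  rw [← lintegral_const_mul'' _ hg.enorm]
  refine setLIntegral_mono' measurableSet_Icc fun r hr => ?_
  gcongr
  · exact (hs.trans_le hr.1).le
  · exact hr.2

/-- The assumption `0 ≤ α` keeps closed shells inside the open one away from the origin, where the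
field is singular; on them the Jacobian is bounded. -/
theorem locallyIntegrableOn_radialField {g : ℝ → ℝ} {α β : ℝ} (hα : 0 ≤ α)
    (hg : ∀ s t, Icc s t ⊆ Ioo α β → IntegrableOn g (Icc s t)) :
    LocallyIntegrableOn (radialField g : E → E) {x : E | ‖x‖ ∈ Ioo α β} := by
  intro x hx
  obtain ⟨δ, hδ, hs⟩ := exists_Icc_nhds_subset isOpen_Ioo hx
  have hs0 : 0 < ‖x‖ - δ := hα.trans_lt (hs ⟨le_rfl, by linarith⟩).1
  have hint := hg _ _ hs
  refine ⟨{y : E | ‖y‖ ∈ Icc (‖x‖ - δ) (‖x‖ + δ)}, mem_nhdsWithin_of_mem_nhds ?_, ?_⟩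
  · exact continuous_norm.continuousAt.preimage_mem_nhds
      (Icc_mem_nhds (by linarith) (by linarith))
  · refine ⟨aestronglyMeasurable_radialField hint.aestronglyMeasurable, ?_⟩
    rw [hasFiniteIntegral_iff_enorm]
    have h1 : ∫⁻ y in {y : E | ‖y‖ ∈ Icc (‖x‖ - δ) (‖x‖ + δ)}, ‖radialField g y‖ₑ =
        ∫⁻ y in {y : E | ‖y‖ ∈ Icc (‖x‖ - δ) (‖x‖ + δ)}, ‖g ‖y‖‖ₑ := by
      refine setLIntegral_congr_fun (measurable_norm measurableSet_Icc) fun y hy => ?_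
      exact enorm_radialField g (norm_pos_iff.1 (hs0.trans_le hy.1))
    rw [h1]
    refine (lintegral_enorm_comp_norm_le hs0 hint.aestronglyMeasurable).trans_lt ?_
    exact ENNReal.mul_lt_top (ENNReal.mul_lt_top sphereMass_ne_top.lt_top ENNReal.ofReal_lt_top)
      hint.hasFiniteIntegral

theorem IsPrimitiveOn.integrableOn_Icc {v g : ℝ → ℝ} {S : Set ℝ} (h : IsPrimitiveOn v g S)
    (s t : ℝ) (hs : Icc s t ⊆ S) : IntegrableOn g (Icc s t) := by
  rcases le_or_gt s t with hst | hst
  · exact (intervalIntegrable_iff_integrableOn_Icc_of_le hst).1 (h hst hs).1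
  · rw [Icc_eq_empty hst.not_ge]; exact integrableOn_empty

/-- Integration by parts for radial functions with a continuously differentiable profile. -/
theorem integral_comp_norm_mul_fderiv {v g : ℝ → ℝ} (hg : Continuous g)
    (hv : ∀ r, HasDerivAt v (g r) r) {α β : ℝ} (hα : 0 ≤ α) {φ : E → ℝ}
    (hφ : IsTestFunction φ {x : E | ‖x‖ ∈ Ioo α β}) (e : E) :
    ∫ x, v ‖x‖ * fderiv ℝ φ x e = - ∫ x, inner ℝ (radialField g x) e * φ x := by
  have hvc : Continuous v := continuous_iff_continuousAt.2 fun r => (hv r).continuousAt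
  have hne : ∀ x ∈ tsupport φ, x ≠ 0 := fun x hx =>
    norm_pos_iff.1 (hα.trans_lt (hφ.subset hx).1)
  have hd : deriv v = g := funext fun r => (hv r).deriv
  have hfd : ∀ x, fderiv ℝ (fun y : E => v ‖y‖) x e * φ x =
      inner ℝ (radialField g x) e * φ x := by
    intro x
    by_cases hx : x ∈ tsupport φ
    · rw [(fderiv_comp_norm_apply (hne x hx) (hv _).differentiableAt e).2, hd]
    · rw [image_eq_zero_of_notMem_tsupport hx, mul_zero, mul_zero]
  rw [integral_mul_fderiv_eq_neg_fderiv_mul_of_integrable (f := fun y : E => v ‖y‖)]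
  · simp_rw [hfd]
  · simp_rw [hfd]
    exact hφ.integrable_inner_mul (locallyIntegrableOn_radialField hα fun s t _ =>
      hg.integrableOn_Icc) e
  · exact hφ.integrable_mul_fderiv ((hvc.comp continuous_norm).locallyIntegrable.locallyIntegrableOn
      _) e
  · refine Continuous.integrable_of_hasCompactSupport ?_ hφ.compact.mul_left
    exact (hvc.comp continuous_norm).mul hφ.continuous
  · exact fun x hx => (fderiv_comp_norm_apply (hne x hx) (hv _).differentiableAt e).1
  · exact fun x _ => (hφ.contDiff.differentiable (by simp)) x

/-- A radial function whose profile is a primitive of `g` has the weak gradient `g(|x|) x/|x|`. -/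
theorem IsPrimitiveOn.hasWeakGradientOn {v g : ℝ → ℝ} {α β : ℝ} (hα : 0 ≤ α)
    (h : IsPrimitiveOn v g (Ioo α β)) :
    HasWeakGradientOn (fun x : E => v ‖x‖) (radialField g) {x : E | ‖x‖ ∈ Ioo α β} := by
  have hUo : IsOpen {x : E | ‖x‖ ∈ Ioo α β} := isOpen_norm_preimage isOpen_Ioo
  have hu : LocallyIntegrableOn (fun x : E => v ‖x‖) {x : E | ‖x‖ ∈ Ioo α β} :=
    ((h.continuousOn isOpen_Ioo).comp continuous_norm.continuousOn
      fun x hx => hx).locallyIntegrableOn hUo.measurableSet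
  have hG := locallyIntegrableOn_radialField (E := E) hα h.integrableOn_Icc
  rw [hasWeakGradientOn_iff]
  refine ⟨hu, hG, fun φ hφ e => ?_⟩
  rcases (tsupport φ).eq_empty_or_nonempty with hemp | hnon
  · have : φ = 0 := tsupport_eq_empty_iff.1 hemp
    simp [this]
  obtain ⟨s, t, hst, hsub, hK⟩ := exists_Icc_of_isCompact_shell hφ.compact hφ.subset hnon
  have hs0 : 0 < s := hα.trans_lt (hsub ⟨le_rfl, hst⟩).1
  have hgi : Integrable ((Icc s t).indicator g) :=
    (h.integrableOn_Icc s t hsub).integrable_indicator measurableSet_Icc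
  obtain ⟨M, hM⟩ := hφ.compact.exists_bound_of_continuousOn hφ.continuous.continuousOn
  have hM' : ∀ x, ‖φ x‖ ≤ max M 0 := fun x => by
    by_cases hx : x ∈ tsupport φ
    · exact (hM x hx).trans (le_max_left _ _)
    · rw [image_eq_zero_of_notMem_tsupport hx]; simp
  set C1 : ℝ≥0∞ := ∫⁻ x, ‖fderiv ℝ φ x e‖ₑ
  set C2 : ℝ≥0∞ := ‖e‖ₑ * ENNReal.ofReal (max M 0) *
    (sphereMass E * ENNReal.ofReal (t ^ (Module.finrank ℝ E - 1)))
  have hC1 : C1 ≠ ⊤ := by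
    have : Integrable fun x => fderiv ℝ φ x e := by
      refine (hφ.continuous_fderiv e).integrable_of_hasCompactSupport ?_
      exact hφ.compact.mono' fun x hx => by
        by_contra hx'; exact hx (IsTestFunction.fderiv_eq_zero hx' e)
    exact this.hasFiniteIntegral.ne
  have hC2 : C2 ≠ ⊤ := by
    refine ENNReal.mul_ne_top (ENNReal.mul_ne_top enorm_ne_top ENNReal.ofReal_ne_top)
      (ENNReal.mul_ne_top sphereMass_ne_top ENNReal.ofReal_ne_top)
  have key : ∀ ε : ℝ≥0∞, ε ≠ 0 →
      ‖∫ x, (v ‖x‖ * fderiv ℝ φ x e + inner ℝ (radialField g x) e * φ x)‖ₑ ≤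
        ε * (C1 + C2) := by
    intro ε hε
    -- `g` is approximated in `L^1(s, t)` by a continuous `k`. The primitive `w` of `k` with `w(s) =
    -- v(s)` is within `ε` of `v` on `[s, t]` and satisfies the formula classically, so the defect
    -- for `v` is a multiple of `ε`.
    obtain ⟨k, -, hk, hkc, -⟩ := hgi.exists_hasCompactSupport_lintegral_sub_le hε
    have hk' : ∫⁻ r in Icc s t, ‖g r - k r‖ₑ ≤ ε := by
      refine le_trans ?_ hk
      rw [← lintegral_indicator measurableSet_Icc]
      refine lintegral_mono fun r => ?_
      by_cases hr : r ∈ Icc s t <;> simp [hr]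
    set w : ℝ → ℝ := fun r => v s + ∫ x in s..r, k x with hw
    have hwd : ∀ r, HasDerivAt w (k r) r := fun r =>
      (hkc.integral_hasStrictDerivAt s r).hasDerivAt.const_add _
    have hwc : Continuous w := continuous_iff_continuousAt.2 fun r => (hwd r).continuousAt
    have hvw : ∀ r ∈ Icc s t, ‖v r - w r‖ₑ ≤ ε := by
      intro r hr
      have hsr : Icc s r ⊆ Icc s t := Icc_subset_Icc le_rfl hr.2
      have h1 : v r - w r = ∫ x in s..r, (g x - k x) := by
        rw [intervalIntegral.integral_sub (h hr.1 (hsr.trans hsub)).1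
          (hkc.intervalIntegrable _ _), ← (h hr.1 (hsr.trans hsub)).2, hw]
        ring
      rw [h1, intervalIntegral.integral_of_le hr.1]
      exact (enorm_integral_le_lintegral_enorm _).trans
        ((lintegral_mono_set (Ioc_subset_Icc_self.trans hsr)).trans hk')
    have hI := integral_comp_norm_mul_fderiv hkc hwd hα hφ e
    have hG' : LocallyIntegrableOn (radialField k : E → E) {x : E | ‖x‖ ∈ Ioo α β} :=
      locallyIntegrableOn_radialField hα fun _ _ _ => hkc.integrableOn_Icc
    have hw' : LocallyIntegrableOn (fun x : E => w ‖x‖) {x : E | ‖x‖ ∈ Ioo α β} :=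
      (hwc.comp continuous_norm).locallyIntegrable.locallyIntegrableOn _
    have e1 : ∫ x, (v ‖x‖ * fderiv ℝ φ x e + inner ℝ (radialField g x) e * φ x) =
        ∫ x, ((v ‖x‖ - w ‖x‖) * fderiv ℝ φ x e +
          inner ℝ (radialField (fun r => g r - k r) x) e * φ x) := by
      have h0 : ∫ x, (w ‖x‖ * fderiv ℝ φ x e + inner ℝ (radialField k x) e * φ x) = 0 := by
        rw [integral_add (hφ.integrable_mul_fderiv hw' e) (hφ.integrable_inner_mul hG' e), hI]
        ring
      rw [← sub_zero (∫ x, (v ‖x‖ * fderiv ℝ φ x e + inner ℝ (radialField g x) e * φ x)), ← h0,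
        ← integral_sub]
      · refine integral_congr_ae (Eventually.of_forall fun x => ?_)
        simp only [← radialField_sub, inner_sub_left]
        ring
      · exact (hφ.integrable_mul_fderiv hu e).add (hφ.integrable_inner_mul hG e)
      · exact (hφ.integrable_mul_fderiv hw' e).add (hφ.integrable_inner_mul hG' e)
    rw [e1]
    have hgk : AEStronglyMeasurable (fun r => g r - k r) (volume.restrict (Icc s t)) :=
      ((h.integrableOn_Icc s t hsub).sub hkc.integrableOn_Icc).aestronglyMeasurable
    calc _ ≤ ∫⁻ x, ‖(v ‖x‖ - w ‖x‖) * fderiv ℝ φ x e +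
          inner ℝ (radialField (fun r => g r - k r) x) e * φ x‖ₑ :=
          enorm_integral_le_lintegral_enorm _
      _ ≤ ∫⁻ x, (ε * ‖fderiv ℝ φ x e‖ₑ + ‖e‖ₑ * ENNReal.ofReal (max M 0) *
          {x : E | ‖x‖ ∈ Icc s t}.indicator (fun x => ‖g ‖x‖ - k ‖x‖‖ₑ) x) := by
          refine lintegral_mono fun x => ?_
          by_cases hx : x ∈ tsupport φ
          · have hx' := hK hx
            have hx0 : x ≠ 0 := norm_pos_iff.1 (hs0.trans_le hx'.1)
            refine (enorm_add_le _ _).trans (add_le_add ?_ ?_)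
            · rw [enorm_mul]
              gcongr
              exact hvw _ hx'
            · rw [enorm_mul, indicator_of_mem hx']
              have h1 : ‖inner ℝ (radialField (fun r => g r - k r) x) e‖ₑ ≤
                  ‖g ‖x‖ - k ‖x‖‖ₑ * ‖e‖ₑ := by
                rw [← enorm_radialField (fun r => g r - k r) hx0, ← ofReal_norm, ← ofReal_norm,
                  ← ofReal_norm, ← ENNReal.ofReal_mul (norm_nonneg _)]
                exact ENNReal.ofReal_le_ofReal (norm_inner_le_norm _ _)
              have h2 : ‖φ x‖ₑ ≤ ENNReal.ofReal (max M 0) := by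
                rw [← ofReal_norm]
                exact ENNReal.ofReal_le_ofReal (hM' x)
              calc _ ≤ ‖g ‖x‖ - k ‖x‖‖ₑ * ‖e‖ₑ * ENNReal.ofReal (max M 0) := by gcongr
                _ = _ := by ring
          · rw [IsTestFunction.fderiv_eq_zero hx, image_eq_zero_of_notMem_tsupport hx]
            simp
      _ = ε * C1 + ‖e‖ₑ * ENNReal.ofReal (max M 0) *
          ∫⁻ x in {x : E | ‖x‖ ∈ Icc s t}, ‖g ‖x‖ - k ‖x‖‖ₑ := by
          rw [lintegral_add_left, lintegral_const_mul, lintegral_const_mul', lintegral_indicator]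
          · exact measurable_norm measurableSet_Icc
          · exact ENNReal.mul_ne_top enorm_ne_top ENNReal.ofReal_ne_top
          · exact (hφ.continuous_fderiv e).measurable.enorm
          · exact (hφ.continuous_fderiv e).measurable.enorm.const_mul _
      _ ≤ ε * C1 + ‖e‖ₑ * ENNReal.ofReal (max M 0) *
          (sphereMass E * ENNReal.ofReal (t ^ (Module.finrank ℝ E - 1)) * ε) := by
          gcongr
          exact (lintegral_enorm_comp_norm_le hs0 hgk).trans (by gcongr)
      _ = ε * (C1 + C2) := by ring
  have h0 : ‖∫ x, (v ‖x‖ * fderiv ℝ φ x e + inner ℝ (radialField g x) e * φ x)‖ₑ = 0 := by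
    by_contra hne
    have hC : C1 + C2 ≠ ⊤ := ENNReal.add_ne_top.2 ⟨hC1, hC2⟩
    have ht : Tendsto (fun n : ℕ => ((n : ℝ≥0∞) + 1)⁻¹ * (C1 + C2)) atTop (𝓝 (0 * (C1 + C2))) := by
      refine ENNReal.Tendsto.mul_const ?_ (Or.inr hC)
      have := (tendsto_add_atTop_iff_nat 1).2 ENNReal.tendsto_inv_nat_nhds_zero
      simpa using this
    rw [zero_mul] at ht
    exact hne (le_antisymm (ge_of_tendsto' ht fun n => key _ (by simp)) zero_le)
  rw [enorm_eq_zero, integral_add (hφ.integrable_mul_fderiv hu e)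
    (hφ.integrable_inner_mul hG e)] at h0
  linarith

end Radial

/-! ### Weak derivatives in one variable -/

theorem IsPrimitiveOn.hasWeakGradientOn_real {v g : ℝ → ℝ} {α β : ℝ} (hα : 0 ≤ α)
    (h : IsPrimitiveOn v g (Ioo α β)) : HasWeakGradientOn v g (Ioo α β) := by
  have hpos : ∀ x ∈ Ioo α β, ‖x‖ = x := fun x hx => abs_of_pos (hα.trans_lt hx.1)
  have hsub : Ioo α β ⊆ {x : ℝ | ‖x‖ ∈ Ioo α β} := fun x hx => by
    rw [mem_ofPred_eq, hpos x hx]; exact hx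
  -- The radial statement in the space `ℝ`, restricted to the positive side, where `|x| = x` and `x
  -- / |x| = 1`.
  refine ((h.hasWeakGradientOn (E := ℝ) hα).mono hsub).congr ?_ ?_
  · exact (ae_restrict_iff' measurableSet_Ioo).2 (Eventually.of_forall fun x hx => by
      simp only [hpos x hx])
  · refine (ae_restrict_iff' measurableSet_Ioo).2 (Eventually.of_forall fun x hx => ?_)
    have : x ≠ 0 := (hα.trans_lt hx.1).ne'
    simp only [radialField, hpos x hx, smul_eq_mul]
    rw [inv_mul_cancel₀ this, mul_one]

/-- A primitive of a test function of integral zero is a test function. -/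
theorem IsTestFunction.integral_Iic {χ : ℝ → ℝ} {α β : ℝ} (h : IsTestFunction χ (Ioo α β))
    (h0 : ∫ x, χ x = 0) :
    IsTestFunction (fun x => ∫ t in Iic x, χ t) (Ioo α β) ∧
      ∀ x, HasDerivAt (fun x => ∫ t in Iic x, χ t) (χ x) x := by
  have hint : Integrable χ := h.continuous.integrable_of_hasCompactSupport h.compact
  have hd : ∀ x, HasDerivAt (fun x => ∫ t in Iic x, χ t) (χ x) x := by
    intro x
    have h1 : (fun x => ∫ t in Iic x, χ t) = fun y => (∫ t in Iic x, χ t) + ∫ t in x..y, χ t := by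
      funext y
      rw [← intervalIntegral.integral_Iic_sub_Iic hint.integrableOn hint.integrableOn]; ring
    rw [h1]
    exact (h.continuous.integral_hasStrictDerivAt x x).hasDerivAt.const_add _
  have hsm : ContDiff ℝ ∞ fun x => ∫ t in Iic x, χ t := by
    rw [contDiff_infty_iff_deriv]
    refine ⟨fun x => (hd x).differentiableAt, ?_⟩
    rw [show deriv (fun x => ∫ t in Iic x, χ t) = χ from funext fun x => (hd x).deriv]
    exact h.contDiff
  rcases (tsupport χ).eq_empty_or_nonempty with hemp | hnon
  · have hz : χ = 0 := tsupport_eq_empty_iff.1 hemp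
    have hz' : (fun x => ∫ t in Iic x, χ t) = 0 := by funext x; simp [hz]
    refine ⟨⟨hsm, ?_, ?_⟩, hd⟩
    · rw [hz']; exact HasCompactSupport.zero
    · rw [hz', tsupport_eq_empty_iff.2 rfl]; exact empty_subset _
  obtain ⟨s, hs, hmin⟩ := h.compact.exists_isLeast hnon
  obtain ⟨t, ht, hmax⟩ := h.compact.exists_isGreatest hnon
  have hts : tsupport (fun x => ∫ t in Iic x, χ t) ⊆ Icc s t := by
    refine closure_minimal (fun x hx => ?_) isClosed_Icc
    by_contra hx'
    apply hx
    rw [mem_Icc, not_and_or, not_le, not_le] at hx'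
    rcases hx' with hx' | hx'
    · refine (setIntegral_congr_fun measurableSet_Iic (g := fun _ => (0:ℝ)) fun y hy => ?_).trans
        (by simp)
      exact image_eq_zero_of_notMem_tsupport fun hy' =>
        absurd (hmin hy') (not_le.2 (lt_of_le_of_lt hy hx'))
    · rw [← h0]
      refine setIntegral_eq_integral_of_forall_compl_eq_zero fun y hy => ?_
      refine image_eq_zero_of_notMem_tsupport fun hy' => hy ?_
      exact (hmax hy').trans hx'.le
  exact ⟨⟨hsm, isCompact_Icc.of_isClosed_subset (isClosed_tsupport _) hts,
    hts.trans fun x hx => ⟨(h.subset hs).1.trans_le hx.1, hx.2.trans_lt (h.subset ht).2⟩⟩, hd⟩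

/-- The du Bois-Reymond lemma. -/
theorem exists_ae_eq_const {z : ℝ → ℝ} {α β : ℝ} (hαβ : α < β)
    (hz : HasWeakGradientOn z 0 (Ioo α β)) : ∃ C : ℝ, ∀ᵐ r, r ∈ Ioo α β → z r = C := by
  rw [hasWeakGradientOn_iff] at hz
  obtain ⟨ψ, hψ, hψ1⟩ : ∃ ψ : ℝ → ℝ, IsTestFunction ψ (Ioo α β) ∧ ∫ x, ψ x = 1 := by
    let f : ContDiffBump ((α + β) / 2) :=
      ⟨(β - α) / 8, (β - α) / 4, by linarith, by linarith⟩
    refine ⟨f.normed volume, ⟨f.contDiff_normed, f.hasCompactSupport_normed, ?_⟩,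
      f.integral_normed⟩
    rw [f.tsupport_normed_eq, Real.closedBall_eq_Icc]
    intro x hx
    have h1 : (α + β) / 2 - (β - α) / 4 ≤ x := hx.1
    have h2 : x ≤ (α + β) / 2 + (β - α) / 4 := hx.2
    constructor <;> linarith
  have hint : ∀ φ, IsTestFunction φ (Ioo α β) → Integrable φ := fun φ hφ =>
    hφ.continuous.integrable_of_hasCompactSupport hφ.compact
  have hzi : ∀ φ, IsTestFunction φ (Ioo α β) → Integrable fun x => z x * φ x := fun φ hφ => by
    have := integrable_smul_of_locallyIntegrableOn hz.1 hφ.compact hφ.subset hφ.continuous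
      fun x hx => image_eq_zero_of_notMem_tsupport hx
    simpa only [smul_eq_mul, mul_comm] using this
  set C := ∫ x, z x * ψ x with hC
  refine ⟨C, ?_⟩
  have h0 : ∀ᵐ r, r ∈ Ioo α β → z r - C = 0 := by
    refine isOpen_Ioo.ae_eq_zero_of_integral_contDiff_smul_eq_zero
      (hz.1.sub (locallyIntegrableOn_const C)) fun φ a b c => ?_
    have hφ : IsTestFunction φ (Ioo α β) := ⟨a, b, c⟩
    set I := ∫ x, φ x with hI
    have hts : tsupport (fun x => φ x - I * ψ x) ⊆ tsupport φ ∪ tsupport ψ := by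
      refine closure_minimal (fun x hx => ?_) ((isClosed_tsupport _).union (isClosed_tsupport _))
      by_contra hx'
      rw [mem_union, not_or] at hx'
      apply hx
      simp only [image_eq_zero_of_notMem_tsupport hx'.1, image_eq_zero_of_notMem_tsupport hx'.2]
      ring
    -- `φ - (∫ φ) ψ` has integral zero, hence is the derivative of a test function. Testing `z`
    -- against it gives `∫ z φ = C ∫ φ`.
    have hχ : IsTestFunction (fun x => φ x - I * ψ x) (Ioo α β) := by
      refine ⟨a.sub (contDiff_const.mul hψ.contDiff), ?_, hts.trans (union_subset c hψ.subset)⟩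
      exact (hφ.compact.isCompact.union hψ.compact.isCompact).of_isClosed_subset
        (isClosed_tsupport _) hts
    have hχ0 : ∫ x, (φ x - I * ψ x) = 0 := by
      rw [integral_sub (hint _ hφ) ((hint _ hψ).const_mul _), integral_const_mul, hψ1]
      simp [hI]
    obtain ⟨hΦ, hd⟩ := hχ.integral_Iic hχ0
    have h1 := hz.2.2 _ hΦ 1
    have h2 : ∀ x, fderiv ℝ (fun x => ∫ t in Iic x, (φ t - I * ψ t)) x 1 = φ x - I * ψ x := by
      intro x
      rw [fderiv_apply_one_eq_deriv, (hd x).deriv]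
    simp_rw [h2] at h1
    simp only [Pi.zero_apply, inner_zero_left, zero_mul, integral_zero, neg_zero] at h1
    have h3 : ∫ x, z x * (φ x - I * ψ x) = (∫ x, z x * φ x) - I * C := by
      rw [hC, ← integral_const_mul, ← integral_sub (hzi _ hφ) ((hzi _ hψ).const_mul _)]
      congr 1; funext x; ring
    rw [h3] at h1
    have h4 : ∫ x, φ x • (z x - C) = (∫ x, z x * φ x) - C * I := by
      rw [hI, ← integral_const_mul, ← integral_sub (hzi _ hφ) ((hint _ hφ).const_mul _)]
      congr 1; funext x; simp only [smul_eq_mul]; ring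
    rw [h4]; linarith
  filter_upwards [h0] with r hr hr' using sub_eq_zero.1 (hr hr')

/-- A function with a weak derivative on an interval has a representative which is a primitive. -/
theorem HasWeakGradientOn.exists_isPrimitiveOn_Ioo {v g : ℝ → ℝ} {α β : ℝ} (hα : 0 ≤ α)
    (hαβ : α < β) (h : HasWeakGradientOn v g (Ioo α β)) :
    ∃ w, w =ᵐ[volume.restrict (Ioo α β)] v ∧ IsPrimitiveOn w g (Ioo α β) := by
  set c := (α + β) / 2
  have hc : c ∈ Ioo α β := ⟨by simp only [c]; linarith, by simp only [c]; linarith⟩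
  have hg : ∀ x ∈ Ioo α β, ∀ y ∈ Ioo α β, IntervalIntegrable g volume x y := by
    intro x hx y hy
    rw [intervalIntegrable_iff']
    exact h.2.1.integrableOn_compact_subset (ordConnected_Ioo.uIcc_subset hx hy) isCompact_uIcc
  have hprim : ∀ C : ℝ, IsPrimitiveOn (fun r => C + ∫ t in c..r, g t) g (Ioo α β) := by
    intro C x y hxy hs
    have hx := hs (left_mem_Icc.2 hxy)
    have hy := hs (right_mem_Icc.2 hxy)
    refine ⟨hg x hx y hy, ?_⟩
    rw [← intervalIntegral.integral_interval_sub_left (hg c hc y hy) (hg c hc x hx)]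
    ring
  have hw := (hprim 0).hasWeakGradientOn_real hα
  -- The difference between `v` and a primitive of `g` has weak derivative zero, so it is almost
  -- everywhere a constant, which is absorbed into the primitive.
  have hz : HasWeakGradientOn (fun r => v r - (0 + ∫ t in c..r, g t)) 0 (Ioo α β) := by
    rw [hasWeakGradientOn_iff] at h hw ⊢
    refine ⟨h.1.sub hw.1, locallyIntegrableOn_zero, fun φ hφ e => ?_⟩
    have h1 := h.2.2 φ hφ e
    have h2 := hw.2.2 φ hφ e
    simp_rw [sub_mul]
    rw [integral_sub (hφ.integrable_mul_fderiv h.1 e) (hφ.integrable_mul_fderiv hw.1 e), h1, h2]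
    simp
  obtain ⟨C, hC⟩ := exists_ae_eq_const hαβ hz
  refine ⟨_, ?_, hprim C⟩
  refine (ae_restrict_iff' measurableSet_Ioo).2 ?_
  filter_upwards [hC] with r hr hrS
  linarith [hr hrS]

/-! ### Assembling the components -/

namespace IsIntervalDecomposition

variable {ι : Type*} {S : Set ℝ} {α β : ι → ℝ}

theorem subset (h : IsIntervalDecomposition S α β) (i : ι) : Ioo (α i) (β i) ⊆ S := by
  rw [h.eq_iUnion]; exact subset_iUnion (fun i => Ioo (α i) (β i)) i

/-- An open interval containing a point of the closure of another one meets its interior. Admitting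
end points here shows that no end point of a component belongs to `S`. -/
theorem eq_of_mem (h : IsIntervalDecomposition S α β) {i j : ι} {r : ℝ}
    (hi : r ∈ Ioo (α i) (β i)) (hj : r ∈ Icc (α j) (β j)) :
    i = j := by
  by_contra hij
  have hd : Disjoint (Ioo (α i) (β i)) (Ioo (α j) (β j)) := h.disjoint hij
  rw [Ioo_disjoint_Ioo] at hd
  have := h.lt i
  have := h.lt j
  rcases le_total (α i) (α j) with h1 | h1 <;> rcases le_total (β i) (β j) with h2 | h2 <;>
    simp only [h1, h2, min_eq_left, min_eq_right, max_eq_left, max_eq_right] at hd <;>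
    linarith [hi.1, hi.2, hj.1, hj.2]

theorem right_notMem (h : IsIntervalDecomposition S α β) (i : ι) : β i ∉ S := by
  rw [h.eq_iUnion, mem_iUnion]
  rintro ⟨j, hj⟩
  have := h.eq_of_mem hj (right_mem_Icc.2 (h.lt i).le)
  subst this
  exact lt_irrefl _ hj.2

theorem left_notMem (h : IsIntervalDecomposition S α β) (i : ι) : α i ∉ S := by
  rw [h.eq_iUnion, mem_iUnion]
  rintro ⟨j, hj⟩
  have := h.eq_of_mem hj (left_mem_Icc.2 (h.lt i).le)
  subst this
  exact lt_irrefl _ hj.1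

/-- An interval leaving the component of its left end point would contain the right end point of
that component, which is not in `S`. Thus the primitive property can be checked on each component.
-/
theorem exists_Icc_subset (h : IsIntervalDecomposition S α β) {x y : ℝ} (hxy : x ≤ y)
    (hs : Icc x y ⊆ S) : ∃ i, Icc x y ⊆ Ioo (α i) (β i) := by
  have hx := hs (left_mem_Icc.2 hxy)
  rw [h.eq_iUnion] at hx
  obtain ⟨i, hi⟩ := mem_iUnion.1 hx
  refine ⟨i, fun t ht => ⟨hi.1.trans_le ht.1, ?_⟩⟩
  by_contra hlt
  rw [not_lt] at hlt
  exact h.right_notMem i (hs ⟨hi.2.le, hlt.trans ht.2⟩)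

theorem isPrimitiveOn (h : IsIntervalDecomposition S α β) {v g : ℝ → ℝ}
    (hv : ∀ i, IsPrimitiveOn v g (Ioo (α i) (β i))) :
    IsPrimitiveOn v g S := by
  intro x y hxy hs
  obtain ⟨i, hi⟩ := h.exists_Icc_subset hxy hs
  exact hv i hxy hi

theorem left_nonneg (h : IsIntervalDecomposition S α β) (h0 : S ⊆ Ioi 0) (i : ι) : 0 ≤ α i := by
  by_contra! hneg
  obtain ⟨r, hr1, hr2⟩ := exists_between (lt_min hneg (h.lt i))
  have h1 := h0 (h.subset i ⟨hr1, hr2.trans_le (min_le_right _ _)⟩)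
  exact lt_asymm h1 (hr2.trans_le (min_le_left _ _))

theorem hasWeakGradientOn_real (h : IsIntervalDecomposition S α β) [Finite ι] (h0 : S ⊆ Ioi 0)
    {v g : ℝ → ℝ}
    (hv : IsPrimitiveOn v g S) : HasWeakGradientOn v g S := by
  have h1 : HasWeakGradientOn v g (⋃ i, Ioo (α i) (β i)) :=
    HasWeakGradientOn.iUnion (fun i => isOpen_Ioo) h.disjoint fun i =>
      (hv.mono (h.subset i)).hasWeakGradientOn_real (h.left_nonneg h0 i)
  rwa [← h.eq_iUnion] at h1

theorem hasWeakGradientOn (h : IsIntervalDecomposition S α β) [Finite ι] (h0 : S ⊆ Ioi 0)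
    {E : Type*} [NormedAddCommGroup E]
    [InnerProductSpace ℝ E] [FiniteDimensional ℝ E] [MeasurableSpace E] [BorelSpace E]
    [Nontrivial E] {v g : ℝ → ℝ} (hv : IsPrimitiveOn v g S) :
    HasWeakGradientOn (fun x : E => v ‖x‖) (radialField g) {x : E | ‖x‖ ∈ S} := by
  have h1 : HasWeakGradientOn (fun x : E => v ‖x‖) (radialField g)
      (⋃ i, {x : E | ‖x‖ ∈ Ioo (α i) (β i)}) :=
    HasWeakGradientOn.iUnion (fun i => isOpen_norm_preimage isOpen_Ioo)
      (fun i j hij => Disjoint.preimage (fun x : E => ‖x‖) (h.disjoint hij))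
      fun i => (hv.mono (h.subset i)).hasWeakGradientOn (h.left_nonneg h0 i)
  convert h1 using 1
  ext x
  rw [h.eq_iUnion]
  simp

theorem exists_eqOn (h : IsIntervalDecomposition S α β) (w : ι → ℝ → ℝ) :
    ∃ z : ℝ → ℝ, ∀ i, ∀ r ∈ Ioo (α i) (β i), z r = w i r := by
  classical
  refine ⟨fun r => if hr : ∃ i, r ∈ Ioo (α i) (β i) then w hr.choose r else 0, fun i r hr => ?_⟩
  have hex : ∃ i, r ∈ Ioo (α i) (β i) := ⟨i, hr⟩
  simp only [dif_pos hex]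
  rw [← h.eq_of_mem hr (Ioo_subset_Icc_self hex.choose_spec)]

/-- A function with a weak derivative has a representative which is a primitive. -/
theorem exists_isPrimitiveOn (h : IsIntervalDecomposition S α β) (h0 : S ⊆ Ioi 0) [Finite ι]
    {v g : ℝ → ℝ}
    (hv : HasWeakGradientOn v g S) :
    ∃ w, w =ᵐ[volume.restrict S] v ∧ IsPrimitiveOn w g S := by
  choose w hw hwp using fun i => (hv.mono (h.subset i)).exists_isPrimitiveOn_Ioo
    (h.left_nonneg h0 i) (h.lt i)
  obtain ⟨W, hWi⟩ := h.exists_eqOn w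
  refine ⟨W, ?_, h.isPrimitiveOn fun i x y hxy hs => ?_⟩
  · have h2 : ∀ᵐ r, ∀ i, r ∈ Ioo (α i) (β i) → w i r = v r :=
      ae_all_iff.2 fun i => (ae_restrict_iff' measurableSet_Ioo).1 (hw i)
    have hSm : MeasurableSet S := by
      rw [h.eq_iUnion]; exact MeasurableSet.iUnion fun i => measurableSet_Ioo
    refine (ae_restrict_iff' hSm).2 ?_
    filter_upwards [h2] with r hr hrS
    rw [h.eq_iUnion] at hrS
    obtain ⟨i, hi⟩ := mem_iUnion.1 hrS
    rw [hWi i r hi, hr i hi]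
  · rw [hWi i y (hs (right_mem_Icc.2 hxy)), hWi i x (hs (left_mem_Icc.2 hxy))]
    exact hwp i hxy hs

end IsIntervalDecomposition

/-! ### Integrability of the conjugate weight at good and bad radii -/

section GoodRadii

variable {p : ℝ} {η : ℝ → ℝ} {a b : ℝ}

theorem goodRadii_subset : goodRadii p η a b ⊆ Ioo a b := fun _ h => h.1

theorem isOpen_goodRadii : IsOpen (goodRadii p η a b) := by
  rw [isOpen_iff_mem_nhds]
  rintro r ⟨hr, ε, hε, hfin⟩
  filter_upwards [Ioo_mem_nhds hr.1 hr.2,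
    Ioo_mem_nhds (show r - ε / 2 < r by linarith) (show r < r + ε / 2 by linarith)] with t ht ht'
  refine ⟨ht, ε / 2, by positivity, lt_of_le_of_lt (lintegral_mono_set ?_) hfin⟩
  exact Ioo_subset_Ioo (by linarith [ht'.1]) (by linarith [ht'.2])

/-- The weight `r^{d-1} η(r)` of the energy in polar coordinates. -/
noncomputable def radialWeight (d : ℕ) (η : ℝ → ℝ) (r : ℝ) : ℝ≥0∞ :=
  ENNReal.ofReal (r ^ (d - 1)) * ENNReal.ofReal (η r)

theorem measurable_radialWeight {d : ℕ} (hη : Measurable η) : Measurable (radialWeight d η) := by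
  unfold radialWeight; fun_prop

theorem radialWeight_ne_top (d : ℕ) (η : ℝ → ℝ) (r : ℝ) : radialWeight d η r ≠ ⊤ :=
  ENNReal.mul_ne_top ENNReal.ofReal_ne_top ENNReal.ofReal_ne_top

theorem conjWeight_radialWeight (d : ℕ) (η : ℝ → ℝ) (r : ℝ) :
    conjWeight p (radialWeight d η) r =
      ENNReal.ofReal (r ^ (d - 1)) ^ (-(1 / (p - 1))) *
        ENNReal.ofReal (η r) ^ (-(1 / (p - 1))) :=
  ENNReal.mul_rpow_of_ne_top ENNReal.ofReal_ne_top ENNReal.ofReal_ne_top _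

/-- Compactness turns local integrability of the power of `η` into integrability on the interval,
and `r^{d-1}` is bounded below there by `x^{d-1} > 0`. -/
theorem lintegral_conjWeight_Icc_ne_top {d : ℕ} {η' : ℝ → ℝ}
    (hηη' : η =ᵐ[volume.restrict (Ioi 0)] η') (ha : 0 ≤ a) (hp : 1 < p) (x y : ℝ)
    (hs : Icc x y ⊆ goodRadii p η a b) :
    ∫⁻ r in Icc x y, conjWeight p (radialWeight d η') r ≠ ⊤ := by
  rcases lt_or_ge y x with hxy | hxy
  · simp [hxy]
  have hq : 0 < 1 / (p - 1) := by have : 0 < p - 1 := by linarith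
                                  positivity
  have hx0 : 0 < x := ha.trans_lt (hs (left_mem_Icc.2 hxy)).1.1
  have h1 : ∫⁻ r in Icc x y, ENNReal.ofReal (η r) ^ (-(1 / (p - 1))) ≠ ⊤ := by
    refine isCompact_Icc.induction_on
      (p := fun A => ∫⁻ r in A, ENNReal.ofReal (η r) ^ (-(1 / (p - 1))) ≠ ⊤) (by simp)
      (fun A B hAB hB => ne_top_of_le_ne_top hB (lintegral_mono_set hAB))
      (fun A B hA hB => ne_top_of_le_ne_top (ENNReal.add_ne_top.2 ⟨hA, hB⟩)
        (lintegral_union_le _ A B)) fun r hr => ?_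
    obtain ⟨-, ε, hε, hfin⟩ := hs hr
    exact ⟨_, mem_nhdsWithin_of_mem_nhds (Ioo_mem_nhds (by linarith) (by linarith)), hfin.ne⟩
  have h2 : ∫⁻ r in Icc x y, conjWeight p (radialWeight d η') r ≤
      ∫⁻ r in Icc x y, ENNReal.ofReal (x ^ (d - 1)) ^ (-(1 / (p - 1))) *
        ENNReal.ofReal (η r) ^ (-(1 / (p - 1))) := by
    refine lintegral_mono_ae ?_
    have hsub : Icc x y ⊆ Ioi 0 := fun r hr => hx0.trans_le hr.1
    filter_upwards [ae_restrict_of_ae_restrict_of_subset hsub hηη',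
      ae_restrict_mem measurableSet_Icc] with r hr hr'
    rw [conjWeight_radialWeight, hr]
    gcongr ?_ * _
    rw [ENNReal.rpow_neg, ENNReal.rpow_neg, ENNReal.inv_le_inv]
    gcongr
    exact hr'.1
  refine ne_top_of_le_ne_top ?_ h2
  have hne : ENNReal.ofReal (x ^ (d - 1)) ^ (-(1 / (p - 1))) ≠ ⊤ := by
    rw [ENNReal.rpow_neg, ENNReal.inv_ne_top]
    have : ENNReal.ofReal (x ^ (d - 1)) ≠ 0 := by simpa using pow_pos hx0 _
    exact (ENNReal.rpow_pos (pos_iff_ne_zero.2 this) ENNReal.ofReal_ne_top).ne'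
  rw [lintegral_const_mul' _ _ hne]
  exact ENNReal.mul_ne_top hne h1

/-- The factor `r^{d-1}` is bounded above near `c`, so integrability of the conjugate weight would
make `c` a good radius. The divergence is the source of the cheap transitions. -/
theorem lintegral_conjWeight_eq_top {d : ℕ} {η' : ℝ → ℝ}
    (hηη' : η =ᵐ[volume.restrict (Ioi 0)] η') (ha : 0 ≤ a) (hp : 1 < p) {c δ : ℝ}
    (hc : c ∈ Ioo a b) (hcS : c ∉ goodRadii p η a b) (hδ : 0 < δ) :
    ∫⁻ r in Ioo (c - δ) (c + δ), conjWeight p (radialWeight d η') r = ⊤ := by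
  by_contra hfin
  have hq : 0 < 1 / (p - 1) := by have : 0 < p - 1 := by linarith
                                  positivity
  have hc0 : 0 < c := ha.trans_lt hc.1
  -- The radius `min δ c` keeps the interval inside the positive half-line, where `η` and `η'` are
  -- known to agree.
  refine hcS ⟨hc, min δ c, lt_min hδ hc0, ?_⟩
  have hsub : Ioo (c - min δ c) (c + min δ c) ⊆ Ioo (c - δ) (c + δ) :=
    Ioo_subset_Ioo (by linarith [min_le_left δ c]) (by linarith [min_le_left δ c])
  have hsub0 : Ioo (c - min δ c) (c + min δ c) ⊆ Ioi 0 := fun r hr => by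
    have := hr.1
    exact lt_of_le_of_lt (by linarith [min_le_right δ c]) this
  have hne : ENNReal.ofReal ((c + δ) ^ (d - 1)) ^ (1 / (p - 1)) ≠ ⊤ :=
    ENNReal.rpow_ne_top_of_nonneg hq.le ENNReal.ofReal_ne_top
  have h2 : ∫⁻ r in Ioo (c - min δ c) (c + min δ c), ENNReal.ofReal (η r) ^ (-(1 / (p - 1))) ≤
      ∫⁻ r in Ioo (c - min δ c) (c + min δ c), ENNReal.ofReal ((c + δ) ^ (d - 1)) ^ (1 / (p - 1)) *
        conjWeight p (radialWeight d η') r := by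
    refine lintegral_mono_ae ?_
    filter_upwards [ae_restrict_of_ae_restrict_of_subset hsub0 hηη',
      ae_restrict_mem measurableSet_Ioo] with r hr hr'
    rw [conjWeight_radialWeight, hr, ← mul_assoc]
    have hr0 : 0 < r := hsub0 hr'
    have h0 : ENNReal.ofReal (r ^ (d - 1)) ≠ 0 := by simpa using pow_pos hr0 _
    refine le_mul_of_one_le_left' ?_
    calc (1 : ℝ≥0∞) = ENNReal.ofReal (r ^ (d - 1)) ^ (1 / (p - 1)) *
          ENNReal.ofReal (r ^ (d - 1)) ^ (-(1 / (p - 1))) := by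
          rw [← ENNReal.rpow_add _ _ h0 ENNReal.ofReal_ne_top]; simp
      _ ≤ _ := by
          gcongr
          exact (hsub hr').2.le
  refine h2.trans_lt ?_
  rw [lintegral_const_mul' _ _ hne]
  exact ENNReal.mul_lt_top hne.lt_top
    (lt_of_le_of_lt (lintegral_mono_set hsub) (lt_top_iff_ne_top.2 hfin))

end GoodRadii

/-! ### Shell integrals and the auxiliary weight -/

theorem finrank_space {d : ℕ} : Module.finrank ℝ (Space d) = d := by simp

theorem shellIntegral_mono {d : ℕ} {p : ℝ} {η : ℝ → ℝ} {r s r' s' : ℝ} (hr : r' ≤ r)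
    (hs : s ≤ s') :
    shellIntegral d p η r s ≤ shellIntegral d p η r' s' :=
  lintegral_mono_set fun _ hy => ⟨hr.trans_lt hy.1, hy.2.trans_le hs⟩

section Shell

variable {d : ℕ} [NeZero d] {p : ℝ} {η η' : ℝ → ℝ}

/-- The shell integral in polar coordinates. -/
theorem shellIntegral_eq (hp : 1 < p) (hη' : Measurable η')
    (hηη' : η =ᵐ[volume.restrict (Ioi 0)] η') {r s : ℝ} (hr : 0 ≤ r) :
    shellIntegral d p η r s =
      sphereMass (Space d) * ∫⁻ t in Ioo r s, conjWeight p (radialWeight d η') t := by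
  have hsub : Ioo r s ⊆ Ioi 0 := fun t ht => hr.trans_lt ht.1
  have hae : ∀ᵐ y ∂(volume.restrict {y : Space d | ‖y‖ ∈ Ioo r s}), η ‖y‖ = η' ‖y‖ :=
    (quasiMeasurePreserving_norm (E := Space d) (Ioo r s)).ae
      (ae_restrict_of_ae_restrict_of_subset hsub hηη')
  have h1 : shellIntegral d p η r s = ∫⁻ y in {y : Space d | ‖y‖ ∈ Ioo r s},
      (fun t : ℝ => ENNReal.ofReal (t ^ (((d : ℝ) - 1) * p) * η' t) ^ (-(1 / (p - 1)))) ‖y‖ := by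
    refine lintegral_congr_ae ?_
    filter_upwards [hae] with y hy
    rw [hy]
  have hm : Measurable fun t : ℝ =>
      ENNReal.ofReal (t ^ (((d : ℝ) - 1) * p) * η' t) ^ (-(1 / (p - 1))) := by fun_prop
  rw [h1, setLIntegral_comp_norm (E := Space d) measurableSet_Ioo hsub hm.aemeasurable,
    finrank_space]
  congr 1
  refine setLIntegral_congr_fun measurableSet_Ioo fun t ht => ?_
  have ht0 : 0 < t := hsub ht
  have hT : ENNReal.ofReal t ≠ 0 := by simpa using ht0
  have hpd : ((d - 1 : ℕ) : ℝ) = (d : ℝ) - 1 := by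
    rw [Nat.cast_sub (Nat.one_le_iff_ne_zero.2 (NeZero.ne d))]; simp
  have hp1 : p - 1 ≠ 0 := by linarith
  rw [conjWeight_radialWeight, ENNReal.ofReal_mul (by positivity),
    ENNReal.mul_rpow_of_ne_top ENNReal.ofReal_ne_top ENNReal.ofReal_ne_top, ← mul_assoc]
  congr 1
  -- With the Jacobian the exponent of `t` is `(d-1) - (d-1)p/(p-1) = -(d-1)/(p-1)`, as in the
  -- conjugate weight of `t^{d-1} η`. The power `(d-1)p` in the shell integral is chosen for this.
  rw [← Real.rpow_natCast t (d - 1), ← ENNReal.ofReal_rpow_of_pos ht0,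
    ← ENNReal.ofReal_rpow_of_pos ht0, ← ENNReal.rpow_mul, ← ENNReal.rpow_mul,
    ← ENNReal.rpow_add _ _ hT ENNReal.ofReal_ne_top, hpd]
  congr 1
  field_simp
  ring

theorem shellIntegral_ne_zero (hp : 1 < p) (hη' : Measurable η')
    (hηη' : η =ᵐ[volume.restrict (Ioi 0)] η') {r s : ℝ} (hr : 0 ≤ r) (hrs : r < s) :
    shellIntegral d p η r s ≠ 0 := by
  rw [shellIntegral_eq hp hη' hηη' hr]
  refine mul_ne_zero sphereMass_ne_zero ?_
  rw [← pos_iff_ne_zero, setLIntegral_pos_iff (measurable_conjWeight (measurable_radialWeight hη'))]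
  have : (Function.support (conjWeight p (radialWeight d η'))) = univ := by
    ext s; simpa using conjWeight_ne_zero hp (radialWeight_ne_top d η' s)
  simp [this, hrs]

end Shell

section AuxPiece

variable {d : ℕ} {p : ℝ} {η : ℝ → ℝ} {α β r : ℝ}

theorem auxPiece_eq_zero (hαβ : α < β) (hr : r ∉ Icc α β) : auxPiece d p η α β r = 0 := by
  rw [mem_Icc, not_and_or, not_le, not_le] at hr
  unfold auxPiece
  rw [if_neg, if_neg, if_neg]
  all_goals rintro ⟨h1, h2⟩; rcases hr with hr | hr <;> linarith

theorem measurable_auxPiece : Measurable (auxPiece d p η α β) := by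
  have h1 : Measurable fun r => (shellIntegral d p η r ((α + β) / 2))⁻¹ :=
    (Antitone.measurable fun r s hrs => shellIntegral_mono hrs le_rfl).inv
  have h2 : Measurable fun r => (shellIntegral d p η ((α + β) / 2) r)⁻¹ :=
    (Monotone.measurable fun r s hrs => shellIntegral_mono le_rfl hrs).inv
  unfold auxPiece
  refine Measurable.ite measurableSet_Icc h1 ?_
  refine Measurable.ite measurableSet_Icc measurable_const ?_
  exact Measurable.ite measurableSet_Icc h2 measurable_const

/-- The auxiliary weight is at most the inverse of the shell integral up to the mid radius. -/
theorem auxPiece_mul_shellIntegral_le (hαβ : α < β) :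
    auxPiece d p η α β r *
      shellIntegral d p η (min r ((α + β) / 2)) (max r ((α + β) / 2)) ≤ 1 := by
  unfold auxPiece
  split_ifs with h1 h2 h3
  · rw [min_eq_left (by linarith), max_eq_right (by linarith)]
    exact ENNReal.inv_mul_le_one _
  · refine (mul_le_mul_right (shellIntegral_mono (r' := (3 * α + β) / 4)
      (s' := (α + 3 * β) / 4) ?_ ?_) _).trans (ENNReal.inv_mul_le_one _)
    · exact le_min h2.1 (by linarith)
    · exact max_le h2.2 (by linarith)
  · rw [min_eq_right (by linarith), max_eq_left (by linarith)]
    exact ENNReal.inv_mul_le_one _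
  · simp

/-- As `r` approaches an end point, the shell between `r` and the mid radius grows and its inverse
integral decreases, so the values at the quarter points bound the outer branches. -/
theorem auxPiece_le : auxPiece d p η α β r ≤
    (shellIntegral d p η ((3 * α + β) / 4) ((α + β) / 2))⁻¹ +
    (shellIntegral d p η ((3 * α + β) / 4) ((α + 3 * β) / 4))⁻¹ +
    (shellIntegral d p η ((α + β) / 2) ((α + 3 * β) / 4))⁻¹ := by
  unfold auxPiece
  split_ifs with h1 h2 h3
  · refine le_trans ?_ (le_self_add.trans le_self_add)
    exact ENNReal.inv_le_inv.2 (shellIntegral_mono h1.2 le_rfl)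
  · exact le_add_self.trans le_self_add
  · refine le_trans ?_ le_add_self
    exact ENNReal.inv_le_inv.2 (shellIntegral_mono le_rfl h3.1)
  · exact zero_le

/-- For `r` inside the component only shells with closure inside it occur. Their integrals are
finite, so the inverses are positive. -/
theorem auxPiece_ne_zero (hfin : ∀ r s, Icc r s ⊆ Ioo α β → shellIntegral d p η r s ≠ ⊤)
    (hr : r ∈ Ioo α β) : auxPiece d p η α β r ≠ 0 := by
  have hαβ := hr.1.trans hr.2
  unfold auxPiece
  split_ifs with h1 h2 h3
  · exact ENNReal.inv_ne_zero.2 (hfin _ _ fun t ht => ⟨hr.1.trans_le ht.1, by linarith [ht.2]⟩)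
  · exact ENNReal.inv_ne_zero.2 (hfin _ _ fun t ht => ⟨by linarith [ht.1], by linarith [ht.2]⟩)
  · exact ENNReal.inv_ne_zero.2 (hfin _ _ fun t ht => ⟨by linarith [ht.1], ht.2.trans_lt hr.2⟩)
  · exfalso
    simp only [not_and_or, not_le] at h1 h2 h3
    have := hr.1; have := hr.2
    rcases h1 with h1 | h1 <;> rcases h2 with h2 | h2 <;> rcases h3 with h3 | h3 <;> linarith

end AuxPiece

/-! ### The setting, the auxiliary measure and the Hardy inequality -/

theorem IsPrimitiveOn.enorm_sub_rpow_le_uIoc {p : ℝ} (hp : 1 < p) {m : ℝ → ℝ≥0∞}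
    (hm : Measurable m) (hm' : ∀ r, m r ≠ ⊤) {v g : ℝ → ℝ} {S : Set ℝ} (h : IsPrimitiveOn v g S)
    {x y : ℝ} (hs : uIcc x y ⊆ S) (hA : ∫⁻ r in uIoc x y, conjWeight p m r ≠ ⊤) :
    ‖v y - v x‖ₑ ^ p ≤
      (∫⁻ r in uIoc x y, ‖g r‖ₑ ^ p * m r) * (∫⁻ r in uIoc x y, conjWeight p m r) ^ (p - 1) := by
  rcases le_total x y with hxy | hxy
  · rw [uIoc_of_le hxy] at hA ⊢
    exact h.enorm_sub_rpow_le hp hm hm' hxy (by rwa [uIcc_of_le hxy] at hs) hA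
  · rw [uIoc_of_ge hxy] at hA ⊢
    rw [← enorm_neg, neg_sub]
    exact h.enorm_sub_rpow_le hp hm hm' hxy (by rwa [uIcc_of_ge hxy] at hs) hA

/-- The standing assumptions of the relaxation theorem; `η'` is a Borel representative of `η`. -/
structure IsSetting {d : ℕ} {ι : Type*} (p : ℝ) (η η' : ℝ → ℝ) (a b : ℝ) (α β : ι → ℝ)
    (Ω : Set (Space d)) : Prop where
  one_lt : 1 < p
  nonneg : 0 ≤ a
  lt : a < b
  shell_subset : {x | ‖x‖ ∈ Ioo a b} ⊆ Ω
  measurableSet : MeasurableSet Ω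
  measurable : Measurable η'
  ae_eq : η =ᵐ[volume.restrict (Ioi 0)] η'
  ae_eq_zero : ∀ᵐ r ∂(volume.restrict (Ioi (0 : ℝ))), r ∉ Ioo a b → η r = 0
  decomposition : IsIntervalDecomposition (goodRadii p η a b) α β

namespace IsSetting

variable {d : ℕ} {ι : Type*} {p : ℝ} {η η' : ℝ → ℝ} {a b : ℝ} {α β : ι → ℝ} {Ω : Set (Space d)}

theorem goodRadii_subset_Ioi (h : IsSetting p η η' a b α β Ω) : goodRadii p η a b ⊆ Ioi 0 :=
  fun _ hr => h.nonneg.trans_lt (goodRadii_subset hr).1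

theorem goodSet_eq (h : IsSetting p η η' a b α β Ω) :
    goodSet p η a b Ω = {x | ‖x‖ ∈ goodRadii p η a b} := by
  ext x
  exact ⟨fun hx => hx.2, fun hx => ⟨h.shell_subset (goodRadii_subset hx), hx⟩⟩

theorem measurableSet_good : MeasurableSet {x : Space d | ‖x‖ ∈ goodRadii p η a b} :=
  measurable_norm isOpen_goodRadii.measurableSet

theorem volume_good_ne_top : volume {x : Space d | ‖x‖ ∈ goodRadii p η a b} ≠ ⊤ := by
  refine ne_top_of_le_ne_top (measure_ball_lt_top (x := (0 : Space d)) (r := b)).ne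
    (measure_mono fun x hx => ?_)
  simpa using (goodRadii_subset hx).2

theorem Ioo_subset (h : IsSetting p η η' a b α β Ω) (i : ι) : Ioo (α i) (β i) ⊆ Ioo a b :=
  (h.decomposition.subset i).trans goodRadii_subset

theorem lintegral_conjWeight_ne_top (h : IsSetting p η η' a b α β Ω) (x y : ℝ)
    (hs : Icc x y ⊆ goodRadii p η a b) :
    ∫⁻ r in Icc x y, conjWeight p (radialWeight d η') r ≠ ⊤ :=
  lintegral_conjWeight_Icc_ne_top h.ae_eq h.nonneg h.one_lt x y hs

theorem left_nonneg (h : IsSetting p η η' a b α β Ω) (i : ι) : 0 ≤ α i :=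
  h.decomposition.left_nonneg h.goodRadii_subset_Ioi i

theorem auxWeight_eq (h : IsSetting p η η' a b α β Ω) {i : ι} {x : Space d}
    (hx : ‖x‖ ∈ Ioo (α i) (β i)) : auxWeight p η α β x = auxPiece d p η (α i) (β i) ‖x‖ := by
  refine le_antisymm (iSup_le fun j => ?_)
    (le_iSup (fun j => auxPiece d p η (α j) (β j) ‖x‖) i)
  by_cases hj : ‖x‖ ∈ Icc (α j) (β j)
  · rw [h.decomposition.eq_of_mem hx hj]
  · rw [auxPiece_eq_zero (h.decomposition.lt j) hj]; exact zero_le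

theorem measurable_auxWeight [Countable ι] :
    Measurable (auxWeight p η α β : Space d → ℝ≥0∞) :=
  Measurable.iSup fun _ => measurable_auxPiece.comp measurable_norm

theorem exists_mem (h : IsSetting p η η' a b α β Ω) {r : ℝ} (hr : r ∈ goodRadii p η a b) :
    ∃ i, r ∈ Ioo (α i) (β i) := by
  rw [h.decomposition.eq_iUnion] at hr; exact mem_iUnion.1 hr

theorem lintegral_domEta (h : IsSetting p η η' a b α β Ω) (g : ℝ → ℝ) :
    ∫⁻ r in goodRadii p η a b,
      ENNReal.ofReal (r ^ (d - 1)) * ‖g r‖ₑ ^ p * ENNReal.ofReal (η r) =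
    ∫⁻ r in goodRadii p η a b, ‖g r‖ₑ ^ p * radialWeight d η' r := by
  refine lintegral_congr_ae ?_
  filter_upwards [ae_restrict_of_ae_restrict_of_subset h.goodRadii_subset_Ioi h.ae_eq] with r hr
  rw [radialWeight, hr]; ring

variable [NeZero d]

/-- The bounds of the pieces are finite because nondegenerate shells have positive integral;
finiteness of the number of components makes their sum finite. -/
theorem exists_auxWeight_le [Finite ι] (h : IsSetting p η η' a b α β Ω) :
    ∃ C : ℝ≥0∞, C ≠ ⊤ ∧ ∀ x : Space d, auxWeight p η α β x ≤ C := by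
  have := Fintype.ofFinite ι
  refine ⟨∑ i, ((shellIntegral d p η ((3 * α i + β i) / 4) ((α i + β i) / 2))⁻¹ +
    (shellIntegral d p η ((3 * α i + β i) / 4) ((α i + 3 * β i) / 4))⁻¹ +
    (shellIntegral d p η ((α i + β i) / 2) ((α i + 3 * β i) / 4))⁻¹), ?_, fun x => ?_⟩
  · refine ENNReal.sum_ne_top.2 fun i _ => ?_
    have h0 := h.left_nonneg i
    have h1 := h.decomposition.lt i
    have key : ∀ r s, 0 ≤ r → r < s → (shellIntegral d p η r s)⁻¹ ≠ ⊤ := fun r s hr hrs =>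
      ENNReal.inv_ne_top.2 (shellIntegral_ne_zero h.one_lt h.measurable h.ae_eq hr hrs)
    refine ENNReal.add_ne_top.2 ⟨ENNReal.add_ne_top.2 ⟨?_, ?_⟩, ?_⟩ <;> apply key <;> linarith
  · refine iSup_le fun i => ?_
    refine auxPiece_le.trans ?_
    exact Finset.single_le_sum (f := fun i =>
      ((shellIntegral d p η ((3 * α i + β i) / 4) ((α i + β i) / 2))⁻¹ +
      (shellIntegral d p η ((3 * α i + β i) / 4) ((α i + 3 * β i) / 4))⁻¹ +
      (shellIntegral d p η ((α i + β i) / 2) ((α i + 3 * β i) / 4))⁻¹))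
      (fun _ _ => zero_le) (Finset.mem_univ i)

theorem auxWeight_ne_zero (h : IsSetting p η η' a b α β Ω) {x : Space d}
    (hx : ‖x‖ ∈ goodRadii p η a b) : auxWeight p η α β x ≠ 0 := by
  obtain ⟨i, hi⟩ := h.exists_mem hx
  rw [h.auxWeight_eq hi]
  refine auxPiece_ne_zero (fun r s hrs => ?_) hi
  rcases le_or_gt r s with hle | hlt
  · have hr0 : 0 ≤ r := (h.left_nonneg i).trans (hrs (left_mem_Icc.2 hle)).1.le
    rw [shellIntegral_eq h.one_lt h.measurable h.ae_eq hr0]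
    exact ENNReal.mul_ne_top sphereMass_ne_top (ne_top_of_le_ne_top
      (h.lintegral_conjWeight_ne_top r s (hrs.trans (h.decomposition.subset i)))
      (lintegral_mono_set Ioo_subset_Icc_self))
  · have : {y : Space d | r < ‖y‖ ∧ ‖y‖ < s} = ∅ :=
      eq_empty_of_forall_notMem fun y hy => lt_asymm hlt (hy.1.trans hy.2)
    simp [shellIntegral, this]

theorem ae_auxWeight_eq_zero [Countable ι] (h : IsSetting p η η' a b α β Ω) :
    ∀ᵐ x : Space d, ‖x‖ ∉ goodRadii p η a b → auxWeight p η α β x = 0 := by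
  have h1 : ∀ᵐ r ∂(volume.restrict (Ioi (0 : ℝ))), ∀ i, r ≠ α i ∧ r ≠ β i := by
    refine ae_restrict_of_ae (ae_all_iff.2 fun i => ?_)
    exact (Measure.ae_ne volume (α i)).and (Measure.ae_ne volume (β i))
  filter_upwards [ae_comp_norm_of_ae (E := Space d) h1] with x hx hxS
  refine le_antisymm (iSup_le fun i => ?_) zero_le
  rw [auxPiece_eq_zero (h.decomposition.lt i)]
  intro hi
  exact hxS (h.decomposition.subset i
    ⟨lt_of_le_of_ne hi.1 (hx i).1.symm, lt_of_le_of_ne hi.2 (hx i).2⟩)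

/-- The auxiliary measure has the same null sets as Lebesgue measure on the good set. -/
theorem ae_auxMeasure_iff [Countable ι] (h : IsSetting p η η' a b α β Ω) {P : Space d → Prop} :
    (∀ᵐ x ∂(auxMeasure p η α β Ω), P x) ↔ ∀ᵐ x, ‖x‖ ∈ goodRadii p η a b → P x := by
  have hp : 0 < p - 1 := by linarith [h.one_lt]
  rw [auxMeasure, ae_withDensity_iff (measurable_auxWeight.pow_const _),
    ae_restrict_iff' h.measurableSet]
  constructor
  · intro H
    filter_upwards [H] with x hx hxS
    refine hx (h.shell_subset (goodRadii_subset hxS)) ?_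
    have := h.auxWeight_ne_zero hxS
    simp [ENNReal.rpow_eq_zero_iff, this, hp.not_gt]
  · intro H
    filter_upwards [H, h.ae_auxWeight_eq_zero] with x hx hx0 _ hne
    refine hx (by_contra fun hS => hne ?_)
    rw [hx0 hS, ENNReal.zero_rpow_of_pos hp]

theorem auxMeasure_absolutelyContinuous [Countable ι] (h : IsSetting p η η' a b α β Ω) :
    auxMeasure p η α β Ω ≪ volume.restrict {x | ‖x‖ ∈ goodRadii p η a b} := by
  refine Measure.AbsolutelyContinuous.mk fun s hs h0 => ?_
  rw [measure_eq_zero_iff_ae_notMem] at h0 ⊢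
  rw [h.ae_auxMeasure_iff]
  exact (ae_restrict_iff' measurableSet_good).1 h0

/-- No measurability of `f` is needed, since the density is measurable and finite. The bad radii
contribute nothing, as the density vanishes almost everywhere there. -/
theorem lintegral_auxMeasure [Finite ι] (h : IsSetting p η η' a b α β Ω) (f : Space d → ℝ≥0∞) :
    ∫⁻ x, f x ∂(auxMeasure p η α β Ω) =
      ∫⁻ x in {x | ‖x‖ ∈ goodRadii p η a b}, auxWeight p η α β x ^ (p - 1) * f x := by
  have hp : 0 < p - 1 := by linarith [h.one_lt]
  obtain ⟨C, hC, hle⟩ := h.exists_auxWeight_le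
  rw [auxMeasure, lintegral_withDensity_eq_lintegral_mul_non_measurable _
    (measurable_auxWeight.pow_const _) (Eventually.of_forall fun x =>
      ENNReal.rpow_lt_top_of_nonneg hp.le (ne_top_of_le_ne_top hC (hle x))),
    ← lintegral_indicator h.measurableSet, ← lintegral_indicator measurableSet_good]
  refine lintegral_congr_ae ?_
  filter_upwards [h.ae_auxWeight_eq_zero] with x hx
  by_cases hxS : ‖x‖ ∈ goodRadii p η a b
  · have h1 : x ∈ {x : Space d | ‖x‖ ∈ goodRadii p η a b} := hxS
    rw [indicator_of_mem h1, indicator_of_mem (h.shell_subset (goodRadii_subset hxS))]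
    rfl
  · have h1 : x ∉ {x : Space d | ‖x‖ ∈ goodRadii p η a b} := hxS
    rw [indicator_of_notMem h1, indicator_apply_eq_zero]
    intro _
    simp [hx hxS, ENNReal.zero_rpow_of_pos hp]

/-- The radial energy on the good set in polar coordinates. -/
theorem lintegral_radialField (h : IsSetting p η η' a b α β Ω) {g : ℝ → ℝ}
    (hg : AEStronglyMeasurable g (volume.restrict (goodRadii p η a b))) :
    ∫⁻ x in {x : Space d | ‖x‖ ∈ goodRadii p η a b},
      ‖radialField g x‖ₑ ^ p * ENNReal.ofReal (η ‖x‖) =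
    sphereMass (Space d) * ∫⁻ r in goodRadii p η a b, ‖g r‖ₑ ^ p * radialWeight d η' r := by
  have hpos := h.goodRadii_subset_Ioi
  have hae : ∀ᵐ x ∂(volume.restrict {x : Space d | ‖x‖ ∈ goodRadii p η a b}), η ‖x‖ = η' ‖x‖ :=
    (quasiMeasurePreserving_norm (E := Space d) _).ae
      (ae_restrict_of_ae_restrict_of_subset hpos h.ae_eq)
  have hm : AEMeasurable (fun r => ‖g r‖ₑ ^ p * ENNReal.ofReal (η' r))
      (volume.restrict (goodRadii p η a b)) :=
    (hg.enorm.pow_const _).mul h.measurable.ennreal_ofReal.aemeasurable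
  have h1 := setLIntegral_comp_norm (E := Space d) isOpen_goodRadii.measurableSet hpos hm
  rw [finrank_space] at h1
  refine Eq.trans (lintegral_congr_ae ?_) (h1.trans ?_)
  · filter_upwards [hae, ae_restrict_mem measurableSet_good] with x hx hxS
    rw [enorm_radialField g (norm_pos_iff.1 (hpos hxS)), hx]
  · congr 1
    refine lintegral_congr fun r => ?_
    rw [radialWeight]; ring

/-- The ball and the shell give the same value: outside `a < |x| < b` the factor `η(|x|)` vanishes
almost everywhere. -/
theorem profileEnergy_eq (h : IsSetting p η η' a b α β Ω) (v : ℝ → ℝ) :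
    profileEnergy p η Ω v =
      sphereMass (Space d) * ∫⁻ r in Ioo a b, ‖deriv v r‖ₑ ^ p * radialWeight d η' r := by
  have hpos : Ioo a b ⊆ Ioi 0 := fun r hr => h.nonneg.trans_lt hr.1
  have hm : Measurable (fun r => ‖deriv v r‖ₑ ^ p * ENNReal.ofReal (η' r)) :=
    ((measurable_deriv v).enorm.pow_const _).mul h.measurable.ennreal_ofReal
  have h1 := setLIntegral_comp_norm (E := Space d) measurableSet_Ioo hpos hm.aemeasurable
  rw [finrank_space] at h1
  have hIm : MeasurableSet {x : Space d | ‖x‖ ∈ Ioo a b} := measurable_norm measurableSet_Ioo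
  rw [profileEnergy, ← lintegral_indicator h.measurableSet]
  rw [← lintegral_indicator hIm] at h1
  refine Eq.trans (lintegral_congr_ae ?_) (h1.trans ?_)
  · filter_upwards [ae_comp_norm_of_ae (E := Space d) h.ae_eq,
      ae_comp_norm_of_ae (E := Space d) h.ae_eq_zero] with x hx hx0
    by_cases hxI : ‖x‖ ∈ Ioo a b
    · rw [indicator_of_mem (h.shell_subset hxI), indicator_of_mem (by exact hxI),
        enorm_fderiv_comp_norm v (norm_pos_iff.1 (hpos hxI)), hx]
    · have h1 : x ∉ {x : Space d | ‖x‖ ∈ Ioo a b} := hxI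
      rw [indicator_of_notMem h1, indicator_apply_eq_zero]
      intro _
      rw [hx0 hxI]; simp
  · congr 1
    refine lintegral_congr fun r => ?_
    rw [radialWeight]; ring

/-- The weighted Hardy inequality with respect to the auxiliary weight. -/
theorem hardy (h : IsSetting p η η' a b α β Ω) {v g : ℝ → ℝ}
    (hv : IsPrimitiveOn v g (goodRadii p η a b)) {i : ι} {x : Space d}
    (hx : ‖x‖ ∈ Ioo (α i) (β i)) {s : ℝ} (hs : s ∈ uIcc ‖x‖ ((α i + β i) / 2)) :
    auxWeight p η α β x ^ (p - 1) * ‖v s - v ‖x‖‖ₑ ^ p ≤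
      (∫⁻ r in goodRadii p η a b, ‖g r‖ₑ ^ p * radialWeight d η' r) *
        (sphereMass (Space d))⁻¹ ^ (p - 1) := by
  have hp : 0 ≤ p - 1 := by linarith [h.one_lt]
  have hlt := h.decomposition.lt i
  have hM : (α i + β i) / 2 ∈ Ioo (α i) (β i) := ⟨by linarith, by linarith⟩
  have hsub1 : uIcc ‖x‖ ((α i + β i) / 2) ⊆ Ioo (α i) (β i) := ordConnected_Ioo.uIcc_subset hx hM
  have hsub2 : uIcc ‖x‖ ((α i + β i) / 2) ⊆ goodRadii p η a b :=
    hsub1.trans (h.decomposition.subset i)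
  have hsubs : uIcc ‖x‖ s ⊆ uIcc ‖x‖ ((α i + β i) / 2) := uIcc_subset_uIcc_left hs
  have hk : ∫⁻ r in uIcc ‖x‖ ((α i + β i) / 2), conjWeight p (radialWeight d η') r ≠ ⊤ :=
    h.lintegral_conjWeight_ne_top _ _ hsub2
  have hk' : ∫⁻ r in uIoc ‖x‖ s, conjWeight p (radialWeight d η') r ≠ ⊤ :=
    ne_top_of_le_ne_top hk (lintegral_mono_set (uIoc_subset_uIcc.trans hsubs))
  have h1 := hv.enorm_sub_rpow_le_uIoc h.one_lt (measurable_radialWeight (d := d) h.measurable)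
    (radialWeight_ne_top d η') (hsubs.trans hsub2) hk'
  set σ := ∫⁻ r in uIoc ‖x‖ s, conjWeight p (radialWeight d η') r
  -- The interval from `|x|` to `s` lies within that from `|x|` to the mid radius, and the auxiliary
  -- weight is at most the inverse of the shell integral over the latter.
  have h2 : auxWeight p η α β x * σ ≤ (sphereMass (Space d))⁻¹ := by
    have h3 := auxPiece_mul_shellIntegral_le (d := d) (p := p) (η := η) (r := ‖x‖) hlt
    rw [← h.auxWeight_eq hx, shellIntegral_eq h.one_lt h.measurable h.ae_eq
      (le_min (norm_nonneg x) ((h.left_nonneg i).trans hM.1.le))] at h3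
    have h4 : σ ≤ ∫⁻ t in Ioo (min ‖x‖ ((α i + β i) / 2)) (max ‖x‖ ((α i + β i) / 2)),
        conjWeight p (radialWeight d η') t := by
      rw [setLIntegral_congr Ioo_ae_eq_Icc]
      exact lintegral_mono_set (uIoc_subset_uIcc.trans hsubs)
    rw [ENNReal.le_inv_iff_mul_le, mul_assoc, mul_comm σ]
    exact (mul_le_mul_right (mul_le_mul_right h4 _) _).trans h3
  calc auxWeight p η α β x ^ (p - 1) * ‖v s - v ‖x‖‖ₑ ^ p
      ≤ auxWeight p η α β x ^ (p - 1) *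
        ((∫⁻ r in goodRadii p η a b, ‖g r‖ₑ ^ p * radialWeight d η' r) * σ ^ (p - 1)) := by
        gcongr
        refine h1.trans ?_
        gcongr
        exact uIoc_subset_uIcc.trans (hsubs.trans hsub2)
    _ = (∫⁻ r in goodRadii p η a b, ‖g r‖ₑ ^ p * radialWeight d η' r) *
        (auxWeight p η α β x * σ) ^ (p - 1) := by
        rw [ENNReal.mul_rpow_of_nonneg _ _ hp]; ring
    _ ≤ _ := by gcongr

theorem aestronglyMeasurable_comp_norm [Countable ι] (h : IsSetting p η η' a b α β Ω) {z : ℝ → ℝ}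
    (hz : ContinuousOn z (goodRadii p η a b)) :
    AEStronglyMeasurable (fun x : Space d => z ‖x‖) (auxMeasure p η α β Ω) :=
  ((hz.comp continuous_norm.continuousOn fun _ hx => hx).aestronglyMeasurable
    measurableSet_good).mono_ac h.auxMeasure_absolutelyContinuous

theorem eLpNorm_eq [Finite ι] (h : IsSetting p η η' a b α β Ω) (u : Space d → ℝ) :
    eLpNorm u (ENNReal.ofReal p) (auxMeasure p η α β Ω) =
      (∫⁻ x in {x | ‖x‖ ∈ goodRadii p η a b},
        auxWeight p η α β x ^ (p - 1) * ‖u x‖ₑ ^ p) ^ (1 / p) := by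
  have hp : 0 < p := by linarith [h.one_lt]
  rw [eLpNorm_eq_lintegral_rpow_enorm_toReal (by simpa using hp) ENNReal.ofReal_ne_top,
    ENNReal.toReal_ofReal hp.le, h.lintegral_auxMeasure]

/-- Radial functions of finite energy belong to the weighted `L^p` space. -/
theorem memLp_of_isPrimitiveOn [Finite ι] (h : IsSetting p η η' a b α β Ω) {v g : ℝ → ℝ}
    (hv : IsPrimitiveOn v g (goodRadii p η a b))
    (hE : ∫⁻ r in goodRadii p η a b, ‖g r‖ₑ ^ p * radialWeight d η' r ≠ ⊤) :
    MemLp (fun x : Space d => v ‖x‖) (ENNReal.ofReal p) (auxMeasure p η α β Ω) := by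
  have := Fintype.ofFinite ι
  have hp : 0 ≤ p - 1 := by linarith [h.one_lt]
  refine ⟨h.aestronglyMeasurable_comp_norm (hv.continuousOn isOpen_goodRadii), ?_⟩
  rw [h.eLpNorm_eq]
  refine ENNReal.rpow_lt_top_of_nonneg (by have := h.one_lt; positivity) ?_
  obtain ⟨C, hC, hle⟩ := h.exists_auxWeight_le
  set B : ℝ≥0∞ := 2 ^ (p - 1) * (C ^ (p - 1) * (∑ i, ‖v ((α i + β i) / 2)‖ₑ ^ p) +
    (∫⁻ r in goodRadii p η a b, ‖g r‖ₑ ^ p * radialWeight d η' r) *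
        (sphereMass (Space d))⁻¹ ^ (p - 1))
  have hB : B ≠ ⊤ := by
    refine ENNReal.mul_ne_top (ENNReal.rpow_ne_top_of_nonneg hp (by simp))
      (ENNReal.add_ne_top.2 ⟨ENNReal.mul_ne_top (ENNReal.rpow_ne_top_of_nonneg hp hC)
        (ENNReal.sum_ne_top.2 fun i _ => ?_), ENNReal.mul_ne_top hE ?_⟩)
    · exact ENNReal.rpow_ne_top_of_nonneg (by linarith) enorm_ne_top
    · exact ENNReal.rpow_ne_top_of_nonneg hp (ENNReal.inv_ne_top.2 sphereMass_ne_zero)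
  refine ne_top_of_le_ne_top (ENNReal.mul_ne_top hB (volume_good_ne_top (d := d) (p := p)
    (η := η) (a := a) (b := b))) ?_
  rw [← setLIntegral_const]
  refine setLIntegral_mono' measurableSet_good fun x hx => ?_
  obtain ⟨i, hi⟩ := h.exists_mem hx
  have h1 := h.hardy hv hi right_mem_uIcc
  have h2 : ‖v ‖x‖‖ₑ ^ p ≤ 2 ^ (p - 1) * (‖v ((α i + β i) / 2)‖ₑ ^ p +
      ‖v ((α i + β i) / 2) - v ‖x‖‖ₑ ^ p) := by
    refine le_trans ?_ (ENNReal.rpow_add_le_mul_rpow_add_rpow _ _ h.one_lt.le)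
    refine ENNReal.rpow_le_rpow ?_ (by linarith)
    have h3 : v ‖x‖ = v ((α i + β i) / 2) - (v ((α i + β i) / 2) - v ‖x‖) := by ring
    conv_lhs => rw [h3]
    exact enorm_sub_le
  calc auxWeight p η α β x ^ (p - 1) * ‖v ‖x‖‖ₑ ^ p
      ≤ auxWeight p η α β x ^ (p - 1) * (2 ^ (p - 1) * (‖v ((α i + β i) / 2)‖ₑ ^ p +
      ‖v ((α i + β i) / 2) - v ‖x‖‖ₑ ^ p)) := by gcongr
    _ = 2 ^ (p - 1) * (auxWeight p η α β x ^ (p - 1) * ‖v ((α i + β i) / 2)‖ₑ ^ p +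
      auxWeight p η α β x ^ (p - 1) * ‖v ((α i + β i) / 2) - v ‖x‖‖ₑ ^ p) := by ring
    _ ≤ B := by
      refine mul_le_mul_right (add_le_add (mul_le_mul' (ENNReal.rpow_le_rpow (hle x) hp) ?_) h1) _
      exact Finset.single_le_sum (f := fun i => ‖v ((α i + β i) / 2)‖ₑ ^ p)
          (fun _ _ => zero_le) (Finset.mem_univ i)

/-- A dominated convergence criterion in the weighted `L^p` space. -/
theorem exists_tendsto [Finite ι] [Fact (1 ≤ ENNReal.ofReal p)] (h : IsSetting p η η' a b α β Ω)
    (f : X p η α β Ω) {z : ℝ → ℝ}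
    (hz : ContinuousOn z (goodRadii p η a b))
    (hf : f =ᵐ[auxMeasure p η α β Ω] fun x => z ‖x‖) {zn : ℕ → ℝ → ℝ}
    (hzn : ∀ n, ContinuousOn (zn n) (goodRadii p η a b)) {B : ℝ≥0∞} (hB : B ≠ ⊤)
    (hbd : ∀ n, ∀ x : Space d, ‖x‖ ∈ goodRadii p η a b →
      auxWeight p η α β x ^ (p - 1) * ‖zn n ‖x‖ - z ‖x‖‖ₑ ^ p ≤ B)
    (hlim : ∀ r ∈ goodRadii p η a b, Tendsto (fun n => zn n r) atTop (𝓝 (z r))) :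
    ∃ fn : ℕ → X p η α β Ω, (∀ n, fn n =ᵐ[auxMeasure p η α β Ω] fun x => zn n ‖x‖) ∧
      Tendsto fn atTop (𝓝 f) := by
  have hp : 0 < p - 1 := by linarith [h.one_lt]
  have hp0 : 0 < p := by linarith
  obtain ⟨C, hC, hle⟩ := h.exists_auxWeight_le
  have hzm : MemLp (fun x : Space d => z ‖x‖) (ENNReal.ofReal p) (auxMeasure p η α β Ω) :=
    (memLp_congr_ae hf).1 (Lp.memLp f)
  have hdm : ∀ n, MemLp (fun x : Space d => zn n ‖x‖ - z ‖x‖) (ENNReal.ofReal p)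
      (auxMeasure p η α β Ω) := by
    intro n
    refine ⟨h.aestronglyMeasurable_comp_norm (z := fun r => zn n r - z r) ((hzn n).sub hz), ?_⟩
    rw [h.eLpNorm_eq]
    refine ENNReal.rpow_lt_top_of_nonneg (by positivity) ?_
    refine ne_top_of_le_ne_top (ENNReal.mul_ne_top hB (volume_good_ne_top (d := d) (p := p)
      (η := η) (a := a) (b := b))) ?_
    rw [← setLIntegral_const]
    exact setLIntegral_mono' measurableSet_good fun x hx => hbd n x hx
  have hznm : ∀ n, MemLp (fun x : Space d => zn n ‖x‖) (ENNReal.ofReal p)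
      (auxMeasure p η α β Ω) := by
    intro n
    have := (hdm n).add hzm
    convert this using 1
    ext x; simp
  refine ⟨fun n => (hznm n).toLp, fun n => MemLp.coeFn_toLp _, ?_⟩
  have hff : f = hzm.toLp := by
    rw [← Lp.toLp_coeFn f (Lp.memLp f), MemLp.toLp_eq_toLp_iff]; exact hf
  rw [hff, Lp.tendsto_Lp_iff_tendsto_eLpNorm'']
  have e1 : ∀ n, eLpNorm ((fun x : Space d => zn n ‖x‖) - fun x => z ‖x‖) (ENNReal.ofReal p)
      (auxMeasure p η α β Ω) = (∫⁻ x in {x | ‖x‖ ∈ goodRadii p η a b},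
        auxWeight p η α β x ^ (p - 1) * ‖zn n ‖x‖ - z ‖x‖‖ₑ ^ p) ^ (1 / p) := fun n =>
    h.eLpNorm_eq _
  simp_rw [e1]
  have h1 : Tendsto (fun n => ∫⁻ x in {x : Space d | ‖x‖ ∈ goodRadii p η a b},
      auxWeight p η α β x ^ (p - 1) * ‖zn n ‖x‖ - z ‖x‖‖ₑ ^ p) atTop
      (𝓝 (∫⁻ x in {x : Space d | ‖x‖ ∈ goodRadii p η a b}, 0)) := by
    refine tendsto_lintegral_of_dominated_convergence' (fun _ => B) (fun n => ?_) (fun n => ?_)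
      ?_ ?_
    · refine (measurable_auxWeight.pow_const _).aemeasurable.mul (AEMeasurable.pow_const ?_ _)
      exact ((((hzn n).sub hz).comp continuous_norm.continuousOn
        fun _ hx => hx).aestronglyMeasurable measurableSet_good).enorm
    · exact (ae_restrict_iff' measurableSet_good).2 (Eventually.of_forall (hbd n))
    · rw [setLIntegral_const]; exact ENNReal.mul_ne_top hB volume_good_ne_top
    · refine (ae_restrict_iff' measurableSet_good).2 (Eventually.of_forall fun x hx => ?_)
      have h2 : Tendsto (fun n => ‖zn n ‖x‖ - z ‖x‖‖ₑ ^ p) atTop (𝓝 0) := by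
        have h3 := ((hlim ‖x‖ hx).sub_const (z ‖x‖)).enorm
        rw [sub_self, enorm_zero] at h3
        have h4 := (ENNReal.continuous_rpow_const (y := p)).tendsto 0 |>.comp h3
        rwa [ENNReal.zero_rpow_of_pos hp0] at h4
      have h5 := ENNReal.Tendsto.const_mul (a := auxWeight p η α β x ^ (p - 1)) h2
        (Or.inr (ENNReal.rpow_ne_top_of_nonneg hp.le (ne_top_of_le_ne_top hC (hle x))))
      rwa [mul_zero] at h5
  have h6 := (ENNReal.continuous_rpow_const (y := 1 / p)).tendsto _ |>.comp h1
  rw [lintegral_zero, ENNReal.zero_rpow_of_pos (by positivity)] at h6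
  exact h6

end IsSetting

/-! ### Lower semicontinuous envelopes -/

section Envelope

variable {Y : Type*} [TopologicalSpace Y] {Φ Ψ : Y → ℝ≥0∞}

theorem lscEnvelope_le (y : Y) : lscEnvelope Φ y ≤ Φ y :=
  iSup_le fun _ => iSup_le fun _ => iSup_le fun h => h y

theorem le_lscEnvelope (hΨ : LowerSemicontinuous Ψ) (h : ∀ z, Ψ z ≤ Φ z) (y : Y) :
    Ψ y ≤ lscEnvelope Φ y :=
  le_iSup_of_le Ψ (le_iSup_of_le hΨ (le_iSup_of_le h le_rfl))

theorem lowerSemicontinuous_lscEnvelope : LowerSemicontinuous (lscEnvelope Φ) :=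
  lowerSemicontinuous_iSup fun _ => lowerSemicontinuous_iSup fun h =>
    lowerSemicontinuous_iSup fun _ => h

theorem lscEnvelope_le_of_tendsto {yn : ℕ → Y} {y : Y} (hy : Tendsto yn atTop (𝓝 y)) {c : ℝ≥0∞}
    (h : ∀ c' > c, ∀ᶠ n in atTop, lscEnvelope Φ (yn n) ≤ c') : lscEnvelope Φ y ≤ c :=
  le_of_forall_gt_imp_ge_of_dense fun c' hc' =>
    (lowerSemicontinuous_lscEnvelope.isClosed_preimage c').mem_of_tendsto hy (h c' hc')

end Envelope

/-! ### The weak energy and the lower bound -/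

/-- The least radial energy on the good radii of the primitive profiles of `f`. -/
noncomputable def weakEnergy {d : ℕ} {ι : Type*} (p : ℝ) (η η' : ℝ → ℝ) (a b : ℝ) (α β : ι → ℝ)
    (Ω : Set (Space d)) (f : X p η α β Ω) : ℝ≥0∞ :=
  ⨅ (v : ℝ → ℝ) (g : ℝ → ℝ) (_ : IsPrimitiveOn v g (goodRadii p η a b))
    (_ : f =ᵐ[auxMeasure p η α β Ω] fun x => v ‖x‖),
    sphereMass (Space d) * ∫⁻ r in goodRadii p η a b, ‖g r‖ₑ ^ p * radialWeight d η' r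

namespace IsSetting

variable {d : ℕ} {ι : Type*} {p : ℝ} {η η' : ℝ → ℝ} {a b : ℝ} {α β : ι → ℝ} {Ω : Set (Space d)}

theorem exists_of_weakEnergy_lt {f : X p η α β Ω} {t : ℝ≥0∞}
    (h : weakEnergy p η η' a b α β Ω f < t) :
    ∃ v g, IsPrimitiveOn v g (goodRadii p η a b) ∧
      f =ᵐ[auxMeasure p η α β Ω] (fun x => v ‖x‖) ∧
      sphereMass (Space d) * ∫⁻ r in goodRadii p η a b, ‖g r‖ₑ ^ p * radialWeight d η' r < t := by
  simp only [weakEnergy, iInf_lt_iff] at h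
  obtain ⟨v, g, h1, h2, h3⟩ := h
  exact ⟨v, g, h1, h2, h3⟩

theorem weakEnergy_le {f : X p η α β Ω} {v g : ℝ → ℝ}
    (h1 : IsPrimitiveOn v g (goodRadii p η a b))
    (h2 : f =ᵐ[auxMeasure p η α β Ω] fun x => v ‖x‖) :
    weakEnergy p η η' a b α β Ω f ≤
      sphereMass (Space d) * ∫⁻ r in goodRadii p η a b, ‖g r‖ₑ ^ p * radialWeight d η' r :=
  iInf_le_of_le v (iInf_le_of_le g (iInf_le_of_le h1 (iInf_le _ h2)))

theorem isPrimitiveOn_deriv (h : IsSetting p η η' a b α β Ω) {v : ℝ → ℝ}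
    (hv : AbsolutelyContinuousOnInterval v a b) :
    IsPrimitiveOn v (deriv v) (goodRadii p η a b) :=
  (AbsolutelyContinuousOnInterval.isPrimitiveOn h.lt.le hv).mono
    (goodRadii_subset.trans Ioo_subset_Icc_self)

variable [NeZero d]

theorem lowerSemicontinuous_weakEnergy [Finite ι] [Fact (1 ≤ ENNReal.ofReal p)]
    (h : IsSetting p η η' a b α β Ω) :
    LowerSemicontinuous (weakEnergy p η η' a b α β Ω) := by
  refine lowerSemicontinuous_iff_isClosed_preimage.2 fun t => ?_
  by_cases ht : t = ⊤
  · simp [ht]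
  refine IsSeqClosed.isClosed fun fn f hfn hlim => ?_
  -- The infimum is not yet known to be attained, so the profiles are chosen up to `ε`.
  refine ENNReal.le_of_forall_pos_le_add fun ε hε _ => ?_
  have hlt : ∀ n, weakEnergy p η η' a b α β Ω (fn n) < t + ε := fun n =>
    lt_of_le_of_lt (hfn n) (ENNReal.lt_add_right ht (by simpa using hε.ne'))
  choose v g hv hf hE using fun n => exists_of_weakEnergy_lt (hlt n)
  obtain ⟨ns, hns, hae⟩ := (tendstoInMeasure_of_tendsto_Lp hlim).exists_seq_tendsto_ae
  have h1 : ∀ᵐ x : Space d, ‖x‖ ∈ goodRadii p η a b →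
      Tendsto (fun n => v (ns n) ‖x‖) atTop (𝓝 (f x)) := by
    refine h.ae_auxMeasure_iff.1 ?_
    filter_upwards [hae, ae_all_iff.2 hf] with x hx hx2
    refine hx.congr fun n => hx2 (ns n)
  -- Extension by zero makes the profiles measurable on the line. The set of convergence is then
  -- measurable, as the passage from almost every `x` to almost every radius requires.
  set vi : ℕ → ℝ → ℝ := fun n => (goodRadii p η a b).indicator (v (ns n)) with hvi
  have hvm : ∀ n, Measurable (vi n) := by
    classical
    intro n
    have h0 : ContinuousOn (0 : ℝ → ℝ) (goodRadii p η a b)ᶜ := continuousOn_const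
    have := ((hv (ns n)).continuousOn isOpen_goodRadii).measurable_piecewise h0
      isOpen_goodRadii.measurableSet
    rwa [piecewise_eq_indicator] at this
  have hP : MeasurableSet {r | ∃ L, Tendsto (fun n => vi n r) atTop (𝓝 L)} :=
    measurableSet_exists_tendsto hvm
  have h2 : ∀ᵐ r ∂(volume.restrict (Ioi (0 : ℝ))),
      ∃ L, Tendsto (fun n => vi n r) atTop (𝓝 L) := by
    refine ae_of_ae_comp_norm (E := Space d) hP ?_
    filter_upwards [h1] with x hx
    by_cases hxS : ‖x‖ ∈ goodRadii p η a b
    · exact ⟨f x, (hx hxS).congr fun n => (indicator_of_mem hxS _).symm⟩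
    · exact ⟨0, tendsto_const_nhds.congr fun n => (indicator_of_notMem hxS _).symm⟩
  set w : ℝ → ℝ := fun r => limUnder atTop fun n => vi n r
  have h3 : ∀ᵐ r, r ∈ goodRadii p η a b → Tendsto (fun n => v (ns n) r) atTop (𝓝 (w r)) := by
    filter_upwards [(ae_restrict_iff' measurableSet_Ioi).1 h2] with r hr hrS
    exact (tendsto_nhds_limUnder (hr (h.goodRadii_subset_Ioi hrS))).congr fun n =>
      indicator_of_mem hrS _
  have hc0 : sphereMass (Space d) ≠ 0 := sphereMass_ne_zero
  have hct : sphereMass (Space d) ≠ ⊤ := sphereMass_ne_top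
  obtain ⟨w', g', hw', hwg, hE'⟩ := exists_isPrimitiveOn_of_ae_tendsto h.one_lt
    (measurable_radialWeight (d := d) h.measurable) (radialWeight_ne_top d η') isOpen_goodRadii
    h.lintegral_conjWeight_ne_top (fun n => hv (ns n)) (T := (t + ε) / sphereMass (Space d))
    (ENNReal.div_ne_top (by finiteness) hc0)
    (fun n => (ENNReal.le_div_iff_mul_le (Or.inl hc0) (Or.inl hct)).2
      (by rw [mul_comm]; exact (hE (ns n)).le)) h3
  refine (weakEnergy_le hwg ?_).trans ?_
  · refine h.ae_auxMeasure_iff.2 ?_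
    have h4 : ∀ᵐ r ∂(volume.restrict (Ioi (0 : ℝ))), r ∈ goodRadii p η a b →
        Tendsto (fun n => v (ns n) r) atTop (𝓝 (w' r)) := by
      refine ae_restrict_of_ae ?_
      filter_upwards [h3, (ae_restrict_iff' isOpen_goodRadii.measurableSet).1 hw'] with r hr hr' hS
      rw [hr' hS]; exact hr hS
    filter_upwards [h1, ae_comp_norm_of_ae (E := Space d) h4] with x hx hx' hxS
    exact tendsto_nhds_unique (hx hxS) (hx' hxS)
  · rw [mul_comm]
    exact (ENNReal.le_div_iff_mul_le (Or.inl hc0) (Or.inl hct)).1 hE'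

/-- An absolutely continuous profile is a primitive of its derivative, and discarding the bad radii
can only lower the energy. -/
theorem weakEnergy_le_F [Finite ι] (h : IsSetting p η η' a b α β Ω) (f : X p η α β Ω) :
    weakEnergy p η η' a b α β Ω f ≤ F p η a b α β Ω f := by
  refine le_iInf fun u => le_iInf fun v => le_iInf fun huv => le_iInf fun hf => ?_
  refine (weakEnergy_le (h.isPrimitiveOn_deriv huv.2.2.1) ?_).trans ?_
  · have h1 : ∀ᵐ x ∂(auxMeasure p η α β Ω), u x = v ‖x‖ := by
      refine h.ae_auxMeasure_iff.2 (Eventually.of_forall fun x hx => huv.2.2.2 x ?_)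
      rw [h.goodSet_eq]; exact hx
    exact hf.trans h1
  · rw [h.profileEnergy_eq]
    gcongr
    exact goodRadii_subset

theorem weakEnergy_le_relaxedF [Finite ι] [Fact (1 ≤ ENNReal.ofReal p)]
    (h : IsSetting p η η' a b α β Ω) (f : X p η α β Ω) :
    weakEnergy p η η' a b α β Ω f ≤ relaxedF p η a b α β Ω f :=
  le_lscEnvelope h.lowerSemicontinuous_weakEnergy h.weakEnergy_le_F f

/-- A profile that is a primitive on the whole of `(a, b)` gives an upper bound of `F`. -/
theorem F_le (h : IsSetting p η η' a b α β Ω) {f : X p η α β Ω} {v g : ℝ → ℝ}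
    (hv : IsPrimitiveOn v g univ) (hf : f =ᵐ[auxMeasure p η α β Ω] fun x => v ‖x‖) :
    F p η a b α β Ω f ≤
      sphereMass (Space d) * ∫⁻ r in Ioo a b, ‖g r‖ₑ ^ p * radialWeight d η' r := by
  have hvc : Continuous v := by
    rw [← continuousOn_univ]; exact hv.continuousOn isOpen_univ
  refine iInf_le_of_le (fun x => v ‖x‖) (iInf_le_of_le v (iInf_le_of_le ⟨?_, ?_, ?_, ?_⟩
    (iInf_le_of_le hf ?_)))
  · exact (hvc.comp continuous_norm).aestronglyMeasurable
  · refine ⟨_, ((hv.mono (subset_univ (Ioo a b))).hasWeakGradientOn h.nonneg).mono ?_⟩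
    · rw [h.goodSet_eq]; exact fun x hx => goodRadii_subset hx
  · exact hv.absolutelyContinuousOnInterval (subset_univ _)
  · exact fun x _ => rfl
  · rw [h.profileEnergy_eq]
    refine mul_le_mul_right (le_of_eq (lintegral_congr_ae ?_)) _
    filter_upwards [(hv.mono (subset_univ (Ioo a b))).ae_eq_deriv isOpen_Ioo] with r hr
    rw [hr]

end IsSetting

/-! ### Operations on primitives -/

namespace IsPrimitiveOn

variable {v g v' g' : ℝ → ℝ} {S : Set ℝ}

theorem congr (h : IsPrimitiveOn v g S) (hv : EqOn v v' S) (hg : EqOn g g' S) :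
    IsPrimitiveOn v' g' S := by
  intro x y hxy hs
  have hs' : uIcc x y ⊆ S := by rwa [uIcc_of_le hxy]
  have hg' : EqOn g g' (uIcc x y) := hg.mono hs'
  rw [← hv (hs (left_mem_Icc.2 hxy)), ← hv (hs (right_mem_Icc.2 hxy)),
    ← intervalIntegral.integral_congr hg']
  exact ⟨(h hxy hs).1.congr (hg'.mono uIoc_subset_uIcc), (h hxy hs).2⟩

theorem const (c : ℝ) (S : Set ℝ) : IsPrimitiveOn (fun _ => c) (fun _ => 0) S := by
  intro x y _ _; simp

theorem sub (h : IsPrimitiveOn v g S) (h' : IsPrimitiveOn v' g' S) :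
    IsPrimitiveOn (fun r => v r - v' r) (fun r => g r - g' r) S := by
  intro x y hxy hs
  obtain ⟨h1, h2⟩ := h hxy hs
  obtain ⟨h3, h4⟩ := h' hxy hs
  refine ⟨h1.sub h3, ?_⟩
  rw [intervalIntegral.integral_sub h1 h3, ← h2, ← h4]; ring

theorem sum {ι : Type*} (s : Finset ι) {v g : ι → ℝ → ℝ} (h : ∀ i, IsPrimitiveOn (v i) (g i) S) :
    IsPrimitiveOn (fun r => ∑ i ∈ s, v i r) (fun r => ∑ i ∈ s, g i r) S := by
  intro x y hxy hs
  have h1 := fun i => h i hxy hs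
  refine ⟨?_, ?_⟩
  · have := IntervalIntegrable.sum s fun i _ => (h1 i).1
    have e : (fun r => ∑ i ∈ s, g i r) = ∑ i ∈ s, g i := by ext r; simp
    rwa [e]
  · rw [intervalIntegral.integral_finsetSum fun i _ => (h1 i).1, ← Finset.sum_sub_distrib]
    exact Finset.sum_congr rfl fun i _ => (h1 i).2

theorem mul (hS : IsOpen S) (h : IsPrimitiveOn v g S) (h' : IsPrimitiveOn v' g' S) :
    IsPrimitiveOn (fun r => v r * v' r) (fun r => g r * v' r + v r * g' r) S := by
  intro x y hxy hs
  have hs' : uIcc x y ⊆ S := by rwa [uIcc_of_le hxy]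
  refine ⟨((h hxy hs).1.mul_continuousOn ((h'.continuousOn hS).mono hs')).add
    ((h' hxy hs).1.continuousOn_mul ((h.continuousOn hS).mono hs')), ?_⟩
  rw [← AbsolutelyContinuousOnInterval.integral_deriv_mul_eq_sub
    (h.absolutelyContinuousOnInterval hs') (h'.absolutelyContinuousOnInterval hs')]
  refine intervalIntegral.integral_congr_ae ?_
  filter_upwards [h.ae_hasDerivAt hS, h'.ae_hasDerivAt hS] with r hr hr' hrI
  have hrS := hs' (uIoc_subset_uIcc hrI)
  rw [(hr hrS).deriv, (hr' hrS).deriv]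

/-- Clamping the variable to a compact interval truncates the derivative. -/
theorem comp_clamp (h : IsPrimitiveOn v g S) {s t : ℝ} (hst : s ≤ t) (hs : Icc s t ⊆ S) :
    IsPrimitiveOn (fun r => v (max s (min r t))) ((Ioc s t).indicator g) univ := by
  intro x y hxy _
  have hg : IntegrableOn g (Ioc s t) := (h.integrableOn_Icc s t hs).mono_set Ioc_subset_Icc_self
  have hle : max s (min x t) ≤ max s (min y t) := max_le_max_left _ (min_le_min_right _ hxy)
  have hsub : Icc (max s (min x t)) (max s (min y t)) ⊆ Icc s t :=
    Icc_subset_Icc (le_max_left _ _) (max_le hst (min_le_right _ _))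
  refine ⟨(hg.integrable_indicator measurableSet_Ioc).intervalIntegrable, ?_⟩
  rw [(h hle (hsub.trans hs)).2, intervalIntegral.integral_of_le hle,
    intervalIntegral.integral_of_le hxy, setIntegral_indicator measurableSet_Ioc]
  congr 2
  ext r
  simp only [mem_inter_iff, mem_Ioc, max_lt_iff, le_max_iff, min_lt_iff, le_min_iff]
  grind

end IsPrimitiveOn

theorem enorm_sum_rpow_le {ι : Type*} (s : Finset ι) (f : ι → ℝ) {p : ℝ} (hp : 1 ≤ p) :
    ‖∑ i ∈ s, f i‖ₑ ^ p ≤ (s.card : ℝ≥0∞) ^ (p - 1) * ∑ i ∈ s, ‖f i‖ₑ ^ p :=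
  (ENNReal.rpow_le_rpow (enorm_sum_le _ _) (by linarith)).trans
    (ENNReal.rpow_sum_le_const_mul_sum_rpow s _ hp)

/-! ### Cut-offs, gluing and the upper bound -/

namespace IsSetting

variable {d : ℕ} {ι : Type*} {p : ℝ} {η η' : ℝ → ℝ} {a b : ℝ} {α β : ι → ℝ} {Ω : Set (Space d)}

theorem le_left_and_right_le (h : IsSetting p η η' a b α β Ω) (i : ι) : a ≤ α i ∧ β i ≤ b :=
  (Ioo_subset_Ioo_iff (h.decomposition.lt i)).1 (h.Ioo_subset i)

/-- A transition from `0` to `1` of small energy across a bad radius. -/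
theorem exists_transition (h : IsSetting p η η' a b α β Ω) {c δ : ℝ} (hc : c ∈ Icc a b)
    (hcS : c ∉ goodRadii p η a b) (hδ : 0 < δ) {ε : ℝ≥0∞} (hε : ε ≠ 0) :
    ∃ t k : ℝ → ℝ, IsPrimitiveOn t k univ ∧ (∀ r, t r ∈ Icc (0 : ℝ) 1) ∧
      (∀ r ∈ Ioo a b, r ≤ c - δ → t r = 0) ∧ (∀ r ∈ Ioo a b, c + δ ≤ r → t r = 1) ∧
      (∀ r ∉ Ioo (c - δ) (c + δ), k r = 0) ∧ ∫⁻ r, ‖k r‖ₑ ^ p * radialWeight d η' r ≤ ε := by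
  have hp : 0 < p := by linarith [h.one_lt]
  -- At an end point of `(a, b)` a constant suffices, because the prescribed values concern only
  -- radii of `(a, b)`. Divergence of the conjugate weight is available at interior bad radii only.
  rcases hc.1.eq_or_lt with rfl | hac
  · refine ⟨fun _ => 1, fun _ => 0, .const 1 univ, by simp, fun r hr hle => ?_, by simp, by simp,
      by simp [hp]⟩
    linarith [hr.1]
  rcases hc.2.eq_or_lt with rfl | hcb
  · refine ⟨fun _ => 0, fun _ => 0, .const 0 univ, by simp, by simp, fun r hr hle => ?_, by simp,
      by simp [hp]⟩
    linarith [hr.2]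
  obtain ⟨t, k, h1, h2, h3, h4, h5, h6⟩ := RadialRelaxation.exists_transition h.one_lt
    (measurable_radialWeight (d := d) h.measurable)
    (lintegral_conjWeight_eq_top h.ae_eq h.nonneg h.one_lt ⟨hac, hcb⟩ hcS hδ) hε
  exact ⟨t, k, h1, h2, fun r _ => h3 r, fun r _ => h4 r, h5, h6⟩

/-- A cut-off function of small energy for one component of the set of good radii. -/
theorem exists_cutoff (h : IsSetting p η η' a b α β Ω) (i : ι) {δ : ℝ} (hδ : 0 < δ) {ε : ℝ≥0∞}
    (hε : ε ≠ 0) :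
    ∃ χ k : ℝ → ℝ, IsPrimitiveOn χ k univ ∧ (∀ r, |χ r| ≤ 1) ∧
      (∀ r ∈ Ioo a b, r ∈ Icc (α i + δ) (β i - δ) → χ r = 1) ∧
      (∀ r ∈ Ioo a b, r ≤ α i - δ ∨ β i + δ ≤ r → χ r = 0) ∧
      (∀ r, r ∉ Ioo (α i - δ) (α i + δ) → r ∉ Ioo (β i - δ) (β i + δ) → k r = 0) ∧
      ∫⁻ r, ‖k r‖ₑ ^ p * radialWeight d η' r ≤ 2 ^ (p - 1) * (ε + ε) := by
  have hlt := h.decomposition.lt i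
  obtain ⟨ha, hb⟩ := h.le_left_and_right_le i
  obtain ⟨s, k, s1, s2, s3, s4, s5, s6⟩ := h.exists_transition (d := d) ⟨ha, hlt.le.trans hb⟩
    (h.decomposition.left_notMem i) hδ hε
  obtain ⟨t, l, t1, t2, t3, t4, t5, t6⟩ := h.exists_transition (d := d) ⟨ha.trans hlt.le, hb⟩
    (h.decomposition.right_notMem i) hδ hε
  -- The cut-off is the difference of a transition at the left end point and one at the right. These
  -- may overlap for large `δ`, so only `|χ| ≤ 1` is claimed.
  refine ⟨_, _, s1.sub t1, fun r => ?_, fun r hr hr' => ?_, fun r hr hr' => ?_,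
    fun r hr hr' => ?_, ?_⟩
  · rw [abs_le]
    constructor <;> linarith [(s2 r).1, (s2 r).2, (t2 r).1, (t2 r).2]
  · rw [s4 r hr hr'.1, t3 r hr hr'.2, sub_zero]
  · rcases hr' with hr' | hr'
    · rw [s3 r hr hr', t3 r hr (by linarith), sub_zero]
    · rw [s4 r hr (by linarith), t4 r hr hr', sub_self]
  · rw [s5 r hr, t5 r hr', sub_zero]
  · have hm := measurable_radialWeight (d := d) h.measurable
    have hk : AEStronglyMeasurable k volume := by
      simpa using s1.aestronglyMeasurable isOpen_univ
    calc ∫⁻ r, ‖k r - l r‖ₑ ^ p * radialWeight d η' r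
        ≤ ∫⁻ r, 2 ^ (p - 1) * (‖k r‖ₑ ^ p * radialWeight d η' r +
          ‖l r‖ₑ ^ p * radialWeight d η' r) := by
          refine lintegral_mono fun r => ?_
          rw [← add_mul, ← mul_assoc]
          gcongr
          exact (ENNReal.rpow_le_rpow enorm_sub_le (by linarith [h.one_lt])).trans
            (ENNReal.rpow_add_le_mul_rpow_add_rpow _ _ h.one_lt.le)
      _ = 2 ^ (p - 1) * ((∫⁻ r, ‖k r‖ₑ ^ p * radialWeight d η' r) +
          ∫⁻ r, ‖l r‖ₑ ^ p * radialWeight d η' r) := by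
          rw [lintegral_const_mul' _ _ (ENNReal.rpow_ne_top_of_nonneg
            (by linarith [h.one_lt]) (by simp)), lintegral_add_left'
            (f := fun r => ‖k r‖ₑ ^ p * radialWeight d η' r)
            ((hk.enorm.pow_const _).mul hm.aemeasurable)]
      _ ≤ _ := by gcongr

/-- Freezing a profile near the end points of the components truncates its derivative. -/
theorem isPrimitiveOn_clamp (h : IsSetting p η η' a b α β Ω) {v g z : ℝ → ℝ}
    (hv : IsPrimitiveOn v g (goodRadii p η a b)) {s t : ι → ℝ} (hs : ∀ i, α i < s i)
    (hst : ∀ i, s i ≤ t i) (ht : ∀ i, t i < β i)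
    (hz : ∀ i, ∀ r ∈ Ioo (α i) (β i), z r = v (max (s i) (min r (t i)))) :
    IsPrimitiveOn z ((⋃ i, Ioc (s i) (t i)).indicator g) (goodRadii p η a b) := by
  have hsub : ∀ i, Icc (s i) (t i) ⊆ Ioo (α i) (β i) := fun i r hr =>
    ⟨(hs i).trans_le hr.1, hr.2.trans_lt (ht i)⟩
  refine h.decomposition.isPrimitiveOn fun i => ?_
  refine ((hv.comp_clamp (hst i) ((hsub i).trans (h.decomposition.subset i))).mono
    (subset_univ _)).congr (fun r hr => (hz i r hr).symm) fun r hr => ?_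
  by_cases hr' : r ∈ Ioc (s i) (t i)
  · rw [indicator_of_mem hr', indicator_of_mem (mem_iUnion_of_mem i hr')]
  · rw [indicator_of_notMem hr', indicator_of_notMem]
    intro hmem
    obtain ⟨j, hj⟩ := mem_iUnion.1 hmem
    obtain rfl := h.decomposition.eq_of_mem hr
      (Ioo_subset_Icc_self (hsub j (Ioc_subset_Icc_self hj)))
    exact hr' hj

end IsSetting

namespace IsSetting

variable {d : ℕ} {ι : Type*} {p : ℝ} {η η' : ℝ → ℝ} {a b : ℝ} {α β : ι → ℝ} {Ω : Set (Space d)}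

/-- Gluing of the truncated profiles to a profile on the whole line, at a small cost of energy. -/
theorem exists_gluing [Fintype ι] (h : IsSetting p η η' a b α β Ω) {v g : ℝ → ℝ}
    (hv : IsPrimitiveOn v g (goodRadii p η a b)) {s t : ι → ℝ} (hst : ∀ i, s i ≤ t i) {B : ℝ}
    (hB : ∀ i r, |v (max (s i) (min r (t i)))| ≤ B) {δ : ℝ} (hδ : 0 < δ)
    (hs : ∀ i, α i + δ ≤ s i) (ht : ∀ i, t i ≤ β i - δ) {ε : ℝ≥0∞} (hε : ε ≠ 0) :
    ∃ V G : ℝ → ℝ, IsPrimitiveOn V G univ ∧ (∀ r, |V r| ≤ Fintype.card ι * B) ∧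
      (∀ i, ∀ r ∈ Icc (α i + δ) (β i - δ), V r = v (max (s i) (min r (t i)))) ∧
      ∫⁻ r in Ioo a b, ‖G r‖ₑ ^ p * radialWeight d η' r ≤
        (∫⁻ r in goodRadii p η a b, ‖g r‖ₑ ^ p * radialWeight d η' r) +
          (Fintype.card ι : ℝ≥0∞) ^ (p - 1) * ENNReal.ofReal B ^ p *
            (Fintype.card ι * (2 ^ (p - 1) * (ε + ε))) := by
  have hp : 0 < p := by linarith [h.one_lt]
  have hp1 : 0 ≤ p - 1 := by linarith [h.one_lt]
  have hm := measurable_radialWeight (d := d) h.measurable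
  have hsub : ∀ i, Icc (s i) (t i) ⊆ Ioo (α i) (β i) := fun i r hr =>
    ⟨by linarith [hr.1, hs i], by linarith [hr.2, ht i]⟩
  choose χ k hχ h1 hone hzero hk hE using fun i => h.exists_cutoff (d := d) i hδ hε
  set w : ι → ℝ → ℝ := fun i r => v (max (s i) (min r (t i)))
  have hw : ∀ i, IsPrimitiveOn (w i) ((Ioc (s i) (t i)).indicator g) univ := fun i =>
    hv.comp_clamp (hst i) ((hsub i).trans (h.decomposition.subset i))
  have hcore : ∀ i r, r ∈ Icc (α i + δ) (β i - δ) → r ∈ Ioo a b := fun i r hr =>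
    h.Ioo_subset i ⟨by linarith [hr.1], by linarith [hr.2]⟩
  -- A point within distance less than `δ` of the core `[α_j + δ, β_j - δ]` lies in the component,
  -- hence is good. So no transition at a bad radius reaches a core.
  have haway : ∀ c, c ∉ goodRadii p η a b → ∀ j r, r ∈ Icc (α j + δ) (β j - δ) →
      r ∉ Ioo (c - δ) (c + δ) := by
    intro c hc j r hr hr'
    refine hc (h.decomposition.subset j ⟨?_, ?_⟩) <;> linarith [hr.1, hr.2, hr'.1, hr'.2]
  have hkz : ∀ i j r, r ∈ Icc (α j + δ) (β j - δ) → k i r = 0 := fun i j r hr =>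
    hk i r (haway _ (h.decomposition.left_notMem i) j r hr)
      (haway _ (h.decomposition.right_notMem i) j r hr)
  have hχz : ∀ i j r, i ≠ j → r ∈ Icc (α j + δ) (β j - δ) → χ i r = 0 := by
    intro i j r hij hr
    refine hzero i r (hcore j r hr) ?_
    by_contra! hcon
    refine hij (h.decomposition.eq_of_mem (r := r) (i := j) (j := i) ?_ ?_).symm
    · exact ⟨by linarith [hr.1], by linarith [hr.2]⟩
    · have hα := haway _ (h.decomposition.left_notMem i) j r hr
      have hβ := haway _ (h.decomposition.right_notMem i) j r hr
      simp only [mem_Ioo, not_and, not_lt] at hα hβ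
      refine ⟨by linarith [hα hcon.1], ?_⟩
      by_contra! hlt
      linarith [hβ (by linarith)]
  refine ⟨_, _, IsPrimitiveOn.sum Finset.univ fun i => (hχ i).mul isOpen_univ (hw i),
    fun r => ?_, fun j r hr => ?_, ?_⟩
  · refine (Finset.abs_sum_le_sum_abs _ _).trans ?_
    refine (Finset.sum_le_card_nsmul _ _ B fun i _ => ?_).trans (by simp)
    rw [abs_mul]
    exact (mul_le_of_le_one_left (abs_nonneg _) (h1 i r)).trans (hB i r)
  · rw [Finset.sum_eq_single j, hone j r (hcore j r hr) hr, one_mul]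
    · intro i _ hij
      rw [hχz i j r hij hr, zero_mul]
    · simp
  · set K : ℝ≥0∞ := (Fintype.card ι : ℝ≥0∞) ^ (p - 1) * ENNReal.ofReal B ^ p
    have hK : K ≠ ⊤ := ENNReal.mul_ne_top (ENNReal.rpow_ne_top_of_nonneg hp1 (by simp))
      (ENNReal.rpow_ne_top_of_nonneg hp.le (by simp))
    have hkm : ∀ i, AEMeasurable (fun r => ‖k i r‖ₑ ^ p * radialWeight d η' r) volume := by
      intro i
      have : AEStronglyMeasurable (k i) volume := by
        simpa using (hχ i).aestronglyMeasurable isOpen_univ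
      exact (this.enorm.pow_const _).mul hm.aemeasurable
    -- On `(s_j, t_j]` every cut-off is constant and only the `j`-th is nonzero, so the derivative
    -- is `g`. Off these intervals the frozen profiles have derivative zero, and only the
    -- derivatives of the cut-offs, times values bounded by `B`, remain.
    have hpt : ∀ r, ‖∑ i, (k i r * w i r + χ i r * (Ioc (s i) (t i)).indicator g r)‖ₑ ^ p *
        radialWeight d η' r ≤ (goodRadii p η a b).indicator
          (fun r => ‖g r‖ₑ ^ p * radialWeight d η' r) r +
          K * ∑ i, ‖k i r‖ₑ ^ p * radialWeight d η' r := by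
      intro r
      by_cases hr : ∃ j, r ∈ Ioc (s j) (t j)
      · obtain ⟨j, hj⟩ := hr
        have hj' : r ∈ Icc (α j + δ) (β j - δ) :=
          ⟨(hs j).trans hj.1.le, hj.2.trans (ht j)⟩
        have e : ∑ i, (k i r * w i r + χ i r * (Ioc (s i) (t i)).indicator g r) = g r := by
          rw [Finset.sum_eq_single j, hkz j j r hj', hone j r (hcore j r hj') hj',
            indicator_of_mem hj]
          · ring
          · intro i _ hij
            rw [hkz i j r hj', hχz i j r hij hj']; ring
          · simp
        rw [e, indicator_of_mem (h.decomposition.subset j (hsub j (Ioc_subset_Icc_self hj)))]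
        exact le_self_add
      · push Not at hr
        have e : ∑ i, (k i r * w i r + χ i r * (Ioc (s i) (t i)).indicator g r) =
            ∑ i, k i r * w i r := by
          refine Finset.sum_congr rfl fun i _ => ?_
          rw [indicator_of_notMem (hr i)]; ring
        rw [e]
        refine le_trans ?_ le_add_self
        rw [← Finset.sum_mul, ← mul_assoc]
        refine mul_le_mul_left ((enorm_sum_rpow_le _ _ h.one_lt.le).trans ?_) _
        rw [Finset.card_univ, mul_assoc]
        refine mul_le_mul_right ?_ _
        rw [Finset.mul_sum]
        refine Finset.sum_le_sum fun i _ => ?_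
        rw [enorm_mul, ENNReal.mul_rpow_of_nonneg _ _ hp.le, mul_comm]
        refine mul_le_mul_left (ENNReal.rpow_le_rpow ?_ hp.le) _
        rw [Real.enorm_eq_ofReal_abs]
        exact ENNReal.ofReal_le_ofReal (hB i r)
    refine (lintegral_mono hpt).trans ?_
    rw [lintegral_add_right' _ ((Finset.aemeasurable_fun_sum _ fun i _ =>
      (hkm i).restrict).const_mul K), lintegral_const_mul' _ _ hK,
      lintegral_finsetSum' _ fun i _ => (hkm i).restrict]
    refine add_le_add ?_ (mul_le_mul_right ?_ _)
    · rw [← lintegral_indicator isOpen_goodRadii.measurableSet]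
      exact setLIntegral_le_lintegral _ _
    · refine (Finset.sum_le_card_nsmul _ _ _ fun i _ =>
        (setLIntegral_le_lintegral _ _).trans (hE i)).trans ?_
      rw [nsmul_eq_mul, Finset.card_univ]

theorem exists_bound_clamp [Finite ι] (h : IsSetting p η η' a b α β Ω) {v g : ℝ → ℝ}
    (hv : IsPrimitiveOn v g (goodRadii p η a b)) {s t : ι → ℝ} (hs : ∀ i, α i < s i)
    (hst : ∀ i, s i ≤ t i) (ht : ∀ i, t i < β i) :
    ∃ B, ∀ i r, |v (max (s i) (min r (t i)))| ≤ B := by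
  have hb : ∀ i, ∃ B, ∀ r ∈ Icc (s i) (t i), ‖v r‖ ≤ B := fun i =>
    isCompact_Icc.exists_bound_of_continuousOn ((hv.continuousOn isOpen_goodRadii).mono
      fun r hr => h.decomposition.subset i ⟨(hs i).trans_le hr.1, hr.2.trans_lt (ht i)⟩)
  choose C hC using hb
  obtain ⟨B, hB⟩ := (finite_range C).bddAbove
  exact ⟨B, fun i r => (hC i _ ⟨le_max_left _ _, max_le (hst i) (min_le_right _ _)⟩).trans
    (hB (mem_range_self i))⟩

variable [NeZero d] [Finite ι] [Fact (1 ≤ ENNReal.ofReal p)]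

/-- Recovery sequence for a profile that is constant near the end points of the components. -/
theorem relaxedF_le_of_clamp (h : IsSetting p η η' a b α β Ω) {v g z : ℝ → ℝ}
    (hv : IsPrimitiveOn v g (goodRadii p η a b)) {s t : ι → ℝ} (hs : ∀ i, α i < s i)
    (hst : ∀ i, s i ≤ t i) (ht : ∀ i, t i < β i)
    (hz : ∀ i, ∀ r ∈ Ioo (α i) (β i), z r = v (max (s i) (min r (t i))))
    {f : X p η α β Ω} (hf : f =ᵐ[auxMeasure p η α β Ω] fun x => z ‖x‖) :
    relaxedF p η a b α β Ω f ≤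
      sphereMass (Space d) * ∫⁻ r in goodRadii p η a b, ‖g r‖ₑ ^ p * radialWeight d η' r := by
  have := Fintype.ofFinite ι
  have hp : 0 < p := by linarith [h.one_lt]
  have hp1 : 0 ≤ p - 1 := by linarith [h.one_lt]
  obtain ⟨B, hB⟩ := h.exists_bound_clamp hv hs hst ht
  obtain ⟨δ, hδst, hδ⟩ : ∃ δ : ℝ, (∀ i, δ < s i - α i ∧ δ < β i - t i) ∧ 0 < δ := by
    have h1 : ∀ᶠ δ in 𝓝[>] (0 : ℝ), ∀ i, δ < s i - α i ∧ δ < β i - t i := by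
      refine eventually_all.2 fun i => nhdsWithin_le_nhds ?_
      exact (eventually_lt_nhds (sub_pos.2 (hs i))).and (eventually_lt_nhds (sub_pos.2 (ht i)))
    obtain ⟨δ, h2, h3⟩ := (h1.and self_mem_nhdsWithin).exists
    exact ⟨δ, h2, h3⟩
  have hδn : ∀ n : ℕ, 0 < δ / (n + 1) ∧ δ / (n + 1) ≤ δ := fun n =>
    ⟨by positivity, div_le_self hδ.le (by linarith [n.cast_nonneg (α := ℝ)])⟩
  have hδlim : Tendsto (fun n : ℕ => δ / (n + 1)) atTop (𝓝 0) := by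
    simpa [div_eq_mul_inv] using (tendsto_one_div_add_atTop_nhds_zero_nat (𝕜 := ℝ)).const_mul δ
  -- Both the width of the transitions and their energy bound `1/n` tend to zero. For `n = 0` the
  -- bound is `∞`, which is harmless.
  choose V G hV hVB hVz hE using fun n : ℕ => h.exists_gluing (d := d) hv hst hB (hδn n).1
    (fun i => by linarith [(hδst i).1, (hδn n).2]) (fun i => by linarith [(hδst i).2, (hδn n).2])
    (ε := (n : ℝ≥0∞)⁻¹) (by simp)
  obtain ⟨C, hC, hle⟩ := h.exists_auxWeight_le
  -- A constant dominates, as the glued profiles are uniformly bounded and the auxiliary weight is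
  -- bounded. At each good radius the sequence is eventually equal to its limit.
  obtain ⟨fn, hfn, hlim⟩ := h.exists_tendsto f
    ((h.isPrimitiveOn_clamp hv hs hst ht hz).continuousOn isOpen_goodRadii) hf
    (zn := V) (fun n => ((hV n).continuousOn isOpen_univ).mono (subset_univ _))
    (B := C ^ (p - 1) * ENNReal.ofReal (Fintype.card ι * B + B) ^ p)
    (ENNReal.mul_ne_top (ENNReal.rpow_ne_top_of_nonneg hp1 hC)
      (ENNReal.rpow_ne_top_of_nonneg hp.le (by simp)))
    (fun n x hx => by
      obtain ⟨i, hi⟩ := h.exists_mem hx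
      refine mul_le_mul' (ENNReal.rpow_le_rpow (hle x) hp1) (ENNReal.rpow_le_rpow ?_ hp.le)
      rw [Real.enorm_eq_ofReal_abs, hz i _ hi]
      exact ENNReal.ofReal_le_ofReal ((abs_sub _ _).trans (add_le_add (hVB n _) (hB i _))))
    (fun r hr => by
      obtain ⟨i, hi⟩ := h.exists_mem hr
      refine tendsto_const_nhds.congr' ?_
      filter_upwards [hδlim.eventually (eventually_lt_nhds (sub_pos.2 hi.1)),
        hδlim.eventually (eventually_lt_nhds (sub_pos.2 hi.2))] with n h1 h2
      rw [hz i r hi, hVz n i r ⟨by linarith, by linarith⟩])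
  refine lscEnvelope_le_of_tendsto hlim fun c' hc' => ?_
  set K : ℝ≥0∞ := (Fintype.card ι : ℝ≥0∞) ^ (p - 1) * ENNReal.ofReal B ^ p
  have hK : K ≠ ⊤ := ENNReal.mul_ne_top (ENNReal.rpow_ne_top_of_nonneg hp1 (by simp))
    (ENNReal.rpow_ne_top_of_nonneg hp.le (by simp))
  have h2 : (2 : ℝ≥0∞) ^ (p - 1) ≠ ⊤ := ENNReal.rpow_ne_top_of_nonneg hp1 (by simp)
  have hεlim : Tendsto (fun n : ℕ => sphereMass (Space d) *
      ((∫⁻ r in goodRadii p η a b, ‖g r‖ₑ ^ p * radialWeight d η' r) +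
        K * (Fintype.card ι * (2 ^ (p - 1) * ((n : ℝ≥0∞)⁻¹ + (n : ℝ≥0∞)⁻¹))))) atTop
      (𝓝 (sphereMass (Space d) *
        ((∫⁻ r in goodRadii p η a b, ‖g r‖ₑ ^ p * radialWeight d η' r) +
          K * (Fintype.card ι * (2 ^ (p - 1) * (0 + 0)))))) :=
    ENNReal.Tendsto.const_mul (tendsto_const_nhds.add (ENNReal.Tendsto.const_mul
      (ENNReal.Tendsto.const_mul (ENNReal.Tendsto.const_mul
        (ENNReal.tendsto_inv_nat_nhds_zero.add ENNReal.tendsto_inv_nat_nhds_zero) (Or.inr h2))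
        (Or.inr (by simp))) (Or.inr hK))) (Or.inr sphereMass_ne_top)
  simp only [add_zero, mul_zero] at hεlim
  filter_upwards [hεlim.eventually (eventually_lt_nhds hc')] with n hn
  exact (lscEnvelope_le _).trans ((h.F_le (hV n) (hfn n)).trans
    ((mul_le_mul_right (hE n) _).trans hn.le))

/-- The relaxed functional is bounded above by the energy of any primitive profile. -/
theorem relaxedF_le (h : IsSetting p η η' a b α β Ω) {v g : ℝ → ℝ}
    (hv : IsPrimitiveOn v g (goodRadii p η a b)) {f : X p η α β Ω}
    (hf : f =ᵐ[auxMeasure p η α β Ω] fun x => v ‖x‖) :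
    relaxedF p η a b α β Ω f ≤
      sphereMass (Space d) * ∫⁻ r in goodRadii p η a b, ‖g r‖ₑ ^ p * radialWeight d η' r := by
  have hp1 : 0 ≤ p - 1 := by linarith [h.one_lt]
  by_cases hE : ∫⁻ r in goodRadii p η a b, ‖g r‖ₑ ^ p * radialWeight d η' r = ⊤
  · rw [hE, ENNReal.mul_top sphereMass_ne_zero]; exact le_top
  -- The shift by two gives `q n ≤ 1/2`, so the mid radius is never frozen beyond: it lies between
  -- the two clamping radii.
  set q : ℕ → ℝ := fun n => 1 / ((n : ℝ) + 2)
  have hq : ∀ n, 0 < q n ∧ q n ≤ 1 / 2 := fun n =>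
    ⟨by positivity, one_div_le_one_div_of_le two_pos (by linarith [n.cast_nonneg (α := ℝ)])⟩
  have hqlim : Tendsto q atTop (𝓝 0) := by
    have := tendsto_one_div_add_atTop_nhds_zero_nat (𝕜 := ℝ)
    refine squeeze_zero (fun n => (hq n).1.le) (fun n => ?_) this
    exact one_div_le_one_div_of_le (by positivity) (by linarith)
  have hL : ∀ i, 0 < β i - α i := fun i => sub_pos.2 (h.decomposition.lt i)
  have hs : ∀ n i, α i < α i + q n * (β i - α i) := fun n i => by
    have := mul_pos (hq n).1 (hL i); linarith
  have ht : ∀ n i, β i - q n * (β i - α i) < β i := fun n i => by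
    have := mul_pos (hq n).1 (hL i); linarith
  have hmid : ∀ n i, α i + q n * (β i - α i) ≤ (α i + β i) / 2 ∧
      (α i + β i) / 2 ≤ β i - q n * (β i - α i) := fun n i => by
    have := mul_le_mul_of_nonneg_right (hq n).2 (hL i).le
    constructor <;> linarith
  choose z hz using fun n => h.decomposition.exists_eqOn fun i r =>
    v (max (α i + q n * (β i - α i)) (min r (β i - q n * (β i - α i))))
  have hst : ∀ n i, α i + q n * (β i - α i) ≤ β i - q n * (β i - α i) := fun n i =>
    (hmid n i).1.trans (hmid n i).2
  -- The profile may be unbounded near the end points, so domination comes from the Hardy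
  -- inequality: the clamped radius lies between `|x|` and the mid radius.
  obtain ⟨fn, hfn, hlim⟩ := h.exists_tendsto f (hv.continuousOn isOpen_goodRadii) hf (zn := z)
    (fun n => (h.isPrimitiveOn_clamp hv (hs n) (hst n) (ht n) (hz n)).continuousOn isOpen_goodRadii)
    (ENNReal.mul_ne_top hE (ENNReal.rpow_ne_top_of_nonneg hp1
      (ENNReal.inv_ne_top.2 (sphereMass_ne_zero (E := Space d)))))
    (fun n x hx => by
      obtain ⟨i, hi⟩ := h.exists_mem hx
      rw [hz n i _ hi]
      refine h.hardy hv hi ?_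
      obtain ⟨h1, h2⟩ := hmid n i
      rw [mem_uIcc]
      grind)
    (fun r hr => by
      obtain ⟨i, hi⟩ := h.exists_mem hr
      have h3 : Tendsto (fun n => q n * (β i - α i)) atTop (𝓝 0) := by
        simpa using hqlim.mul_const (β i - α i)
      refine tendsto_const_nhds.congr' ?_
      filter_upwards [h3.eventually (eventually_lt_nhds (sub_pos.2 hi.1)),
        h3.eventually (eventually_lt_nhds (sub_pos.2 hi.2))] with n h1 h2
      rw [hz n i r hi, min_eq_left (by linarith), max_eq_right (by linarith)])
  exact lscEnvelope_le_of_tendsto hlim fun c' hc' => Eventually.of_forall fun n =>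
    (h.relaxedF_le_of_clamp hv (hs n) (hst n) (ht n) (hz n) (hfn n)).trans hc'.le

theorem relaxedF_eq_weakEnergy (h : IsSetting p η η' a b α β Ω) (f : X p η α β Ω) :
    relaxedF p η a b α β Ω f = weakEnergy p η η' a b α β Ω f :=
  le_antisymm (le_iInf fun _ => le_iInf fun _ => le_iInf fun hv => le_iInf fun hf =>
    h.relaxedF_le hv hf) (h.weakEnergy_le_relaxedF f)

end IsSetting

/-! ### Identification of the domain and of the energy -/

namespace IsSetting

variable {d : ℕ} {ι : Type*} {p : ℝ} {η η' : ℝ → ℝ} {a b : ℝ} {α β : ι → ℝ} {Ω : Set (Space d)}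

theorem ae_eq_of_goodSet (h : IsSetting p η η' a b α β Ω) {u : Space d → ℝ} {v : ℝ → ℝ}
    (hu : ∀ x ∈ goodSet p η a b Ω, u x = v ‖x‖) :
    u =ᵐ[volume.restrict {x | ‖x‖ ∈ goodRadii p η a b}] fun x => v ‖x‖ := by
  refine (ae_restrict_iff' measurableSet_good).2 (Eventually.of_forall fun x hx => hu x ?_)
  rw [h.goodSet_eq]; exact hx

/-- The members of `Dom` have profiles that are primitives of finite energy. -/
theorem exists_profile [NeZero d] [Finite ι] (h : IsSetting p η η' a b α β Ω) {u : Space d → ℝ}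
    (hu : u ∈ Dom p η a b Ω) :
    ∃ v g, IsPrimitiveOn v g (goodRadii p η a b) ∧
      u =ᵐ[volume.restrict {x | ‖x‖ ∈ goodRadii p η a b}] (fun x => v ‖x‖) ∧
      ∫⁻ r in goodRadii p η a b, ‖g r‖ₑ ^ p * radialWeight d η' r ≠ ⊤ := by
  obtain ⟨-, v, ⟨g, hvg, hE⟩, huv⟩ := hu
  obtain ⟨w, hwv, hw⟩ := h.decomposition.exists_isPrimitiveOn h.goodRadii_subset_Ioi hvg
  rw [h.lintegral_domEta] at hE
  refine ⟨w, g, hw, (h.ae_eq_of_goodSet huv).trans ?_, hE.ne⟩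
  exact (quasiMeasurePreserving_norm (E := Space d) _).ae hwv.symm

variable [NeZero d] [Finite ι]

theorem hasWeakGradientOn (h : IsSetting p η η' a b α β Ω) {u : Space d → ℝ} {v g : ℝ → ℝ}
    (hv : IsPrimitiveOn v g (goodRadii p η a b))
    (hu : u =ᵐ[volume.restrict {x | ‖x‖ ∈ goodRadii p η a b}] fun x => v ‖x‖) :
    HasWeakGradientOn u (radialField g) (goodSet p η a b Ω) := by
  rw [h.goodSet_eq]
  exact (h.decomposition.hasWeakGradientOn h.goodRadii_subset_Ioi hv).congr hu.symm .rfl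

theorem ae_eq_iff (h : IsSetting p η η' a b α β Ω) {u u' : Space d → ℝ} :
    u =ᵐ[auxMeasure p η α β Ω] u' ↔
      u =ᵐ[volume.restrict {x | ‖x‖ ∈ goodRadii p η a b}] u' :=
  h.ae_auxMeasure_iff.trans (ae_restrict_iff' measurableSet_good).symm

theorem memLp_of_mem_dom (h : IsSetting p η η' a b α β Ω) {u : Space d → ℝ}
    (hu : u ∈ Dom p η a b Ω) : MemLp u (ENNReal.ofReal p) (auxMeasure p η α β Ω) := by
  obtain ⟨v, g, hv, huv, hE⟩ := h.exists_profile hu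
  exact (memLp_congr_ae (h.ae_eq_iff.2 huv)).2 (h.memLp_of_isPrimitiveOn hv hE)

theorem lintegral_weakGradient (h : IsSetting p η η' a b α β Ω) {u : Space d → ℝ} {v g : ℝ → ℝ}
    (hv : IsPrimitiveOn v g (goodRadii p η a b))
    (hu : u =ᵐ[volume.restrict {x | ‖x‖ ∈ goodRadii p η a b}] fun x => v ‖x‖)
    {G : Space d → Space d} (hG : HasWeakGradientOn u G (goodSet p η a b Ω)) :
    ∫⁻ x in goodSet p η a b Ω, ‖G x‖ₑ ^ p * ENNReal.ofReal (η ‖x‖) =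
      sphereMass (Space d) * ∫⁻ r in goodRadii p η a b, ‖g r‖ₑ ^ p * radialWeight d η' r := by
  have hopen : IsOpen (goodSet p η a b Ω) := by
    rw [h.goodSet_eq]; exact isOpen_norm_preimage isOpen_goodRadii
  have h1 := hG.ae_unique hopen (h.hasWeakGradientOn hv hu)
  rw [← h.lintegral_radialField (hv.aestronglyMeasurable isOpen_goodRadii), ← h.goodSet_eq]
  exact lintegral_congr_ae (h1.mono fun x hx => by simp only [hx])

/-- The infimum runs over equal values: every primitive profile of the class produces a weak
gradient of `u`, and this is unique up to null sets. -/
theorem weakEnergy_eq (h : IsSetting p η η' a b α β Ω) {f : X p η α β Ω} {u : Space d → ℝ}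
    (hu : u ∈ Dom p η a b Ω) (hf : f =ᵐ[auxMeasure p η α β Ω] u) {G : Space d → Space d}
    (hG : HasWeakGradientOn u G (goodSet p η a b Ω)) :
    weakEnergy p η η' a b α β Ω f =
      ∫⁻ x in goodSet p η a b Ω, ‖G x‖ₑ ^ p * ENNReal.ofReal (η ‖x‖) := by
  obtain ⟨v, g, hv, huv, -⟩ := h.exists_profile hu
  refine le_antisymm ?_ (le_iInf fun w => le_iInf fun k => le_iInf fun hw => le_iInf fun hfw => ?_)
  · rw [h.lintegral_weakGradient hv huv hG]
    exact weakEnergy_le hv (hf.trans (h.ae_eq_iff.2 huv))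
  · rw [h.lintegral_weakGradient hw (h.ae_eq_iff.1 (hf.symm.trans hfw)) hG]

theorem mem_domX_iff (h : IsSetting p η η' a b α β Ω) {f : X p η α β Ω} :
    f ∈ DomX p η a b α β Ω ↔ weakEnergy p η η' a b α β Ω f < ⊤ := by
  constructor
  · rintro ⟨u, hu, hf⟩
    obtain ⟨v, g, hv, huv, hE⟩ := h.exists_profile hu
    exact (weakEnergy_le hv (hf.trans (h.ae_eq_iff.2 huv))).trans_lt
      (ENNReal.mul_lt_top sphereMass_ne_top.lt_top hE.lt_top)
  · intro hlt
    obtain ⟨v, g, hv, hf, hE⟩ := exists_of_weakEnergy_lt hlt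
    have hEg : ∫⁻ r in goodRadii p η a b, ‖g r‖ₑ ^ p * radialWeight d η' r ≠ ⊤ := by
      intro htop
      rw [htop, ENNReal.mul_top sphereMass_ne_zero] at hE
      exact lt_irrefl _ hE
    have hm : AEStronglyMeasurable (fun x : Space d => v ‖x‖)
        (volume.restrict {x | ‖x‖ ∈ goodRadii p η a b}) :=
      ((hv.continuousOn isOpen_goodRadii).comp continuous_norm.continuousOn
        fun _ hx => hx).aestronglyMeasurable measurableSet_good
    have hind : ∀ x ∈ goodSet p η a b Ω,
        {x : Space d | ‖x‖ ∈ goodRadii p η a b}.indicator (fun x => v ‖x‖) x = v ‖x‖ :=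
      fun x hx => indicator_of_mem (s := {x : Space d | ‖x‖ ∈ goodRadii p η a b}) hx.2 _
    -- Away from the good radii `v` is arbitrary and `v(|x|)` may fail to be measurable. Cutting it
    -- off there leaves the class unchanged.
    refine ⟨{x : Space d | ‖x‖ ∈ goodRadii p η a b}.indicator fun x => v ‖x‖, ⟨?_, v,
      ⟨g, h.decomposition.hasWeakGradientOn_real h.goodRadii_subset_Ioi hv, ?_⟩, hind⟩, ?_⟩
    · exact ((aestronglyMeasurable_indicator_iff measurableSet_good).2 hm).restrict
    · rw [h.lintegral_domEta]; exact hEg.lt_top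
    · exact hf.trans (h.ae_eq_iff.2 (h.ae_eq_of_goodSet hind).symm)

end IsSetting

/-! ### Conclusion -/

theorem exists_isSetting {d : ℕ} {ι : Type*} {p : ℝ} (hp : 1 < p) {a b : ℝ} (ha : 0 ≤ a)
    (hab : a < b) {Ω : Set (Space d)} (hΩ : Ω = {x | ‖x‖ < b} ∨ Ω = {x | a < ‖x‖ ∧ ‖x‖ < b})
    {η : ℝ → ℝ} (hη_int : LocallyIntegrableOn η (Ici 0))
    (hη_supp : ∀ᵐ r ∂(volume.restrict (Ici (0 : ℝ))), r ∉ Ioo a b → η r = 0) {α β : ι → ℝ}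
    (hdec : IsIntervalDecomposition (goodRadii p η a b) α β) :
    ∃ η', IsSetting p η η' a b α β Ω := by
  have hm := hη_int.aestronglyMeasurable
  have hsub : Ioi (0 : ℝ) ⊆ Ici 0 := Ioi_subset_Ici_self
  refine ⟨hm.mk, hp, ha, hab, ?_, ?_, hm.stronglyMeasurable_mk.measurable,
    ae_restrict_of_ae_restrict_of_subset hsub hm.ae_eq_mk,
    ae_restrict_of_ae_restrict_of_subset hsub hη_supp, hdec⟩
  · rcases hΩ with rfl | rfl
    · exact fun x hx => hx.2
    · exact fun x hx => hx
  · rcases hΩ with rfl | rfl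
    · exact measurableSet_lt measurable_norm measurable_const
    · exact measurable_norm measurableSet_Ioo

end RadialRelaxation

theorem theorem4p1 (d : ℕ) (hd : 1 ≤ d) (p : ℝ) (hp : 1 < p) [Fact (1 ≤ ENNReal.ofReal p)]
    (a b : ℝ) (ha : 0 ≤ a) (hab : a < b)
    (Ω : Set (RadialRelaxation.Space d))
    (hΩ : Ω = {x | ‖x‖ < b} ∨ Ω = {x | a < ‖x‖ ∧ ‖x‖ < b})
    (η : ℝ → ℝ)
    (hη_int : LocallyIntegrableOn η (Ici 0))
    (hη_nonneg : ∀ᵐ r ∂(volume.restrict (Ici (0 : ℝ))), 0 ≤ η r)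
    (hη_supp : ∀ᵐ r ∂(volume.restrict (Ici (0 : ℝ))), r ∉ Ioo a b → η r = 0)
    (N : ℕ) (hN : 1 ≤ N) (α β : Fin N → ℝ)
    (hdec : RadialRelaxation.IsIntervalDecomposition (RadialRelaxation.goodRadii p η a b) α β) :
    (∀ u ∈ RadialRelaxation.Dom p η a b Ω,
      MemLp u (ENNReal.ofReal p) (RadialRelaxation.auxMeasure p η α β Ω)) ∧
    {f | RadialRelaxation.relaxedF p η a b α β Ω f < ⊤} =
      RadialRelaxation.DomX p η a b α β Ω ∧
    (∀ (f : RadialRelaxation.X p η α β Ω), ∀ u ∈ RadialRelaxation.Dom p η a b Ω,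
      f =ᵐ[RadialRelaxation.auxMeasure p η α β Ω] u →
      (∃ G, RadialRelaxation.HasWeakGradientOn u G (RadialRelaxation.goodSet p η a b Ω)) ∧
      ∀ G, RadialRelaxation.HasWeakGradientOn u G (RadialRelaxation.goodSet p η a b Ω) →
        RadialRelaxation.relaxedF p η a b α β Ω f =
          ∫⁻ x in RadialRelaxation.goodSet p η a b Ω, ‖G x‖ₑ ^ p * ENNReal.ofReal (η ‖x‖)) ∧
    ∀ f ∉ RadialRelaxation.DomX p η a b α β Ω,
      RadialRelaxation.relaxedF p η a b α β Ω f = ⊤ := by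
  have : NeZero d := ⟨by omega⟩
  obtain ⟨η', h⟩ := RadialRelaxation.exists_isSetting hp ha hab hΩ hη_int hη_supp hdec
  refine ⟨fun u hu => h.memLp_of_mem_dom hu, ?_, fun f u hu hf => ⟨?_, fun G hG => ?_⟩,
    fun f hf => ?_⟩
  · ext f
    rw [h.mem_domX_iff, ← h.relaxedF_eq_weakEnergy]
    rfl
  · obtain ⟨v, g, hv, huv, -⟩ := h.exists_profile hu
    exact ⟨_, h.hasWeakGradientOn hv huv⟩
  · rw [h.relaxedF_eq_weakEnergy, h.weakEnergy_eq hu hf hG]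
  · rwa [h.mem_domX_iff, ← h.relaxedF_eq_weakEnergy, not_lt_top_iff] at hf
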